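/- Let $\mathbb{P}_n$ be the Pauli group on $n\ge 1$ qubits (phases are ignored when speaking of subgroups and of the dimension $|\cdot|$ of a group, i.e. its number of independent generators). Let $G\subset\mathbb{P}_n$ be a maximally commuting set of Pauli operators (commuting, of size $2^n$), and let $$H=-\sum_{P\in G}\alpha_P P+\sum_{i=1}^k\gamma_iP_i,\qquad \alpha_P,\gamma_i\in\mathbb{R},$$ where $P_1,\dots,P_k\in\mathbb{P}_n$ are arbitrary Pauli operators; let $K=\langle P_1,\dots,P_k\rangle$ and let $|K|$ be its dimension. Let $J\subseteq G$ be a subgroup of Pauli operators that commute with all elements of $K$, of dimension $n-\nu$ with $\nu\le|K|$, and let $C$ be a Clifford unitary with $CJC^\dagger=\langle Z_1,\dots,Z_{n-\nu}\rangle$ up to signs. Let $\psi$ be any (normalized) eigenstate of $H$ that is also an eigenstate of every element of $J$. Then $C|\psi\rangle=|x\rangle\otimes|\phi\rangle$ for a bitstring $x\in\{0,1\}^{n-\nu}$ and a $\nu$-qubit state $\phi$, and for every bipartition $A|B$ of the qubits the 2-Rényi entanglement entropy $S_2(\psi;A|B)=-\log_2\operatorname{Tr}(\psi_A^2)$, where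 $\psi_A$ is the reduced density matrix of $\psi$ on $A$, satisfies the following. (i) Let $\mathcal{P}_B(g_A\otimes g_B)=I\otimes g_B$ on Pauli operators modulo phases, let $n_A$ be the number of qubits in $A$, and let $|S_A|$ be the dimension of the kernel of $\mathcal{P}_B$ restricted to $J$. Let $r$ be the sum of $\langle\phi|P|\phi\rangle^2$ over those of the $4^\nu$ Pauli operators $P$ on $\nu$ qubits for which $\mathcal{P}_B(C^\dagger(I\otimes P)C)\in\mathcal{P}_B(J)$. Then $$S_2(\psi;A|B)=n_A-|S_A|-\log_2 r .$$ (ii) There is a classical algorithm that computes $S_2(\psi;A|B)$ exactly in time $O(n^3\,2^{2|K|})$. Its input consists of $n$, $\nu$, the set $A$, the bitstring $x$, the $2^\nu$ complex amplitudes of $\phi$, and the binary symplectic tableaux of $J$ (a generating set) and of $P\mapsto C^\dagger PC$. The algorithm and the constant in $O(\cdot)$ are the same for all inputs. The machine is a random access machine with unit-cost operations on words of $O(\log(n+2^\nu))$ bits and with unit-cost exact real arithmetic $+,-,\times,\div,\log_2$, without branching on real numbers. -/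

import Mathlib

open scoped Matrix
open Complex (I)

noncomputable section

/-! ### Qubits and Pauli operators -/

/-- Computational basis labels of `n` qubits. -/
abbrev Bits (n : ℕ) : Type := Fin n → Fin 2

/-- Operators on `n` qubits, as matrices in the computational basis. -/
abbrev Op (n : ℕ) : Type := Matrix (Bits n) (Bits n) ℂ

/-- Symplectic representation of the `n`-qubit Pauli operators modulo phases: the X-part and the
Z-part. Multiplication of Pauli operators modulo phases is addition of labels. -/
abbrev PauliLabel (n : ℕ) : Type := (Fin n → ZMod 2) × (Fin n → ZMod 2)

/-- The one-qubit Pauli matrix with given X-bit and Z-bit: `1`, `Z`, `X` or `Y`. -/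
def pauliOne (x z : ZMod 2) : Matrix (Fin 2) (Fin 2) ℂ :=
  if x = 0 then (if z = 0 then 1 else !![1, 0; 0, -1])
  else (if z = 0 then !![0, 1; 1, 0] else !![0, -I; I, 0])

/-- The (Hermitian) `n`-qubit Pauli operator with a given label: a tensor product of one-qubit
Pauli matrices. -/
def pauli {n : ℕ} (v : PauliLabel n) : Op n :=
  Matrix.of fun s t => ∏ i, pauliOne (v.1 i) (v.2 i) (s i) (t i)

/-- `H = H₀ + δH` with `H₀ = -∑_{P ∈ G} α_P P` and `δH = ∑ᵢ γᵢ Pᵢ`. -/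
def hamiltonian {n k : ℕ} (G : Submodule (ZMod 2) (PauliLabel n)) (α : PauliLabel n → ℝ)
    (P : Fin k → PauliLabel n) (γ : Fin k → ℝ) : Op n :=
  open Classical in
  -(∑ v : PauliLabel n, if v ∈ G then (α v : ℂ) • pauli v else 0) +
    ∑ i, (γ i : ℂ) • pauli (P i)

/-- `|K|`: the number of independent generators of the group generated by the Pauli operators
`P₁, …, P_k` (phases are ignored). -/
def groupDim {n k : ℕ} (P : Fin k → PauliLabel n) : ℕ :=
  Module.finrank (ZMod 2) (Submodule.span (ZMod 2) (Set.range P))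

/-! ### Clifford unitaries and compression -/

/-- `U P U† = ± Q` for the Pauli operators `P`, `Q` with labels `v`, `w`. -/
def ConjTo {n : ℕ} (U : Op n) (v w : PauliLabel n) : Prop :=
  U * pauli v * Uᴴ = pauli w ∨ U * pauli v * Uᴴ = -pauli w

/-- Clifford unitaries: unitaries that map Pauli operators to Pauli operators up to sign. -/
def IsClifford {n : ℕ} (U : Op n) : Prop :=
  U ∈ Matrix.unitaryGroup (Bits n) ℂ ∧ ∀ v, ∃ w, ConjTo U v w

/-- The generators `X_j` (left) and `Z_j` (right) of the Pauli group. -/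
def pauliGen {n : ℕ} : Fin n ⊕ Fin n → PauliLabel n
  | .inl j => (Pi.single j 1, 0)
  | .inr j => (0, Pi.single j 1)

/-- `T` is the binary tableau of `P ↦ C† P C`: its rows are the symplectic representations of
`C† X_j C` and `C† Z_j C`. -/
def IsTableau {n : ℕ} (C : Op n) (T : Fin n ⊕ Fin n → PauliLabel n) : Prop :=
  ∀ j, ConjTo Cᴴ (pauliGen j) (T j)

/-- `C J C†` is, up to signs, the group generated by `Z₁, …, Z_m`. -/
def MapsToZ {m ν : ℕ} (C : Op (m + ν)) (J : Submodule (ZMod 2) (PauliLabel (m + ν))) : Prop :=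
  ∀ w : PauliLabel (m + ν),
    (∃ v ∈ J, ConjTo C v w) ↔ (w.1 = 0 ∧ ∀ j : Fin ν, w.2 (Fin.natAdd m j) = 0)

/-- The product state `|x⟩ ⊗ |φ⟩`. -/
def prodState {m ν : ℕ} (x : Bits m) (φ : Bits ν → ℂ) : Bits (m + ν) → ℂ :=
  fun s => if (fun i => s (Fin.castAdd ν i)) = x then φ (fun j => s (Fin.natAdd m j)) else 0

/-! ### Rényi entropy -/

/-- The reduced density matrix `ψ_A` of the pure state `ψ`: the partial trace of `|ψ⟩⟨ψ|` over
the qubits outside `A`. -/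
def reducedDensity {n : ℕ} (ψ : Bits n → ℂ) (A : Finset (Fin n)) :
    Matrix ({i // i ∈ A} → Fin 2) ({i // i ∈ A} → Fin 2) ℂ :=
  Matrix.of fun a a' => ∑ b : {i // ¬ i ∈ A} → Fin 2,
    ψ ((Equiv.piEquivPiSubtypeProd (fun i => i ∈ A) (fun _ => Fin 2)).symm (a, b)) *
      star (ψ ((Equiv.piEquivPiSubtypeProd (fun i => i ∈ A) (fun _ => Fin 2)).symm (a', b)))

/-- `S₂(ψ; A|B) = -log₂ Tr ψ_A²`, where `B` is the complement of `A`. -/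
def renyiTwo {n : ℕ} (ψ : Bits n → ℂ) (A : Finset (Fin n)) : ℝ :=
  -Real.logb 2 (reducedDensity ψ A * reducedDensity ψ A).trace.re

/-- The projection `𝒫_B (g_A ⊗ g_B) = 1 ⊗ g_B` on labels, where `B` is the complement of `A`. -/
def projB {n : ℕ} (A : Finset (Fin n)) : PauliLabel n →ₗ[ZMod 2] PauliLabel n where
  toFun v := (fun i => if i ∈ A then 0 else v.1 i, fun i => if i ∈ A then 0 else v.2 i)
  map_add' v w := by ext i <;> by_cases h : i ∈ A <;> simp [h]
  map_smul' c v := by ext i <;> by_cases h : i ∈ A <;> simp [h]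

/-- `1 ⊗ P`: a Pauli operator acting on the last `ν` qubits. -/
def onLast (m : ℕ) {ν : ℕ} (p : PauliLabel ν) : PauliLabel (m + ν) :=
  (Fin.append 0 p.1, Fin.append 0 p.2)

/-- The (real) expectation value `⟨φ|P|φ⟩`. -/
def expectation {n : ℕ} (φ : Bits n → ℂ) (p : PauliLabel n) : ℝ :=
  (star φ ⬝ᵥ (pauli p *ᵥ φ)).re

/-- The number `r`: the sum of `⟨φ|P|φ⟩²` over all Pauli operators `P` on `ν` qubits
such that `𝒫_B` of the symplectic representation `y` of `C† P C` lies in `𝒫_B(J)`. -/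
def entropySum {m ν : ℕ} (J : Submodule (ZMod 2) (PauliLabel (m + ν))) (C : Op (m + ν))
    (φ : Bits ν → ℂ) (A : Finset (Fin (m + ν))) : ℝ :=
  open Classical in
  ∑ p : PauliLabel ν,
    if ∃ y, ConjTo Cᴴ (onLast m p) y ∧ projB A y ∈ J.map (projB A)
    then expectation φ p ^ 2 else 0

/-- The value `n_A - |S_A| - log₂ r` returned by the stabilizer algorithm, where
`|S_A| = dim ker (𝒫_B restricted to J)`. -/
def entropyValue {m ν : ℕ} (J : Submodule (ZMod 2) (PauliLabel (m + ν))) (C : Op (m + ν))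
    (φ : Bits ν → ℂ) (A : Finset (Fin (m + ν))) : ℝ :=
  (A.card : ℝ) - (Module.finrank (ZMod 2) ↥(J ⊓ LinearMap.ker (projB A)) : ℝ) -
    Real.logb 2 (entropySum J C φ A)

/-! ### The machine model: a word RAM with exact real arithmetic and a step count -/

/-- Memory: finitely many of the integer arrays and of the real arrays are named by a program. -/
structure Memory where
  word : ℕ → ℕ → ℕ
  real : ℕ → ℕ → ℝ

/-- Operations on machine words. -/
inductive WordOp
  | add | sub | mul | land | xor | shl | shr

def WordOp.eval : WordOp → ℕ → ℕ → ℕ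
  | .add, a, b => a + b
  | .sub, a, b => a - b
  | .mul, a, b => a * b
  | .land, a, b => a &&& b
  | .xor, a, b => a ^^^ b
  | .shl, a, b => a <<< b
  | .shr, a, b => a >>> b

/-- Integer expressions: literals, array entries and operations. -/
inductive WordExp
  | lit (k : ℕ)
  | get (arr : ℕ) (idx : WordExp)
  | op (o : WordOp) (e f : WordExp)

def WordExp.eval (s : Memory) : WordExp → ℕ
  | .lit k => k
  | .get a i => s.word a (i.eval s)
  | .op o e f => o.eval (e.eval s) (f.eval s)

/-- No intermediate result leaves the range `[0, W)` of a machine word. -/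
def WordExp.Ok (W : ℕ) (s : Memory) : WordExp → Prop
  | .lit k => k < W
  | .get _ i => i.Ok W s
  | .op o e f => e.Ok W s ∧ f.Ok W s ∧ o.eval (e.eval s) (f.eval s) < W

/-- Number of elementary operations in the evaluation. -/
def WordExp.cost : WordExp → ℕ
  | .lit _ => 1
  | .get _ i => i.cost + 1
  | .op _ e f => e.cost + f.cost + 1

/-- Real expressions: integers, array entries, field operations and `log₂`. -/
inductive RealExp
  | ofWord (e : WordExp)
  | get (arr : ℕ) (idx : WordExp)
  | add (e f : RealExp)
  | sub (e f : RealExp)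
  | mul (e f : RealExp)
  | div (e f : RealExp)
  | log2 (e : RealExp)

def RealExp.eval (s : Memory) : RealExp → ℝ
  | .ofWord e => (e.eval s : ℝ)
  | .get a i => s.real a (i.eval s)
  | .add e f => e.eval s + f.eval s
  | .sub e f => e.eval s - f.eval s
  | .mul e f => e.eval s * f.eval s
  | .div e f => e.eval s / f.eval s
  | .log2 e => Real.logb 2 (e.eval s)

/-- The evaluation is legal: word operations do not overflow, no division by zero and no
logarithm of a nonpositive number. -/
def RealExp.Ok (W : ℕ) (s : Memory) : RealExp → Prop
  | .ofWord e => e.Ok W s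
  | .get _ i => i.Ok W s
  | .add e f => e.Ok W s ∧ f.Ok W s
  | .sub e f => e.Ok W s ∧ f.Ok W s
  | .mul e f => e.Ok W s ∧ f.Ok W s
  | .div e f => e.Ok W s ∧ f.Ok W s ∧ f.eval s ≠ 0
  | .log2 e => e.Ok W s ∧ 0 < e.eval s

def RealExp.cost : RealExp → ℕ
  | .ofWord e => e.cost + 1
  | .get _ i => i.cost + 1
  | .add e f => e.cost + f.cost + 1
  | .sub e f => e.cost + f.cost + 1
  | .mul e f => e.cost + f.cost + 1
  | .div e f => e.cost + f.cost + 1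
  | .log2 e => e.cost + 1

/-- Programs. Branching is on comparisons of integers only. -/
inductive Prog
  | skip
  | setWord (arr : ℕ) (idx e : WordExp)
  | setReal (arr : ℕ) (idx : WordExp) (e : RealExp)
  | seq (p q : Prog)
  | ifLt (e f : WordExp) (p q : Prog)
  | whileLt (e f : WordExp) (p : Prog)

def Memory.setWord (s : Memory) (a i v : ℕ) : Memory :=
  { s with word := Function.update s.word a (Function.update (s.word a) i v) }

def Memory.setReal (s : Memory) (a i : ℕ) (v : ℝ) : Memory :=
  { s with real := Function.update s.real a (Function.update (s.real a) i v) }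

/-- `Runs W p s t s'`: with machine words in `[0, W)`, the program `p` started in the memory `s`
halts in the memory `s'` after exactly `t` elementary operations, without overflow or fault. -/
inductive Runs (W : ℕ) : Prog → Memory → ℕ → Memory → Prop
  | skip (s : Memory) : Runs W .skip s 1 s
  | setWord (s : Memory) (a : ℕ) (i e : WordExp) (hi : i.Ok W s) (he : e.Ok W s) :
      Runs W (.setWord a i e) s (i.cost + e.cost + 1) (s.setWord a (i.eval s) (e.eval s))
  | setReal (s : Memory) (a : ℕ) (i : WordExp) (e : RealExp) (hi : i.Ok W s) (he : e.Ok W s) :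
      Runs W (.setReal a i e) s (i.cost + e.cost + 1) (s.setReal a (i.eval s) (e.eval s))
  | seq {p q : Prog} {s s' s'' : Memory} {t t' : ℕ} (hp : Runs W p s t s')
      (hq : Runs W q s' t' s'') : Runs W (.seq p q) s (t + t') s''
  | ifTrue {e f : WordExp} {p q : Prog} {s s' : Memory} {t : ℕ} (he : e.Ok W s) (hf : f.Ok W s)
      (h : e.eval s < f.eval s) (hp : Runs W p s t s') :
      Runs W (.ifLt e f p q) s (e.cost + f.cost + 1 + t) s'
  | ifFalse {e f : WordExp} {p q : Prog} {s s' : Memory} {t : ℕ} (he : e.Ok W s) (hf : f.Ok W s)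
      (h : ¬ e.eval s < f.eval s) (hq : Runs W q s t s') :
      Runs W (.ifLt e f p q) s (e.cost + f.cost + 1 + t) s'
  | whileDone {e f : WordExp} {p : Prog} {s : Memory} (he : e.Ok W s) (hf : f.Ok W s)
      (h : ¬ e.eval s < f.eval s) :
      Runs W (.whileLt e f p) s (e.cost + f.cost + 1) s
  | whileStep {e f : WordExp} {p : Prog} {s s' s'' : Memory} {t t' : ℕ}
      (he : e.Ok W s) (hf : f.Ok W s) (h : e.eval s < f.eval s) (hp : Runs W p s t s')
      (hw : Runs W (.whileLt e f p) s' t' s'') :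
      Runs W (.whileLt e f p) s (e.cost + f.cost + 1 + t + t') s''

/-! ### Input format -/

/-- Column `c < 2n` of a symplectic vector, as a bit: first the X-part, then the Z-part. -/
def labelBit {n : ℕ} (v : PauliLabel n) (c : ℕ) : ℕ :=
  if h : c < n then (v.1 ⟨c, h⟩).val
  else if h : c - n < n then (v.2 ⟨c - n, h⟩).val else 0

/-- The initial memory. Integer array `0` holds `n = m + ν` and `ν`, array `1` the indicator of
`A`, array `2` the bits of `x`, arrays `3` and `4` the tableaux of `J` and of `C` (row by row,
one bit per cell, `2n` cells per row); real arrays `0` and `1` hold the real and imaginary parts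
of the `2^ν` amplitudes of `φ` (bit `j` of the index is the value of the `j`-th qubit). All other
cells are `0`. -/
def inputMemory {m ν : ℕ} (g : Fin m → PauliLabel (m + ν))
    (T : Fin (m + ν) ⊕ Fin (m + ν) → PauliLabel (m + ν)) (A : Finset (Fin (m + ν)))
    (x : Bits m) (φ : Bits ν → ℂ) : Memory where
  word
    | 0, i => if i = 0 then m + ν else if i = 1 then ν else 0
    | 1, i => if h : i < m + ν then (if (⟨i, h⟩ : Fin (m + ν)) ∈ A then 1 else 0) else 0
    | 2, i => if h : i < m then (x ⟨i, h⟩ : ℕ) else 0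
    | 3, i =>
        if h : i / (2 * (m + ν)) < m
        then labelBit (g ⟨i / (2 * (m + ν)), h⟩) (i % (2 * (m + ν))) else 0
    | 4, i =>
        if h : i / (2 * (m + ν)) < m + ν
        then labelBit (T (.inl ⟨i / (2 * (m + ν)), h⟩)) (i % (2 * (m + ν)))
        else if h : i / (2 * (m + ν)) - (m + ν) < m + ν
        then labelBit (T (.inr ⟨i / (2 * (m + ν)) - (m + ν), h⟩)) (i % (2 * (m + ν)))
        else 0
    | _, _ => 0
  real
    | 0, i => if i < 2 ^ ν then (φ fun j => if i.testBit j then 1 else 0).re else 0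
    | 1, i => if i < 2 ^ ν then (φ fun j => if i.testBit j then 1 else 0).im else 0
    | _, _ => 0

/-- The output is left in cell `0` of the real array `2`. -/
def Memory.output (s : Memory) : ℝ := s.real 2 0

end

/-! Entropy formula. The Pauli operators supported on `A` satisfy `∑ P ⊗ P = 2^(n_A) · SWAP_A`, and
`Tr ψ_A²` is the expectation of `SWAP_A` in `ψ ⊗ ψ`. Hence `2^(n_A) Tr ψ_A²` is the sum of
`⟨ψ|y|ψ⟩²` over the labels `y` with `projB A y = 0` (`trace_reducedDensity_sq`). Modulo phases,
conjugation by `C` is a linear automorphism `τ` of the labels (`IsClifford.exists_equiv`). The state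
`Cψ` is a joint eigenvector of `Z₁, …, Z_m`, so it is supported on a single bitstring `x` of the
first `m` qubits (`exists_prodState`). In `|x⟩ ⊗ |φ⟩` the squared expectation of `τ y` vanishes if
`τ y` has an X-part on the first `m` qubits. Otherwise it equals `⟨φ|p|φ⟩²`, where `p` is the part
of `τ y` on the last qubits (`sq_expectation_prodState`).

The labels `y` that belong to a given `p` form the coset `τ⁻¹(1 ⊗ p) + J`. The kernel of `projB A`
meets this coset in `2^|S_A|` points if `projB A (τ⁻¹(1 ⊗ p))` lies in the image of `J`, and in none
otherwise (`card_coset_ker`). So the sum is `2^|S_A| · r` (`sum_sq_expectation`), and taking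
logarithms gives the formula.

Algorithm. Gaussian elimination of the generators of `J`, masked to `B`, costs `O(n³)`. It yields
the rank of `projB A` on `J`, which is `m - |S_A|`, and a linear map whose kernel is `projB A (J)`
(`IsEliminated.mem_span_iff`). Each of the `4^ν` membership tests then costs `O(n²)`: a combination
of tableau rows is formed and reduced. For a fixed X-part `a`, the squared expectations for all
Z-parts are squared moduli of one Walsh–Hadamard transform of `i ↦ conj (φ i) * φ (i + a)`
(`sq_expectation_eq_walsh`), at cost `O(ν 2^ν)`. The outcome of a test is a bit that enters the sum
as a factor `1 - bit`. The total is `O(n³ 4^ν)`, and `ν ≤ |K|`.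

The program is verified with a Hoare-style calculus: `Spec` asserts termination within a budget
together with a postcondition, `Spec.for` is the loop rule, and each subroutine has its own `_spec`
lemma. -/

/-! ### Total correctness with a time bound -/

/-- Started in `s`, the program `p` halts within `T` operations in a memory satisfying `Q`. -/
def Spec (W : ℕ) (p : Prog) (s : Memory) (T : ℕ) (Q : Memory → Prop) : Prop :=
  ∃ t s', Runs W p s t s' ∧ t ≤ T ∧ Q s'

namespace Spec

variable {W : ℕ} {s : Memory} {Q : Memory → Prop}

theorem skip (h : Q s) : Spec W .skip s 1 Q := ⟨1, s, .skip s, le_rfl, h⟩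

theorem setWord {a : ℕ} {i e : WordExp} {T : ℕ} (hi : i.Ok W s) (he : e.Ok W s)
    (h : Q (s.setWord a (i.eval s) (e.eval s))) (hT : i.cost + e.cost + 1 ≤ T) :
    Spec W (.setWord a i e) s T Q :=
  ⟨_, _, .setWord s a i e hi he, hT, h⟩

theorem setReal {a : ℕ} {i : WordExp} {e : RealExp} {T : ℕ} (hi : i.Ok W s) (he : e.Ok W s)
    (h : Q (s.setReal a (i.eval s) (e.eval s))) (hT : i.cost + e.cost + 1 ≤ T) :
    Spec W (.setReal a i e) s T Q :=
  ⟨_, _, .setReal s a i e hi he, hT, h⟩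

theorem mono {p : Prog} {T T' : ℕ} {Q' : Memory → Prop} (h : Spec W p s T Q) (hT : T ≤ T')
    (hQ : ∀ s', Q s' → Q' s') : Spec W p s T' Q' := by
  obtain ⟨t, s', hr, ht, hq⟩ := h
  exact ⟨t, s', hr, ht.trans hT, hQ _ hq⟩

theorem seq {p q : Prog} {T T' : ℕ} {R : Memory → Prop} (hp : Spec W p s T R)
    (hq : ∀ s', R s' → Spec W q s' T' Q) : Spec W (.seq p q) s (T + T') Q := by
  obtain ⟨t, s', hr, ht, hR⟩ := hp
  obtain ⟨t', s'', hr', ht', hQ⟩ := hq s' hR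
  exact ⟨_, _, .seq hr hr', by omega, hQ⟩

theorem ifLt {e f : WordExp} {p q : Prog} {T T' : ℕ} (he : e.Ok W s) (hf : f.Ok W s)
    (hp : e.eval s < f.eval s → Spec W p s T Q) (hq : ¬ e.eval s < f.eval s → Spec W q s T Q)
    (hT : e.cost + f.cost + 1 + T ≤ T') :
    Spec W (.ifLt e f p q) s T' Q := by
  by_cases h : e.eval s < f.eval s
  · obtain ⟨t, s', hr, ht, hQ⟩ := hp h
    exact ⟨_, _, .ifTrue he hf h hr, by omega, hQ⟩
  · obtain ⟨t, s', hr, ht, hQ⟩ := hq h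
    exact ⟨_, _, .ifFalse he hf h hr, by omega, hQ⟩

end Spec

/-- The scalar variable stored in cell `0` of an array. -/
abbrev WordExp.var (a : ℕ) : WordExp := .get a (.lit 0)

/-- `for v = 0, …, bound - 1 do body`. -/
def Prog.for (v : ℕ) (bound : WordExp) (body : Prog) : Prog :=
  .seq (.setWord v (.lit 0) (.lit 0))
    (.whileLt (.var v) bound
      (.seq body (.setWord v (.lit 0) (.op .add (.var v) (.lit 1)))))

theorem Memory.word_setWord (s : Memory) (a i v b : ℕ) :
    (s.setWord a i v).word b = if b = a then Function.update (s.word a) i v else s.word b := by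
  simp only [Memory.setWord, Function.update_apply]

theorem Memory.real_setReal (s : Memory) (a i : ℕ) (v : ℝ) (b : ℕ) :
    (s.setReal a i v).real b = if b = a then Function.update (s.real a) i v else s.real b := by
  simp only [Memory.setReal, Function.update_apply]

@[simp] theorem Memory.word_setReal (s : Memory) (a i : ℕ) (v : ℝ) :
    (s.setReal a i v).word = s.word := rfl

@[simp] theorem Memory.real_setWord (s : Memory) (a i v : ℕ) :
    (s.setWord a i v).real = s.real := rfl

/-- The invariant must survive any write to the counter (`hframe`), since the loop itself resets and
increments it. The bound is re-evaluated in every round, so its value must follow from the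
invariant. Per round, `bound.cost + 3` pays for the test and `6` for the increment. The condition `B
< W` makes the last increment, to `B`, legal. -/
theorem Spec.for {W : ℕ} {s : Memory} (v : ℕ) (bound : WordExp) (body : Prog)
    (B T T' : ℕ) (Inv : ℕ → Memory → Prop) (hBW : B < W) (hW : 1 < W)
    (hbound : ∀ k s, k ≤ B → Inv k s → bound.Ok W s ∧ bound.eval s = B)
    (hframe : ∀ k s x, Inv k s → Inv k (s.setWord v 0 x))
    (init : Inv 0 s)
    (step : ∀ k s, k < B → Inv k s → s.word v 0 = k →
      Spec W body s T fun s' => s'.word v 0 = k ∧ Inv (k + 1) s')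
    (hT : B * (T + bound.cost + 9) + bound.cost + 7 ≤ T') :
    Spec W (.for v bound body) s T' (fun s' => Inv B s' ∧ s'.word v 0 = B) := by
  have loop : ∀ d k s, k + d = B → Inv k s → s.word v 0 = k →
      Spec W (.whileLt (.var v) bound
        (.seq body (.setWord v (.lit 0) (.op .add (.var v) (.lit 1))))) s
        (d * (T + bound.cost + 9) + bound.cost + 3) (fun s' => Inv B s' ∧ s'.word v 0 = B) := by
    intro d
    induction d with
    | zero =>
      intro k s hk hI hv
      obtain rfl : k = B := by omega
      obtain ⟨hok, heq⟩ := hbound _ _ le_rfl hI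
      refine ⟨_, s, .whileDone (by simp [WordExp.Ok]; omega) hok ?_, ?_, hI, hv⟩
      · simp [WordExp.eval, heq, hv]
      · simp [WordExp.cost]; omega
    | succ d ih =>
      intro k s hk hI hv
      obtain ⟨hok, heq⟩ := hbound k s (by omega) hI
      obtain ⟨t, s', hr, ht, hv', hI'⟩ := step k s (by omega) hI hv
      have hI'' := hframe _ _ (k + 1) hI'
      obtain ⟨t', s'', hr', ht', hQ⟩ := ih (k + 1) (s'.setWord v 0 (k + 1)) (by omega) hI''
        (by simp [Memory.word_setWord])
      have hset : Runs W (.setWord v (.lit 0) (.op .add (.var v) (.lit 1))) s' 6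
          (s'.setWord v 0 (k + 1)) := by
        have := Runs.setWord (W := W) s' v (.lit 0) (.op .add (.var v) (.lit 1))
          (by simp [WordExp.Ok]; omega) (by simp [WordExp.Ok, WordExp.eval, WordOp.eval, hv']; omega)
        simpa [WordExp.eval, WordOp.eval, hv', WordExp.cost] using this
      refine ⟨_, s'', .whileStep (by simp [WordExp.Ok]; omega) hok ?_ (.seq hr hset) hr', ?_, hQ⟩
      · simp [WordExp.eval, heq, hv]; omega
      · simp only [WordExp.cost]
        have : (d + 1) * (T + bound.cost + 9) = d * (T + bound.cost + 9) + (T + bound.cost + 9) := by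
          ring
        omega
  have h0 : Spec W (.setWord v (.lit 0) (.lit 0)) s 3
      (fun s' => Inv 0 s' ∧ s'.word v 0 = 0) := by
    refine Spec.setWord (by simp [WordExp.Ok]; omega) (by simp [WordExp.Ok]; omega) ?_ ?_
    · exact ⟨hframe _ _ _ init, by simp [Memory.word_setWord, WordExp.eval]⟩
    · simp [WordExp.cost]
  refine (Spec.seq h0 fun s' hs' => loop B 0 s' (by omega) hs'.1 hs'.2).mono ?_ fun _ h => h
  omega

/-! ### Loops that overwrite a segment of an array -/

/-- The array `f` with the segment of length `B` at `base` overwritten by `g`. -/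
def segUpdate {α : Type*} (f : ℕ → α) (base B : ℕ) (g : ℕ → α) : ℕ → α :=
  fun i => if base ≤ i ∧ i < base + B then g (i - base) else f i

theorem segUpdate_zero {α : Type*} (f : ℕ → α) (base : ℕ) (g : ℕ → α) :
    segUpdate f base 0 g = f := by
  funext i
  simp only [segUpdate]
  rw [if_neg (by omega)]

theorem segUpdate_succ {α : Type*} (f : ℕ → α) (base k : ℕ) (g : ℕ → α) :
    Function.update (segUpdate f base k g) (base + k) (g k) = segUpdate f base (k + 1) g := by
  funext i
  simp only [segUpdate, Function.update_apply]
  by_cases h : i = base + k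
  · subst h
    simp
  · rw [if_neg h]
    by_cases h' : base ≤ i ∧ i < base + k
    · rw [if_pos h', if_pos (by omega)]
    · rw [if_neg h', if_neg (by omega)]

theorem segUpdate_of_lt {α : Type*} (f : ℕ → α) {base B : ℕ} (g : ℕ → α) {c : ℕ} (hc : c < B) :
    segUpdate f base B g (base + c) = g c := by
  simp [segUpdate, hc]

theorem segUpdate_of_not {α : Type*} (f : ℕ → α) {base B : ℕ} (g : ℕ → α) {i : ℕ}
    (h : i < base ∨ base + B ≤ i) : segUpdate f base B g i = f i := by
  rw [segUpdate, if_neg (by omega)]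

/-- A loop that overwrites a segment of an integer array. -/
theorem Spec.fillWord {W : ℕ} {s : Memory} (v a : ℕ) (bound idx e : WordExp) (base B C : ℕ)
    (f : ℕ → ℕ) (T' : ℕ) (hav : v ≠ a) (hBW : B < W) (hW : 1 < W)
    (hbound : ∀ s' : Memory, (∀ b, b ≠ a → b ≠ v → s'.word b = s.word b) →
      bound.Ok W s' ∧ bound.eval s' = B)
    (h : ∀ c s', c < B → (∀ b, b ≠ a → b ≠ v → s'.word b = s.word b) → s'.word v 0 = c →
      s'.word a = segUpdate (s.word a) base c f →
      idx.Ok W s' ∧ e.Ok W s' ∧ idx.eval s' = base + c ∧ e.eval s' = f c)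
    (hC : idx.cost + e.cost + bound.cost + 20 ≤ C) (hT : (B + 1) * C ≤ T') :
    Spec W (.for v bound (.setWord a idx e)) s T' fun s' =>
      (∀ b, b ≠ a → b ≠ v → s'.word b = s.word b) ∧ s'.real = s.real ∧
      s'.word a = segUpdate (s.word a) base B f := by
  refine (Spec.for v bound _ B (idx.cost + e.cost + 1) T'
    (fun k s' => (∀ b, b ≠ a → b ≠ v → s'.word b = s.word b) ∧ s'.real = s.real ∧
      s'.word a = segUpdate (s.word a) base k f) hBW hW ?_ ?_ ?_ ?_ ?_).mono le_rfl fun s' h => h.1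
  · exact fun k s' _ hI => hbound s' hI.1
  · rintro k s' x ⟨h1, h2, h3⟩
    refine ⟨fun b hb hb' => ?_, h2, ?_⟩
    · rw [Memory.word_setWord, if_neg hb', h1 b hb hb']
    · rw [Memory.word_setWord, if_neg hav.symm, h3]
  · exact ⟨fun _ _ _ => rfl, rfl, (segUpdate_zero _ _ _).symm⟩
  · rintro k s' hk ⟨h1, h2, h3⟩ hv
    obtain ⟨o1, o2, e1, e2⟩ := h k s' hk h1 hv h3
    refine Spec.setWord o1 o2 ?_ le_rfl
    rw [e1, e2]
    refine ⟨?_, fun b hb hb' => ?_, h2, ?_⟩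
    · rw [Memory.word_setWord, if_neg hav, hv]
    · rw [Memory.word_setWord, if_neg hb, h1 b hb hb']
    · rw [Memory.word_setWord, if_pos rfl, h3, segUpdate_succ]
  · refine le_trans ?_ hT
    have : B * (idx.cost + e.cost + 1 + bound.cost + 9) ≤ B * C := Nat.mul_le_mul_left _ (by omega)
    rw [add_mul]
    omega

/-- A loop that overwrites a segment of a real array. -/
theorem Spec.fillReal {W : ℕ} {s : Memory} (v a : ℕ) (bound idx : WordExp) (e : RealExp)
    (base B C : ℕ) (f : ℕ → ℝ) (T' : ℕ) (hBW : B < W) (hW : 1 < W)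
    (hbound : ∀ s' : Memory, (∀ b, b ≠ v → s'.word b = s.word b) →
      bound.Ok W s' ∧ bound.eval s' = B)
    (h : ∀ c s', c < B → (∀ b, b ≠ v → s'.word b = s.word b) → s'.word v 0 = c →
      (∀ b, b ≠ a → s'.real b = s.real b) →
      s'.real a = segUpdate (s.real a) base c f →
      idx.Ok W s' ∧ e.Ok W s' ∧ idx.eval s' = base + c ∧ e.eval s' = f c)
    (hC : idx.cost + e.cost + bound.cost + 20 ≤ C) (hT : (B + 1) * C ≤ T') :
    Spec W (.for v bound (.setReal a idx e)) s T' fun s' =>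
      (∀ b, b ≠ v → s'.word b = s.word b) ∧ (∀ b, b ≠ a → s'.real b = s.real b) ∧
      s'.real a = segUpdate (s.real a) base B f := by
  refine (Spec.for v bound _ B (idx.cost + e.cost + 1) T'
    (fun k s' => (∀ b, b ≠ v → s'.word b = s.word b) ∧ (∀ b, b ≠ a → s'.real b = s.real b) ∧
      s'.real a = segUpdate (s.real a) base k f) hBW hW ?_ ?_ ?_ ?_ ?_).mono le_rfl fun s' h => h.1
  · exact fun k s' _ hI => hbound s' hI.1
  · rintro k s' x ⟨h1, h2, h3⟩
    exact ⟨fun b hb => by rw [Memory.word_setWord, if_neg hb, h1 b hb], h2, h3⟩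
  · exact ⟨fun _ _ => rfl, fun _ _ => rfl, (segUpdate_zero _ _ _).symm⟩
  · rintro k s' hk ⟨h1, h2, h3⟩ hv
    obtain ⟨o1, o2, e1, e2⟩ := h k s' hk h1 hv h2 h3
    refine Spec.setReal o1 o2 ?_ le_rfl
    rw [e1, e2]
    refine ⟨hv, h1, fun b hb => ?_, ?_⟩
    · rw [Memory.real_setReal, if_neg hb, h2 b hb]
    · rw [Memory.real_setReal, if_pos rfl, h3, segUpdate_succ]
  · refine le_trans ?_ hT
    have : B * (idx.cost + e.cost + 1 + bound.cost + 9) ≤ B * C := Nat.mul_le_mul_left _ (by omega)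
    rw [add_mul]
    omega

/-! ### Gaussian elimination over `𝔽₂` -/

section Elimination

variable {V : Type*} [AddCommGroup V] [Module (ZMod 2) V]

/-- Reduction of a vector by the first `k` rows of `ρ`, where row `i` cancels the coordinate
`e (piv i)`. -/
def reduceBy (e : ℕ → V →ₗ[ZMod 2] ZMod 2) (ρ : ℕ → V) (piv : ℕ → ℕ) : ℕ → V →ₗ[ZMod 2] V
  | 0 => LinearMap.id
  | k + 1 => reduceBy e ρ piv k +
      ((e (piv k)).comp (reduceBy e ρ piv k)).smulRight (ρ k)

theorem reduceBy_succ (e : ℕ → V →ₗ[ZMod 2] ZMod 2) (ρ : ℕ → V) (piv : ℕ → ℕ) (k : ℕ) (v : V) :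
    reduceBy e ρ piv (k + 1) v =
      reduceBy e ρ piv k v + e (piv k) (reduceBy e ρ piv k v) • ρ k := rfl

theorem reduceBy_congr (e : ℕ → V →ₗ[ZMod 2] ZMod 2) {ρ ρ' : ℕ → V} {piv piv' : ℕ → ℕ} {k : ℕ}
    (hρ : ∀ i < k, ρ i = ρ' i) (hp : ∀ i < k, piv i = piv' i) :
    reduceBy e ρ piv k = reduceBy e ρ' piv' k := by
  induction k with
  | zero => rfl
  | succ k ih =>
    simp only [reduceBy]
    rw [ih (fun i hi => hρ i (by omega)) (fun i hi => hp i (by omega)), hρ k (by omega),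
      hp k (by omega)]

/-- The first `k` rows of `ρ` result from inserting the vectors `u` one by one. -/
def IsEliminated (e : ℕ → V →ₗ[ZMod 2] ZMod 2) (ρ : ℕ → V) (piv : ℕ → ℕ) (u : ℕ → V) (k : ℕ) : Prop :=
  ∀ i < k, ρ i = reduceBy e ρ piv i (u i) ∧ (ρ i = 0 ∨ e (piv i) (ρ i) = 1)

variable {e : ℕ → V →ₗ[ZMod 2] ZMod 2} {ρ : ℕ → V} {piv : ℕ → ℕ} {u : ℕ → V} {k : ℕ}

/-- After `l` steps `u l` has become `ρ l`. Step `l` then adds `ρ l` to itself, which gives zero in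
characteristic 2, and zero stays zero. No echelon form of the rows is needed. -/
theorem IsEliminated.reduceBy_eq_zero (h : IsEliminated e ρ piv u k) {l : ℕ} (hl : l < k) :
    reduceBy e ρ piv k (u l) = 0 := by
  induction k with
  | zero => omega
  | succ k ih =>
    rcases Nat.lt_succ_iff_lt_or_eq.mp hl with hlt | rfl
    · rw [reduceBy_succ, ih (fun i hi => h i (by omega)) hlt]
      simp
    · obtain ⟨h1, h2⟩ := h l hl
      rw [reduceBy_succ, ← h1]
      rcases h2 with h2 | h2
      · rw [h2]; simp
      · rw [h2, one_smul]
        exact ZModModule.add_self _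

theorem reduceBy_sub_mem (e : ℕ → V →ₗ[ZMod 2] ZMod 2) (ρ : ℕ → V) (piv : ℕ → ℕ) (k : ℕ) (v : V) :
    reduceBy e ρ piv k v - v ∈ Submodule.span (ZMod 2) (ρ '' Set.Iio k) := by
  induction k with
  | zero => simp [reduceBy]
  | succ k ih =>
    rw [reduceBy_succ, add_sub_right_comm]
    refine Submodule.add_mem _ (Submodule.span_mono (Set.image_mono ?_) ih)
      (Submodule.smul_mem _ _ (Submodule.subset_span ⟨k, by simp, rfl⟩))
    exact Set.Iio_subset_Iio (by omega)

theorem IsEliminated.span_le (h : IsEliminated e ρ piv u k) :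
    Submodule.span (ZMod 2) (ρ '' Set.Iio k) ≤ Submodule.span (ZMod 2) (u '' Set.Iio k) := by
  induction k with
  | zero => simp
  | succ k ih =>
    have ih' := ih (fun i hi => h i (by omega))
    have hle : Submodule.span (ZMod 2) (u '' Set.Iio k) ≤
        Submodule.span (ZMod 2) (u '' Set.Iio (k + 1)) :=
      Submodule.span_mono (Set.image_mono (Set.Iio_subset_Iio (by omega)))
    rw [Submodule.span_le]
    rintro _ ⟨i, hi, rfl⟩
    rcases Nat.lt_succ_iff_lt_or_eq.mp (Set.mem_Iio.mp hi) with hlt | rfl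
    · exact hle (ih' (Submodule.subset_span ⟨i, hlt, rfl⟩))
    · have h1 := reduceBy_sub_mem e ρ piv i (u i)
      rw [← (h i hi).1] at h1
      have h2 := Submodule.add_mem _ (hle (ih' h1))
        (Submodule.subset_span (s := u '' Set.Iio (i + 1)) ⟨i, hi, rfl⟩)
      simpa using h2

/-- Reduction is linear and kills every `u l`, hence their span. Conversely, a vector differs from
its reduction by a combination of rows, and the rows lie in the span of the `u l`. -/
theorem IsEliminated.mem_span_iff (h : IsEliminated e ρ piv u k) (v : V) :
    v ∈ Submodule.span (ZMod 2) (u '' Set.Iio k) ↔ reduceBy e ρ piv k v = 0 := by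
  constructor
  · intro hv
    have : Submodule.span (ZMod 2) (u '' Set.Iio k) ≤ LinearMap.ker (reduceBy e ρ piv k) := by
      rw [Submodule.span_le]
      rintro _ ⟨i, hi, rfl⟩
      exact h.reduceBy_eq_zero hi
    exact this hv
  · intro hv
    have h1 := h.span_le (reduceBy_sub_mem e ρ piv k v)
    rw [hv, zero_sub] at h1
    simpa using h1

/-- The pivot entry of row `i` is `1` exactly when `u i` enlarges the span of its predecessors, and
`0` when the row is zero. The rank is therefore a plain sum of memory cells. -/
theorem IsEliminated.sum_eq_finrank [Module.Finite (ZMod 2) V] (h : IsEliminated e ρ piv u k) :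
    ∑ i ∈ Finset.range k, (e (piv i) (ρ i)).val =
      Module.finrank (ZMod 2) (Submodule.span (ZMod 2) (u '' Set.Iio k)) := by
  induction k with
  | zero =>
    rw [show Set.Iio 0 = (∅ : Set ℕ) by ext; simp, Set.image_empty, Submodule.span_empty,
      finrank_bot, Finset.range_zero, Finset.sum_empty]
  | succ k ih =>
    have hk : IsEliminated e ρ piv u k := fun i hi => h i (by omega)
    rw [Finset.sum_range_succ, ih hk]
    have hset : u '' Set.Iio (k + 1) = u '' Set.Iio k ∪ {u k} := by
      ext x
      simp only [Set.mem_image, Set.mem_Iio, Nat.lt_succ_iff_lt_or_eq, or_and_right, exists_or,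
        exists_eq_left, Set.mem_union, Set.mem_singleton_iff, eq_comm (b := x)]
    rw [hset, Submodule.span_union]
    obtain ⟨h1, h2⟩ := h k (by omega)
    by_cases hm : u k ∈ Submodule.span (ZMod 2) (u '' Set.Iio k)
    · rw [(hk.mem_span_iff _).mp hm] at h1
      rw [h1, sup_eq_left.mpr (by simpa [Submodule.span_le] using hm)]
      simp
    · have h0 : ρ k ≠ 0 := fun h0 => hm ((hk.mem_span_iff _).mpr (h1 ▸ h0))
      rw [Submodule.finrank_sup_span_singleton hm, h2.resolve_left h0]
      rfl

end Elimination

/-! ### Rows of bits and Pauli labels -/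

/-- The label whose coordinates are the `2n` cells of an array that start at `base`. -/
def rowLabel (n : ℕ) (f : ℕ → ℕ) (base : ℕ) : PauliLabel n :=
  (fun j => (f (base + j) : ZMod 2), fun j => (f (base + n + j) : ZMod 2))

/-- The coordinate of a label in column `c < 2n`. -/
def coord (n c : ℕ) : PauliLabel n →ₗ[ZMod 2] ZMod 2 where
  toFun v := if h : c < n then v.1 ⟨c, h⟩ else if h : c - n < n then v.2 ⟨c - n, h⟩ else 0
  map_add' v w := by split_ifs <;> simp
  map_smul' r v := by split_ifs <;> simp

theorem coord_val {n : ℕ} (v : PauliLabel n) (c : ℕ) : (coord n c v).val = labelBit v c := by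
  simp only [coord, labelBit, LinearMap.coe_mk, AddHom.coe_mk]
  split_ifs <;> simp

theorem coord_rowLabel {n : ℕ} (f : ℕ → ℕ) (base : ℕ) {c : ℕ} (hc : c < 2 * n) :
    coord n c (rowLabel n f base) = (f (base + c) : ZMod 2) := by
  simp only [coord, rowLabel, LinearMap.coe_mk, AddHom.coe_mk]
  split_ifs with h1 h2
  · rfl
  · congr 2; omega
  · omega

theorem label_ext {n : ℕ} {v w : PauliLabel n}
    (h : ∀ c < 2 * n, coord n c v = coord n c w) : v = w := by
  refine Prod.ext (funext fun j => ?_) (funext fun j => ?_)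
  · have := h j (by omega)
    simpa [coord] using this
  · have := h (n + j) (by omega)
    simpa [coord] using this

theorem rowLabel_congr {n : ℕ} {f g : ℕ → ℕ} {base base' : ℕ}
    (h : ∀ c < 2 * n, f (base + c) = g (base' + c)) : rowLabel n f base = rowLabel n g base' := by
  apply label_ext
  intro c hc
  rw [coord_rowLabel _ _ hc, coord_rowLabel _ _ hc, h c hc]

theorem bit_xor_land_cast {a b d : ℕ} (ha : a < 2) (hb : b < 2) (hd : d < 2) :
    ((a ^^^ (b &&& d) : ℕ) : ZMod 2) = a + b * d := by
  interval_cases a <;> interval_cases b <;> interval_cases d <;> rfl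

theorem bit_land_lt {b d : ℕ} (hb : b < 2) : b &&& d < 2 :=
  lt_of_le_of_lt Nat.and_le_left hb

theorem bit_xor_lt {a b : ℕ} (ha : a < 2) (hb : b < 2) : a ^^^ b < 2 :=
  Nat.xor_lt_two_pow (n := 1) ha hb

theorem bit_eq_val {a : ℕ} (ha : a < 2) : (a : ZMod 2).val = a := ZMod.val_cast_of_lt ha

/-! ### The elimination programs -/

/-- The cell `i * w + c` of a matrix with rows of length `w = word 6 0`. -/
abbrev WordExp.cell (a : ℕ) (i c : WordExp) : WordExp :=
  .get a (.op .add (.op .mul i (.var 6)) c)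

/-- Add `word 23 0` times row `word 22 0` to row `word 10 0` of the matrix in array `20`. -/
def Prog.addRow : Prog :=
  .for 24 (.var 6) (.setWord 20 (.op .add (.op .mul (.var 10) (.var 6)) (.var 24))
    (.op .xor (.cell 20 (.var 10) (.var 24)) (.op .land (.var 23) (.cell 20 (.var 22) (.var 24)))))

/-- Reduce row `word 10 0` by the preceding rows; array `21` holds the pivots. -/
def Prog.reduceRow : Prog :=
  .for 22 (.var 10)
    (.seq (.setWord 23 (.lit 0) (.cell 20 (.var 10) (.get 21 (.var 22)))) .addRow)

/-- Find a pivot of row `word 10 0`. -/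
def Prog.findPivot : Prog :=
  .seq (.setWord 21 (.var 10) (.lit 0))
    (.for 24 (.var 6) (.ifLt (.lit 0) (.cell 20 (.var 10) (.var 24))
      (.setWord 21 (.var 10) (.var 24)) .skip))

/-- Insert row `word 10 0` into the system formed by the preceding rows. -/
def Prog.insertRow : Prog := .seq .reduceRow .findPivot

/-- Row `i` of the matrix in array `20`. -/
abbrev Memory.row (s : Memory) (n i : ℕ) : PauliLabel n := rowLabel n (s.word 20) (i * (2 * n))

theorem addRow_spec {W n i k : ℕ} {s : Memory} (h6 : s.word 6 0 = 2 * n) (h10 : s.word 10 0 = i)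
    (h22 : s.word 22 0 = k) (hk : k < i) (hW : i * (2 * n) + 2 * n + 1 < W)
    (hbit : ∀ j, s.word 20 j < 2) (h23 : s.word 23 0 < 2) :
    Spec W .addRow s ((2 * n + 1) * 60) fun s' =>
      (∀ b, b ≠ 20 → b ≠ 24 → s'.word b = s.word b) ∧ s'.real = s.real ∧
      (∀ j, s'.word 20 j < 2) ∧
      (∀ j, (j < i * (2 * n) ∨ i * (2 * n) + 2 * n ≤ j) → s'.word 20 j = s.word 20 j) ∧
      s'.row n i = s.row n i + (s.word 23 0 : ZMod 2) • s.row n k := by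
  -- Row `k` ends no later than row `i` begins, so overwriting row `i` leaves the source row intact.
  have hkm : (k + 1) * (2 * n) ≤ i * (2 * n) := Nat.mul_le_mul_right _ hk
  rw [add_mul, one_mul] at hkm
  refine (Spec.fillWord 24 20 (.var 6) _ _ (i * (2 * n)) (2 * n) 60
    (fun c => s.word 20 (i * (2 * n) + c) ^^^
      (s.word 23 0 &&& s.word 20 (k * (2 * n) + c))) _ (by decide) (by omega) (by omega)
    ?_ ?_ ?_ le_rfl).mono le_rfl ?_
  · intro s' hs'
    simp [WordExp.Ok, WordExp.eval, hs', h6]; omega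
  · intro c s' hc hs' hc' hseg
    have e1 : s'.word 20 (i * (2 * n) + c) = s.word 20 (i * (2 * n) + c) := by
      rw [hseg, segUpdate_of_not _ _ (by omega)]
    have e2 : s'.word 20 (k * (2 * n) + c) = s.word 20 (k * (2 * n) + c) := by
      rw [hseg, segUpdate_of_not _ _ (by omega)]
    have b1 := hbit (i * (2 * n) + c)
    have b2 := bit_land_lt (d := s.word 20 (k * (2 * n) + c)) h23
    have b3 := bit_xor_lt b1 b2
    simp only [WordExp.Ok, WordExp.eval, WordOp.eval, hs' 6 (by decide) (by decide),
      hs' 10 (by decide) (by decide), hs' 22 (by decide) (by decide),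
      hs' 23 (by decide) (by decide), h6, h10, h22, hc', e1, e2]
    refine ⟨⟨⟨?_, ?_, ?_⟩, ?_, ?_⟩, ⟨⟨⟨?_, ?_, ?_⟩, ?_, ?_⟩, ⟨?_, ⟨⟨?_, ?_, ?_⟩, ?_, ?_⟩, ?_⟩, ?_⟩,
      trivial, trivial⟩ <;> omega
  · simp [WordExp.cost]
  · rintro s' ⟨h1, h2, h3⟩
    refine ⟨h1, h2, fun j => ?_, fun j hj => ?_, ?_⟩
    · rw [h3, segUpdate]
      split_ifs
      · exact bit_xor_lt (hbit _) (bit_land_lt h23)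
      · exact hbit j
    · rw [h3, segUpdate_of_not _ _ hj]
    · apply label_ext
      intro c hc
      rw [map_add, map_smul, coord_rowLabel _ _ hc, coord_rowLabel _ _ hc, coord_rowLabel _ _ hc,
        h3, segUpdate_of_lt _ _ hc, smul_eq_mul, bit_xor_land_cast (hbit _) h23 (hbit _)]

theorem reduceRow_spec {W n i : ℕ} {s : Memory} (h6 : s.word 6 0 = 2 * n) (h10 : s.word 10 0 = i)
    (hW : i * (2 * n) + 2 * n + 1 < W) (hbit : ∀ j, s.word 20 j < 2)
    (hpiv : ∀ k < i, s.word 21 k < 2 * n) (hn : 0 < n) :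
    Spec W .reduceRow s (i * ((2 * n + 1) * 60 + 40) + 20) fun s' =>
      (∀ b, b ≠ 20 → b ≠ 22 → b ≠ 23 → b ≠ 24 → s'.word b = s.word b) ∧ s'.real = s.real ∧
      (∀ j, s'.word 20 j < 2) ∧
      (∀ j, (j < i * (2 * n) ∨ i * (2 * n) + 2 * n ≤ j) → s'.word 20 j = s.word 20 j) ∧
      s'.row n i = reduceBy (coord n) (s.row n) (s.word 21) i (s.row n i) := by
  have hi : i ≤ i * (2 * n) := Nat.le_mul_of_pos_right _ (by omega)
  refine (Spec.for 22 (.var 10) _ i ((2 * n + 1) * 60 + 22) _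
    (fun k s' => (∀ b, b ≠ 20 → b ≠ 22 → b ≠ 23 → b ≠ 24 → s'.word b = s.word b) ∧
      s'.real = s.real ∧ (∀ j, s'.word 20 j < 2) ∧
      (∀ j, (j < i * (2 * n) ∨ i * (2 * n) + 2 * n ≤ j) → s'.word 20 j = s.word 20 j) ∧
      s'.row n i = reduceBy (coord n) (s.row n) (s.word 21) k (s.row n i))
    (by omega) (by omega) ?_ ?_ ?_ ?_ ?_).mono le_rfl fun s' h => h.1
  · rintro k s' - ⟨h1, -⟩
    simp [WordExp.Ok, WordExp.eval, h1, h10]; omega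
  · rintro k s' x ⟨h1, h2, h3, h4, h5⟩
    refine ⟨fun b b20 b22 b23 b24 => ?_, h2, ?_, ?_, ?_⟩
    · rw [Memory.word_setWord, if_neg b22, h1 b b20 b22 b23 b24]
    · simpa [Memory.word_setWord] using h3
    · simpa [Memory.word_setWord] using h4
    · simpa [Memory.word_setWord, Memory.row] using h5
  · exact ⟨fun _ _ _ _ _ => rfl, rfl, hbit, fun _ _ => rfl, rfl⟩
  · rintro k s' hk ⟨h1, h2, h3, h4, h5⟩ h22
    have hkm : (k + 1) * (2 * n) ≤ i * (2 * n) := Nat.mul_le_mul_right _ hk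
    rw [add_mul, one_mul] at hkm
    have h6' : s'.word 6 0 = 2 * n := by rw [h1 6 (by decide) (by decide) (by decide) (by decide), h6]
    have h10' : s'.word 10 0 = i := by rw [h1 10 (by decide) (by decide) (by decide) (by decide), h10]
    have h21' : s'.word 21 = s.word 21 := h1 21 (by decide) (by decide) (by decide) (by decide)
    have hp := hpiv k hk
    -- The coefficient is saved in `word 23 0` beforehand, because adding row `k` may change the
    -- very cell it is read from.
    refine (Spec.seq (T := 22) (R := fun s'' =>
      s'' = s'.setWord 23 0 (s'.word 20 (i * (2 * n) + s.word 21 k)))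
      (Spec.setWord ?_ ?_ ?_ ?_) ?_ (T' := (2 * n + 1) * 60)).mono (by omega) fun _ h => h
    · simp [WordExp.Ok]; omega
    · simp only [WordExp.Ok, WordExp.eval, WordOp.eval, h6', h10', h22, h21']
      refine ⟨⟨?_, ?_, ?_⟩, ?_, ?_⟩ <;> omega
    · simp only [WordExp.eval, WordOp.eval, h6', h10', h22, h21']
    · simp [WordExp.cost]
    · rintro _ rfl
      refine (addRow_spec (n := n) (i := i) (k := k) ?_ ?_ ?_ hk hW ?_ ?_).mono le_rfl ?_
      · simpa [Memory.word_setWord]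
      · simpa [Memory.word_setWord]
      · simpa [Memory.word_setWord]
      · simpa [Memory.word_setWord] using h3
      · simpa [Memory.word_setWord] using h3 _
      · rintro s'' ⟨g1, g2, g3, g4, g5⟩
        simp only [Memory.word_setWord, Memory.real_setWord] at g1 g2 g4 g5
        refine ⟨?_, fun b b20 b22 b23 b24 => ?_, by rw [g2, h2], g3, fun j hj => ?_, ?_⟩
        · rw [g1 22 (by decide) (by decide), if_neg (by decide), h22]
        · rw [g1 b b20 b24, if_neg b23, h1 b b20 b22 b23 b24]
        · rw [g4 j hj, if_neg (by decide), h4 j hj]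
        · have hrow : rowLabel n (s'.word 20) (k * (2 * n)) = s.row n k :=
            rowLabel_congr fun c hc => h4 _ (by omega)
          simp only [Memory.row, Memory.word_setWord, if_neg (show (20 : ℕ) ≠ 23 by decide)] at g5
          rw [Memory.row, g5, reduceBy_succ, ← h5, hrow, coord_rowLabel _ _ hp]
          simp
  · simp only [WordExp.cost]
    have : i * ((2 * n + 1) * 60 + 22 + (1 + 1) + 9) ≤ i * ((2 * n + 1) * 60 + 40) :=
      Nat.mul_le_mul_left _ (by omega)
    omega

/-- The scan has no early exit, so the last nonzero column becomes the pivot. A zero row keeps the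
default pivot `0`, which is a legal column because `n > 0`. -/
theorem findPivot_spec {W n i : ℕ} {s : Memory} (h6 : s.word 6 0 = 2 * n) (h10 : s.word 10 0 = i)
    (hW : i * (2 * n) + 2 * n + 1 < W) (hbit : ∀ j, s.word 20 j < 2) (hn : 0 < n) :
    Spec W .findPivot s ((2 * n) * 60 + 20) fun s' =>
      (∀ b, b ≠ 21 → b ≠ 24 → s'.word b = s.word b) ∧ s'.real = s.real ∧
      (∀ k, k ≠ i → s'.word 21 k = s.word 21 k) ∧ s'.word 21 i < 2 * n ∧
      (s.row n i = 0 ∨ coord n (s'.word 21 i) (s.row n i) = 1) := by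
  have hi : i ≤ i * (2 * n) := Nat.le_mul_of_pos_right _ (by omega)
  refine (Spec.seq (T := 6) (T' := (2 * n) * 60 + 10) (R := fun s' => s' = s.setWord 21 i 0)
    (Spec.setWord ?_ ?_ ?_ ?_) ?_).mono (by omega) fun _ h => h
  · simp [WordExp.Ok]; omega
  · simp [WordExp.Ok]; omega
  · simp [WordExp.eval, h10]
  · simp [WordExp.cost]
  rintro _ rfl
  refine (Spec.for 24 (.var 6) _ (2 * n) 40 _
    (fun k s' => (∀ b, b ≠ 21 → b ≠ 24 → s'.word b = s.word b) ∧ s'.real = s.real ∧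
      (∀ k, k ≠ i → s'.word 21 k = s.word 21 k) ∧ s'.word 21 i < 2 * n ∧
      ((∀ c < k, s.word 20 (i * (2 * n) + c) = 0) ∨
        s.word 20 (i * (2 * n) + s'.word 21 i) = 1))
    (by omega) (by omega) ?_ ?_ ?_ ?_ ?_).mono le_rfl ?_
  · rintro k s' - ⟨h1, -⟩
    simp [WordExp.Ok, WordExp.eval, h1, h6]; omega
  · rintro k s' x ⟨h1, h2, h3, h4, h5⟩
    refine ⟨fun b hb hb' => ?_, h2, ?_, ?_, ?_⟩
    · rw [Memory.word_setWord, if_neg hb', h1 b hb hb']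
    all_goals simpa [Memory.word_setWord]
  · refine ⟨fun b hb _ => ?_, rfl, fun k hk => ?_, ?_, ?_⟩
    · simp [Memory.word_setWord, hb]
    · simp [Memory.word_setWord, hk]
    · simp [Memory.word_setWord, hn]
    · left; simp
  · rintro k s' hk ⟨h1, h2, h3, h4, h5⟩ h24
    have h6' : s'.word 6 0 = 2 * n := by rw [h1 6 (by decide) (by decide), h6]
    have h10' : s'.word 10 0 = i := by rw [h1 10 (by decide) (by decide), h10]
    have h20' : s'.word 20 = s.word 20 := h1 20 (by decide) (by decide)
    refine Spec.ifLt (T := 6) ?_ ?_ ?_ ?_ ?_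
    · simp [WordExp.Ok]; omega
    · simp only [WordExp.Ok, WordExp.eval, WordOp.eval, h6', h10', h24]
      refine ⟨⟨?_, ?_, ?_⟩, ?_, ?_⟩ <;> omega
    · intro hlt
      simp only [WordExp.eval, WordOp.eval, h6', h10', h24, h20'] at hlt
      refine Spec.setWord ?_ ?_ ?_ ?_
      · simp [WordExp.Ok]; omega
      · simp [WordExp.Ok]; omega
      · simp only [WordExp.eval, h10', h24]
        refine ⟨by simpa [Memory.word_setWord], fun b hb hb' => ?_, h2, fun k hk => ?_, ?_, ?_⟩
        · simp [Memory.word_setWord, hb, h1 b hb hb']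
        · simp [Memory.word_setWord, hk, h3]
        · simpa [Memory.word_setWord]
        · right
          have := hbit (i * (2 * n) + k)
          simp only [Memory.word_setWord, if_true, Function.update_self]
          omega
      · simp [WordExp.cost]
    · intro hlt
      simp only [WordExp.eval, WordOp.eval, h6', h10', h24, h20'] at hlt
      refine (Spec.skip ?_).mono (by decide : (1 : ℕ) ≤ 6) fun _ h => h
      refine ⟨h24, h1, h2, h3, h4, h5.imp_left fun h5 c hc => ?_⟩
      rcases Nat.lt_succ_iff_lt_or_eq.mp hc with hc | rfl
      · exact h5 c hc
      · omega
    · simp [WordExp.cost]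
  · simp only [WordExp.cost]
    omega
  · rintro s' ⟨⟨h1, h2, h3, h4, h5⟩, -⟩
    refine ⟨h1, h2, h3, h4, h5.imp (fun h => label_ext fun c hc => ?_) fun h => ?_⟩
    · rw [coord_rowLabel _ _ hc, h c hc]; simp
    · rw [coord_rowLabel _ _ h4, h]; simp

theorem insertRow_spec {W n i : ℕ} {s : Memory} (h6 : s.word 6 0 = 2 * n) (h10 : s.word 10 0 = i)
    (hW : i * (2 * n) + 2 * n + 1 < W) (hbit : ∀ j, s.word 20 j < 2)
    (hpiv : ∀ k < i, s.word 21 k < 2 * n) (hn : 0 < n) :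
    Spec W .insertRow s ((i + 1) * (n * 300)) fun s' =>
      (∀ b, b < 20 → s'.word b = s.word b) ∧ s'.real = s.real ∧
      (∀ j, s'.word 20 j < 2) ∧
      (∀ j, (j < i * (2 * n) ∨ i * (2 * n) + 2 * n ≤ j) → s'.word 20 j = s.word 20 j) ∧
      (∀ k, k ≠ i → s'.word 21 k = s.word 21 k) ∧ s'.word 21 i < 2 * n ∧
      s'.row n i = reduceBy (coord n) (s.row n) (s.word 21) i (s.row n i) ∧
      (s'.row n i = 0 ∨ coord n (s'.word 21 i) (s'.row n i) = 1) := by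
  refine (Spec.seq (reduceRow_spec h6 h10 hW hbit hpiv hn) (T' := (2 * n) * 60 + 20) ?_).mono ?_
    fun _ h => h
  · rintro s' ⟨h1, h2, h3, h4, h5⟩
    have h6' : s'.word 6 0 = 2 * n := by rw [h1 6 (by decide) (by decide) (by decide) (by decide), h6]
    have h10' : s'.word 10 0 = i := by rw [h1 10 (by decide) (by decide) (by decide) (by decide), h10]
    refine (findPivot_spec h6' h10' hW h3 hn).mono le_rfl ?_
    rintro s'' ⟨g1, g2, g3, g4, g5⟩
    have h20 : s''.word 20 = s'.word 20 := g1 20 (by decide) (by decide)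
    have h21 : s'.word 21 = s.word 21 := h1 21 (by decide) (by decide) (by decide) (by decide)
    refine ⟨fun b hb => ?_, by rw [g2, h2], by rwa [h20], by rwa [h20], by rwa [← h21], g4,
      by rwa [Memory.row, h20], by rwa [Memory.row, h20]⟩
    rw [g1 b (by omega) (by omega), h1 b (by omega) (by omega) (by omega) (by omega)]
  · have : i * ((2 * n + 1) * 60 + 40) ≤ i * (n * 300) := Nat.mul_le_mul_left _ (by omega)
    have e : (i + 1) * (n * 300) = i * (n * 300) + n * 300 := by ring
    omega

theorem IsEliminated.congr {V : Type*} [AddCommGroup V] [Module (ZMod 2) V]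
    {e : ℕ → V →ₗ[ZMod 2] ZMod 2} {ρ ρ' : ℕ → V} {piv piv' : ℕ → ℕ} {u : ℕ → V} {k : ℕ}
    (h : IsEliminated e ρ piv u k) (hρ : ∀ i < k, ρ' i = ρ i) (hp : ∀ i < k, piv' i = piv i) :
    IsEliminated e ρ' piv' u k := by
  intro i hi
  rw [hρ i hi, hp i hi, reduceBy_congr e (fun j hj => hρ j (by omega)) fun j hj => hp j (by omega)]
  exact h i hi

/-! ### Memory layout and elimination of the masked generators of `J` -/

/-- The arrays below `9` hold the input and the quantities derived from it at the start: the rows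
of array `3`, masked by array `8`, are the labels `u`, and the last `ν` rows of both halves of
array `4`, masked in the same way, are `tx` and `tz`. -/
structure Layout (W m ν : ℕ) (s : Memory) (u tx tz : ℕ → PauliLabel (m + ν)) : Prop where
  pos : 0 < m + ν
  words : 4 * ((m + ν) * (m + ν)) + 20 < W
  levels : (ν + 2) * 2 ^ ν + 20 < W
  n_eq : s.word 0 0 = m + ν
  ν_eq : s.word 0 1 = ν
  size_eq : s.word 5 0 = 2 ^ ν
  width_eq : s.word 6 0 = 2 * (m + ν)
  m_eq : s.word 7 0 = m
  u_eq : ∀ i < m, ∀ c < 2 * (m + ν),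
    s.word 8 c &&& s.word 3 (i * (2 * (m + ν)) + c) = (coord (m + ν) c (u i)).val
  tx_eq : ∀ j < ν, ∀ c < 2 * (m + ν),
    s.word 8 c &&& s.word 4 ((m + j) * (2 * (m + ν)) + c) = (coord (m + ν) c (tx j)).val
  tz_eq : ∀ j < ν, ∀ c < 2 * (m + ν),
    s.word 8 c &&& s.word 4 ((m + ν + (m + j)) * (2 * (m + ν)) + c) =
      (coord (m + ν) c (tz j)).val

theorem Layout.congr {W m ν : ℕ} {s s' : Memory} {u tx tz : ℕ → PauliLabel (m + ν)}
    (h : Layout W m ν s u tx tz) (hs : ∀ b, b < 9 → s'.word b = s.word b) :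
    Layout W m ν s' u tx tz := by
  obtain ⟨a1, a2, a3, a4, a5, a6, a7, a8, a9, a10, a11⟩ := h
  refine ⟨a1, a2, a3, ?_, ?_, ?_, ?_, ?_, ?_, ?_, ?_⟩ <;>
    simpa only [hs 0 (by decide), hs 3 (by decide), hs 4 (by decide), hs 5 (by decide),
      hs 6 (by decide), hs 7 (by decide), hs 8 (by decide)]

/-- The largest bit matrix is the tableau of `C`, with `2n` rows of `2n` cells; this explains the
`4n²` in `Layout.words`. -/
theorem Layout.row_lt {W m ν : ℕ} {s : Memory} {u tx tz : ℕ → PauliLabel (m + ν)}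
    (h : Layout W m ν s u tx tz) {i : ℕ} (hi : i ≤ 2 * (m + ν) - 1) :
    i * (2 * (m + ν)) + 2 * (m + ν) + 1 < W := by
  have h1 := h.words
  have h2 := h.pos
  have h3 : (i + 1) * (2 * (m + ν)) ≤ 2 * (m + ν) * (2 * (m + ν)) :=
    Nat.mul_le_mul_right _ (by omega)
  have h4 : 2 * (m + ν) * (2 * (m + ν)) = 4 * ((m + ν) * (m + ν)) := by ring
  rw [add_mul, one_mul] at h3
  omega

/-- The elimination state: the first `m` rows of array `20` with the pivots in array `21`. -/
structure Eliminated (m ν : ℕ) (s : Memory) (u : ℕ → PauliLabel (m + ν)) (k : ℕ) : Prop where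
  bit : ∀ j, s.word 20 j < 2
  piv_lt : ∀ i < k, s.word 21 i < 2 * (m + ν)
  rows : IsEliminated (coord (m + ν)) (s.row (m + ν)) (s.word 21) u k

/-- Copy row `word 10 0` of array `3`, masked, to array `20`. -/
def Prog.copyRow : Prog :=
  .for 24 (.var 6) (.setWord 20 (.op .add (.op .mul (.var 10) (.var 6)) (.var 24))
    (.op .land (.get 8 (.var 24)) (.cell 3 (.var 10) (.var 24))))

/-- Gaussian elimination of the masked rows of array `3`. -/
def Prog.eliminate : Prog := .for 10 (.var 7) (.seq .copyRow .insertRow)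

theorem copyRow_spec {W m ν i : ℕ} {s : Memory} {u tx tz : ℕ → PauliLabel (m + ν)}
    (h : Layout W m ν s u tx tz) (h10 : s.word 10 0 = i) (hi : i < m)
    (hbit : ∀ j, s.word 20 j < 2) :
    Spec W .copyRow s ((2 * (m + ν) + 1) * 60) fun s' =>
      (∀ b, b < 20 → s'.word b = s.word b) ∧ s'.real = s.real ∧ s'.word 21 = s.word 21 ∧
      (∀ j, s'.word 20 j < 2) ∧
      (∀ j, (j < i * (2 * (m + ν)) ∨ i * (2 * (m + ν)) + 2 * (m + ν) ≤ j) →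
        s'.word 20 j = s.word 20 j) ∧
      s'.row (m + ν) i = u i := by
  have hW := h.row_lt (i := i) (by omega)
  have h6 := h.width_eq
  refine (Spec.fillWord 24 20 (.var 6) _ _ (i * (2 * (m + ν))) (2 * (m + ν)) 60
    (fun c => s.word 8 c &&& s.word 3 (i * (2 * (m + ν)) + c)) _ (by decide) (by omega) (by omega)
    ?_ ?_ ?_ le_rfl).mono le_rfl ?_
  · intro s' hs'
    simp only [WordExp.Ok, WordExp.eval, hs' 6 (by decide) (by decide), h6, and_true]; omega
  · intro c s' hc hs' hc' hseg
    have b1 := h.u_eq i hi c hc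
    have b2 := ZMod.val_lt (coord (m + ν) c (u i))
    have b3 : s.word 8 c &&& s.word 3 (i * (2 * (m + ν)) + c) < W := by rw [b1]; omega
    simp only [WordExp.Ok, WordExp.eval, WordOp.eval, hs' 6 (by decide) (by decide),
      hs' 10 (by decide) (by decide), hs' 8 (by decide) (by decide),
      hs' 3 (by decide) (by decide), h6, h10, hc']
    refine ⟨⟨⟨?_, ?_, ?_⟩, ?_, ?_⟩, ⟨?_, ⟨⟨?_, ?_, ?_⟩, ?_, ?_⟩, ?_⟩, trivial, trivial⟩ <;>
      first | exact b3 | omega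
  · simp [WordExp.cost]
  · rintro s' ⟨h1, h2, h3⟩
    refine ⟨fun b hb => h1 b (by omega) (by omega), h2, h1 21 (by decide) (by decide),
      fun j => ?_, fun j hj => ?_, ?_⟩
    · rw [h3, segUpdate]
      split_ifs
      · rw [h.u_eq i hi _ (by omega)]
        exact ZMod.val_lt _
      · exact hbit j
    · rw [h3, segUpdate_of_not _ _ hj]
    · apply label_ext
      intro c hc
      rw [coord_rowLabel _ _ hc, h3, segUpdate_of_lt _ _ hc, h.u_eq i hi c hc,
        ZMod.natCast_zmod_val]

/-- The case `i < m` extends the system. The case `i = m` uses row `m` as a scratch row, which turns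
the same routine into a membership test that can be repeated. -/
theorem insertRow_eliminated {W m ν i : ℕ} {s : Memory} {u tx tz : ℕ → PauliLabel (m + ν)}
    (h : Layout W m ν s u tx tz) (h10 : s.word 10 0 = i) (hi : i ≤ m)
    (he : Eliminated m ν s u i) :
    Spec W .insertRow s ((i + 1) * ((m + ν) * 300)) fun s' =>
      (∀ b, b < 20 → s'.word b = s.word b) ∧ s'.real = s.real ∧ Eliminated m ν s' u i ∧
      s'.word 21 i < 2 * (m + ν) ∧
      s'.row (m + ν) i =
        reduceBy (coord (m + ν)) (s'.row (m + ν)) (s'.word 21) i (s.row (m + ν) i) ∧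
      (s'.row (m + ν) i = 0 ∨ coord (m + ν) (s'.word 21 i) (s'.row (m + ν) i) = 1) := by
  have hpos := h.pos
  refine (insertRow_spec h.width_eq h10 (h.row_lt (by omega)) he.bit he.piv_lt h.pos).mono le_rfl ?_
  rintro s' ⟨h1, h2, h3, h4, h5, h6, h7, h8⟩
  have hrow : ∀ k < i, s'.row (m + ν) k = s.row (m + ν) k := fun k hk => by
    have hkm : (k + 1) * (2 * (m + ν)) ≤ i * (2 * (m + ν)) := Nat.mul_le_mul_right _ hk
    rw [add_mul, one_mul] at hkm
    exact rowLabel_congr fun c hc => h4 _ (by omega)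
  have hpiv : ∀ k < i, s'.word 21 k = s.word 21 k := fun k hk => h5 k (by omega)
  refine ⟨h1, h2, ⟨h3, fun k hk => ?_, he.rows.congr hrow hpiv⟩, h6, ?_, h8⟩
  · rw [hpiv k hk]; exact he.piv_lt k hk
  · rw [h7, reduceBy_congr _ hrow hpiv]

theorem eliminate_spec {W m ν : ℕ} {s : Memory} {u tx tz : ℕ → PauliLabel (m + ν)}
    (h : Layout W m ν s u tx tz) (hbit : ∀ j, s.word 20 j < 2) :
    Spec W .eliminate s ((m + 1) * (m + 1) * ((m + ν) * 1000)) fun s' =>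
      (∀ b, b < 20 → b ≠ 10 → s'.word b = s.word b) ∧ s'.real = s.real ∧ s'.word 10 0 = m ∧
      Eliminated m ν s' u m := by
  have hpos := h.pos
  have hW := h.row_lt (i := m) (by omega)
  have hm : m ≤ m * (2 * (m + ν)) := Nat.le_mul_of_pos_right _ (by omega)
  refine (Spec.for 10 (.var 7) _ m ((2 * (m + ν) + 1) * 60 + (m + 1) * ((m + ν) * 300)) _
    (fun k s' => (∀ b, b < 20 → b ≠ 10 → s'.word b = s.word b) ∧ s'.real = s.real ∧
      Eliminated m ν s' u k)
    (by omega) (by omega) ?_ ?_ ?_ ?_ ?_).mono le_rfl fun s' h => ⟨h.1.1, h.1.2.1, h.2, h.1.2.2⟩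
  · rintro k s' - ⟨h1, -⟩
    simp only [WordExp.Ok, WordExp.eval, h1 7 (by decide) (by decide), h.m_eq, and_true]
    omega
  · rintro k s' x ⟨h1, h2, h3, h4, h5⟩
    refine ⟨fun b hb hb' => ?_, h2, ?_, ?_, ?_⟩
    · rw [Memory.word_setWord, if_neg hb', h1 b hb hb']
    · simpa [Memory.word_setWord] using h3
    · simpa [Memory.word_setWord] using h4
    · exact h5.congr (fun i _ => by simp [Memory.row, Memory.word_setWord])
        fun i _ => by simp [Memory.word_setWord]
  · exact ⟨fun _ _ _ => rfl, rfl, hbit, fun i hi => by omega, fun i hi => by omega⟩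
  · rintro k s' hk ⟨h1, h2, h3⟩ h10
    have hL : Layout W m ν s' u tx tz := h.congr fun b hb => h1 b (by omega) (by omega)
    refine Spec.seq (copyRow_spec hL h10 hk h3.bit) ?_ |>.mono le_rfl fun _ h => h
    rintro s₁ ⟨a1, a2, a3, a4, a5, a6⟩
    have hrow : ∀ i < k, s₁.row (m + ν) i = s'.row (m + ν) i := fun i hi => by
      have hkm : (i + 1) * (2 * (m + ν)) ≤ k * (2 * (m + ν)) := Nat.mul_le_mul_right _ hi
      rw [add_mul, one_mul] at hkm
      exact rowLabel_congr fun c hc => a5 _ (by omega)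
    have he : Eliminated m ν s₁ u k :=
      ⟨a4, by rw [a3]; exact h3.piv_lt, h3.rows.congr hrow fun i _ => by rw [a3]⟩
    refine (insertRow_eliminated (hL.congr fun b hb => a1 b (by omega))
      (by rw [a1 10 (by decide), h10]) hk.le he).mono
      (Nat.mul_le_mul_right _ (by omega)) ?_
    rintro s₂ ⟨b1, b2, b3, b4, b5, b6⟩
    refine ⟨by rw [b1 10 (by decide), a1 10 (by decide), h10], fun b hb hb' => ?_,
      by rw [b2, a2, h2], b3.bit, fun i hi => ?_, fun i hi => ?_⟩
    · rw [b1 b hb, a1 b hb, h1 b hb hb']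
    · rcases Nat.lt_succ_iff_lt_or_eq.mp hi with hi | rfl
      · exact b3.piv_lt i hi
      · exact b4
    · rcases Nat.lt_succ_iff_lt_or_eq.mp hi with hi | rfl
      · exact b3.rows i hi
      · exact ⟨by rw [b5, a6], b6⟩
  · simp only [WordExp.cost]
    have h1 : (2 * (m + ν) + 1) * 60 + (m + 1) * ((m + ν) * 300) + (1 + 1) + 9 ≤
        (m + 1) * ((m + ν) * 600) := by
      nlinarith [Nat.zero_le (m * (m + ν))]
    have h2 := Nat.mul_le_mul_left m h1
    nlinarith [Nat.zero_le (m * (m + 1) * (m + ν)), Nat.zero_le (m * (m + ν))]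

/-! ### The label of `C† (1 ⊗ P) C` and the membership test -/

/-- The bit `j` of `a`, as a number. -/
abbrev bitAt (a j : ℕ) : ℕ := (a >>> j) &&& 1

theorem bitAt_lt (a j : ℕ) : bitAt a j < 2 := by
  rw [bitAt, Nat.and_one_is_mod]
  omega

/-- The combination of the labels `tx` and `tz` with the bits of `a` and `z` as coefficients. -/
def bitCombination {n : ℕ} (tx tz : ℕ → PauliLabel n) (a z k : ℕ) : PauliLabel n :=
  ∑ j ∈ Finset.range k, ((bitAt a j : ZMod 2) • tx j + (bitAt z j : ZMod 2) • tz j)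

/-- Set row `word 10 0` of array `20` to zero. -/
def Prog.clearRow : Prog :=
  .for 24 (.var 6) (.setWord 20 (.op .add (.op .mul (.var 10) (.var 6)) (.var 24)) (.lit 0))

/-- Add to row `word 10 0` of array `20` the masked rows `m + j` and `n + m + j` of array `4`, with
coefficients `word 26 0` and `word 27 0`, where `j = word 25 0`. -/
def Prog.addTableauRows : Prog :=
  .for 24 (.var 6) (.setWord 20 (.op .add (.op .mul (.var 10) (.var 6)) (.var 24))
    (.op .xor
      (.op .xor (.cell 20 (.var 10) (.var 24))
        (.op .land (.var 26) (.op .land (.get 8 (.var 24))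
          (.cell 4 (.op .add (.var 7) (.var 25)) (.var 24)))))
      (.op .land (.var 27) (.op .land (.get 8 (.var 24))
          (.cell 4 (.op .add (.var 0) (.op .add (.var 7) (.var 25))) (.var 24))))))

/-- Write the masked label of `C† (1 ⊗ P) C` to row `word 10 0` of array `20`, where the bits of
`word 12 0` and `word 13 0` are the label of `P`. -/
def Prog.buildRow : Prog :=
  .seq .clearRow
    (.for 25 (.get 0 (.lit 1))
      (.seq (.setWord 26 (.lit 0) (.op .land (.op .shr (.var 12) (.var 25)) (.lit 1)))
        (.seq (.setWord 27 (.lit 0) (.op .land (.op .shr (.var 13) (.var 25)) (.lit 1)))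
          .addTableauRows)))

section

variable {W m ν : ℕ} {s : Memory} {u tx tz : ℕ → PauliLabel (m + ν)}

theorem clearRow_spec (h : Layout W m ν s u tx tz) (h10 : s.word 10 0 = m)
    (hbit : ∀ j, s.word 20 j < 2) :
    Spec W .clearRow s ((2 * (m + ν) + 1) * 60) fun s' =>
      (∀ b, b ≠ 20 → b ≠ 24 → s'.word b = s.word b) ∧ s'.real = s.real ∧
      (∀ j, s'.word 20 j < 2) ∧
      (∀ j, j < m * (2 * (m + ν)) → s'.word 20 j = s.word 20 j) ∧
      s'.row (m + ν) m = 0 := by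
  have hpos := h.pos
  have hW := h.row_lt (i := m) (by omega)
  have h6 := h.width_eq
  refine (Spec.fillWord 24 20 (.var 6) _ _ (m * (2 * (m + ν))) (2 * (m + ν)) 60
    (fun c => 0) _ (by decide) (by omega) (by omega)
    ?_ ?_ ?_ le_rfl).mono le_rfl ?_
  · intro s' hs'
    simp only [WordExp.Ok, WordExp.eval, hs' 6 (by decide) (by decide), h6, and_true]; omega
  · intro c s' hc hs' hc' hseg
    simp only [WordExp.Ok, WordExp.eval, WordOp.eval, hs' 6 (by decide) (by decide),
      hs' 10 (by decide) (by decide), h6, h10, hc', and_true]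
    omega
  · simp [WordExp.cost]
  · rintro s' ⟨h1, h2, h3⟩
    refine ⟨h1, h2, fun j => ?_, fun j hj => ?_, ?_⟩
    · rw [h3, segUpdate]
      split_ifs
      · omega
      · exact hbit j
    · rw [h3, segUpdate_of_not _ _ (Or.inl hj)]
    · apply label_ext
      intro c hc
      rw [coord_rowLabel _ _ hc, h3, segUpdate_of_lt _ _ hc, map_zero]
      rfl

theorem addTableauRows_spec (h : Layout W m ν s u tx tz) (h10 : s.word 10 0 = m)
    (hbit : ∀ j, s.word 20 j < 2) {j : ℕ} (hj : j < ν) (h25 : s.word 25 0 = j)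
    (h26 : s.word 26 0 < 2) (h27 : s.word 27 0 < 2) :
    Spec W .addTableauRows s ((2 * (m + ν) + 1) * 100) fun s' =>
      (∀ b, b ≠ 20 → b ≠ 24 → s'.word b = s.word b) ∧ s'.real = s.real ∧
      (∀ j, s'.word 20 j < 2) ∧
      (∀ j, j < m * (2 * (m + ν)) → s'.word 20 j = s.word 20 j) ∧
      s'.row (m + ν) m = s.row (m + ν) m +
        ((s.word 26 0 : ZMod 2) • tx j + (s.word 27 0 : ZMod 2) • tz j) := by
  have hpos := h.pos
  have hW := h.row_lt (i := m) (by omega)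
  have hW1 := h.row_lt (i := m + j) (by omega)
  have hW2 := h.row_lt (i := m + ν + (m + j)) (by omega)
  have hW3 : m + ν + (m + j) < W := by
    have : m + ν + (m + j) ≤ (m + ν + (m + j)) * (2 * (m + ν)) :=
      Nat.le_mul_of_pos_right _ (by omega)
    omega
  have h6 := h.width_eq
  have hx : ∀ c < 2 * (m + ν), s.word 8 c &&& s.word 4 ((m + j) * (2 * (m + ν)) + c) < 2 :=
    fun c hc => by rw [h.tx_eq j hj c hc]; exact ZMod.val_lt _
  have hz : ∀ c < 2 * (m + ν),
      s.word 8 c &&& s.word 4 ((m + ν + (m + j)) * (2 * (m + ν)) + c) < 2 :=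
    fun c hc => by rw [h.tz_eq j hj c hc]; exact ZMod.val_lt _
  have hb : ∀ c < 2 * (m + ν), s.word 20 (m * (2 * (m + ν)) + c) ^^^ (s.word 26 0 &&&
      (s.word 8 c &&& s.word 4 ((m + j) * (2 * (m + ν)) + c))) < 2 :=
    fun c hc => bit_xor_lt (hbit _) (bit_land_lt h26)
  refine (Spec.fillWord 24 20 (.var 6) _ _ (m * (2 * (m + ν))) (2 * (m + ν)) 100
    (fun c => s.word 20 (m * (2 * (m + ν)) + c) ^^^ (s.word 26 0 &&&
      (s.word 8 c &&& s.word 4 ((m + j) * (2 * (m + ν)) + c))) ^^^ (s.word 27 0 &&&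
      (s.word 8 c &&& s.word 4 ((m + ν + (m + j)) * (2 * (m + ν)) + c))))
    _ (by decide) (by omega) (by omega)
    ?_ ?_ ?_ le_rfl).mono le_rfl ?_
  · intro s' hs'
    simp only [WordExp.Ok, WordExp.eval, hs' 6 (by decide) (by decide), h6, and_true]; omega
  · intro c s' hc hs' hc' hseg
    have e1 : s'.word 20 (m * (2 * (m + ν)) + c) = s.word 20 (m * (2 * (m + ν)) + c) := by
      rw [hseg, segUpdate_of_not _ _ (by omega)]
    have o1 := hx c hc
    have o2 := hz c hc
    have o3 := hb c hc
    have o4 := bit_land_lt (d := s.word 8 c &&& s.word 4 ((m + j) * (2 * (m + ν)) + c)) h26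
    have o5 := bit_land_lt
      (d := s.word 8 c &&& s.word 4 ((m + ν + (m + j)) * (2 * (m + ν)) + c)) h27
    have o6 := bit_xor_lt o3 o5
    have w2 : 2 ≤ W := by omega
    simp only [WordExp.Ok, WordExp.eval, WordOp.eval, hs' 6 (by decide) (by decide),
      hs' 10 (by decide) (by decide), hs' 8 (by decide) (by decide), hs' 0 (by decide) (by decide),
      hs' 7 (by decide) (by decide), hs' 25 (by decide) (by decide),
      hs' 26 (by decide) (by decide), hs' 27 (by decide) (by decide),
      hs' 4 (by decide) (by decide), h6, h10, hc', h.m_eq, h.n_eq, h25, e1, o1.trans_le w2,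
      o2.trans_le w2, o3.trans_le w2, o4.trans_le w2, o5.trans_le w2, o6.trans_le w2, and_true]
    omega
  · simp [WordExp.cost]
  · rintro s' ⟨h1, h2, h3⟩
    refine ⟨h1, h2, fun i => ?_, fun i hi => ?_, ?_⟩
    · rw [h3, segUpdate]
      split_ifs
      · exact bit_xor_lt (hb _ (by omega)) (bit_land_lt h27)
      · exact hbit i
    · rw [h3, segUpdate_of_not _ _ (Or.inl hi)]
    · apply label_ext
      intro c hc
      rw [map_add, map_add, map_smul, map_smul, coord_rowLabel _ _ hc, coord_rowLabel _ _ hc,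
        h3, segUpdate_of_lt _ _ hc, smul_eq_mul, smul_eq_mul,
        bit_xor_land_cast (hb c hc) h27 (hz c hc), bit_xor_land_cast (hbit _) h26 (hx c hc),
        h.tx_eq j hj c hc, h.tz_eq j hj c hc, ZMod.natCast_zmod_val, ZMod.natCast_zmod_val,
        add_assoc]

/-- Conjugation acts linearly on labels (`bitCombination_eq`), so `ν` passes over pairs of tableau
rows suffice, at a cost of `O(ν n)`. The cells before row `m` hold the eliminated system and must
survive. -/
theorem buildRow_spec (h : Layout W m ν s u tx tz) (h10 : s.word 10 0 = m)
    (hbit : ∀ j, s.word 20 j < 2) {a z : ℕ} (h12 : s.word 12 0 = a) (h13 : s.word 13 0 = z)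
    (ha : a < 2 ^ ν) (hz : z < 2 ^ ν) :
    Spec W .buildRow s ((ν + 1) * ((m + ν) * 400)) fun s' =>
      (∀ b, b < 20 → s'.word b = s.word b) ∧ s'.word 21 = s.word 21 ∧ s'.real = s.real ∧
      (∀ j, s'.word 20 j < 2) ∧
      (∀ j, j < m * (2 * (m + ν)) → s'.word 20 j = s.word 20 j) ∧
      s'.row (m + ν) m = bitCombination tx tz a z ν := by
  have hpos := h.pos
  have hw := h.words
  have hl : 2 ^ ν + 20 < W := by
    have h1 := h.levels
    have h2 : 1 * 2 ^ ν ≤ (ν + 2) * 2 ^ ν := Nat.mul_le_mul_right _ (by omega)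
    omega
  have hνW : ν < W := lt_trans Nat.lt_two_pow_self (by omega)
  refine (Spec.seq (clearRow_spec h h10 hbit)
    (T' := ν * ((2 * (m + ν) + 1) * 100 + 40) + 20) ?_).mono ?_ fun _ h => h
  · rintro s₀ ⟨a1, a2, a3, a4, a5⟩
    have hL : Layout W m ν s₀ u tx tz := h.congr fun b hb => a1 b (by omega) (by omega)
    refine (Spec.for 25 (.get 0 (.lit 1)) _ ν ((2 * (m + ν) + 1) * 100 + 20) _
      (fun k s' => (∀ b, b < 20 → s'.word b = s₀.word b) ∧ s'.word 21 = s₀.word 21 ∧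
        s'.real = s₀.real ∧ (∀ j, s'.word 20 j < 2) ∧
        (∀ j, j < m * (2 * (m + ν)) → s'.word 20 j = s₀.word 20 j) ∧
        s'.row (m + ν) m = bitCombination tx tz a z k)
      hνW (by omega) ?_ ?_ ?_ ?_ ?_).mono le_rfl ?_
    · rintro k s' - ⟨h1, -⟩
      simp only [WordExp.Ok, WordExp.eval, h1 0 (by decide), hL.ν_eq, and_true]
      omega
    · rintro k s' x ⟨h1, h2, h3, h4, h5, h6⟩
      refine ⟨fun b hb => ?_, ?_, h3, ?_, ?_, ?_⟩
      · rw [Memory.word_setWord, if_neg (by omega), h1 b hb]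
      · simpa [Memory.word_setWord] using h2
      · simpa [Memory.word_setWord] using h4
      · simpa [Memory.word_setWord] using h5
      · simpa [Memory.word_setWord, Memory.row] using h6
    · refine ⟨fun _ _ => rfl, rfl, rfl, a3, fun _ _ => rfl, ?_⟩
      rw [a5]; simp [bitCombination]
    · rintro k s' hk ⟨h1, h2, h3, h4, h5, h6⟩ h25
      have g12 : s'.word 12 0 = a := by
        rw [h1 12 (by decide), a1 12 (by decide) (by decide), h12]
      have g13 : s'.word 13 0 = z := by
        rw [h1 13 (by decide), a1 13 (by decide) (by decide), h13]
      have la := bitAt_lt a k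
      have lz := bitAt_lt z k
      have sa : a >>> k ≤ a := by rw [Nat.shiftRight_eq_div_pow]; exact Nat.div_le_self _ _
      have sz : z >>> k ≤ z := by rw [Nat.shiftRight_eq_div_pow]; exact Nat.div_le_self _ _
      have wa : a >>> k < W := by omega
      have wz : z >>> k < W := by omega
      have wa' : a >>> k &&& 1 < W := lt_of_lt_of_le la (by omega)
      have wz' : z >>> k &&& 1 < W := lt_of_lt_of_le lz (by omega)
      refine (Spec.seq (T := 10) (R := fun s'' => s'' = s'.setWord 26 0 (bitAt a k))
        (Spec.setWord ?_ ?_ ?_ ?_) ?_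
        (T' := 10 + (2 * (m + ν) + 1) * 100)).mono (by omega) fun _ h => h
      · simp only [WordExp.Ok]; omega
      · simp only [WordExp.Ok, WordExp.eval, WordOp.eval, g12, h25, wa, wa', and_true]
        omega
      · simp only [WordExp.eval, WordOp.eval, g12, h25]
      · simp [WordExp.cost]
      rintro _ rfl
      refine Spec.seq (T := 10)
        (R := fun s'' => s'' = (s'.setWord 26 0 (bitAt a k)).setWord 27 0 (bitAt z k))
        (Spec.setWord ?_ ?_ ?_ ?_) ?_
      · simp only [WordExp.Ok]; omega
      · simp only [WordExp.Ok, WordExp.eval, WordOp.eval, Memory.word_setWord,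
          if_neg (show (13 : ℕ) ≠ 26 by decide), if_neg (show (25 : ℕ) ≠ 26 by decide), g13, h25,
          wz, wz', and_true]
        omega
      · simp only [WordExp.eval, WordOp.eval, Memory.word_setWord,
          if_neg (show (13 : ℕ) ≠ 26 by decide), if_neg (show (25 : ℕ) ≠ 26 by decide), g13, h25]
      · simp [WordExp.cost]
      rintro _ rfl
      have hw20 : ∀ b, b < 26 →
          ((s'.setWord 26 0 (bitAt a k)).setWord 27 0 (bitAt z k)).word b = s'.word b :=
        fun b hb => by
          rw [Memory.word_setWord, if_neg (by omega), Memory.word_setWord, if_neg (by omega)]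
      refine (addTableauRows_spec (u := u) (tx := tx) (tz := tz) (j := k) ?_ ?_ ?_ hk ?_ ?_ ?_).mono
        le_rfl ?_
      · exact hL.congr fun b hb => by rw [hw20 b (by omega), h1 b (by omega)]
      · rw [hw20 10 (by decide), h1 10 (by decide), a1 10 (by decide) (by decide), h10]
      · rw [hw20 20 (by decide)]; exact h4
      · rw [hw20 25 (by decide), h25]
      · rw [Memory.word_setWord, if_neg (by decide), Memory.word_setWord, if_pos rfl,
          Function.update_self]; exact la
      · rw [Memory.word_setWord, if_pos rfl, Function.update_self]; exact lz
      · rintro s'' ⟨b1, b2, b3, b4, b5⟩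
        have c26 : ((s'.setWord 26 0 (bitAt a k)).setWord 27 0 (bitAt z k)).word 26 0 =
            bitAt a k := by
          rw [Memory.word_setWord, if_neg (by decide), Memory.word_setWord, if_pos rfl,
            Function.update_self]
        have c27 : ((s'.setWord 26 0 (bitAt a k)).setWord 27 0 (bitAt z k)).word 27 0 =
            bitAt z k := by
          rw [Memory.word_setWord, if_pos rfl, Function.update_self]
        rw [c26, c27] at b5
        refine ⟨?_, fun b hb => ?_, ?_, ?_, b3, fun j hj => ?_, ?_⟩
        · rw [b1 25 (by decide) (by decide), hw20 25 (by decide), h25]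
        · rw [b1 b (by omega) (by omega), hw20 b (by omega), h1 b hb]
        · rw [b1 21 (by decide) (by decide), hw20 21 (by decide), h2]
        · rw [b2, Memory.real_setWord, Memory.real_setWord, h3]
        · rw [b4 j hj, hw20 20 (by decide), h5 j hj]
        · rw [Memory.row] at h6
          rw [b5, Memory.row, hw20 20 (by decide), h6, bitCombination, bitCombination,
            Finset.sum_range_succ]
    · simp only [WordExp.cost]
      have : ν * ((2 * (m + ν) + 1) * 100 + 20 + (1 + 1) + 9) ≤
          ν * ((2 * (m + ν) + 1) * 100 + 40) := Nat.mul_le_mul_left _ (by omega)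
      omega
    · rintro s' ⟨⟨h1, h2, h3, h4, h5, h6⟩, -⟩
      refine ⟨fun b hb => ?_, ?_, by rw [h3, a2], h4, fun j hj => ?_, h6⟩
      · rw [h1 b hb, a1 b (by omega) (by omega)]
      · rw [h2, a1 21 (by decide) (by decide)]
      · rw [h5 j hj, a4 j hj]
  · have e : (ν + 1) * ((m + ν) * 400) = ν * ((m + ν) * 400) + (m + ν) * 400 := by ring
    have : ν * ((2 * (m + ν) + 1) * 100 + 40) ≤ ν * ((m + ν) * 400) :=
      Nat.mul_le_mul_left _ (by omega)
    omega

/-- Decide whether `𝒫_B (C† (1 ⊗ P) C)` lies in the span of the eliminated rows. -/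
def Prog.testRow : Prog := .seq .buildRow .insertRow

-- The pivot search condenses "the reduced row is zero" into one cell: the pivot entry is `1` unless
-- the row vanishes. This bit can later be used as an arithmetic factor instead of a branch.
open Classical in
theorem testRow_spec (h : Layout W m ν s u tx tz) (h10 : s.word 10 0 = m)
    (he : Eliminated m ν s u m) {a z : ℕ} (h12 : s.word 12 0 = a) (h13 : s.word 13 0 = z)
    (ha : a < 2 ^ ν) (hz : z < 2 ^ ν) :
    Spec W .testRow s ((m + ν + 1) * ((m + ν) * 800)) fun s' =>
      (∀ b, b < 20 → s'.word b = s.word b) ∧ s'.real = s.real ∧ Eliminated m ν s' u m ∧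
      s'.word 21 m < 2 * (m + ν) ∧
      s'.word 20 (m * (2 * (m + ν)) + s'.word 21 m) =
        if bitCombination tx tz a z ν ∈ Submodule.span (ZMod 2) (u '' Set.Iio m) then 0 else 1 := by
  have hpos := h.pos
  refine (Spec.seq (buildRow_spec h h10 he.bit h12 h13 ha hz)
    (T' := (m + 1) * ((m + ν) * 300)) ?_).mono ?_ fun _ h => h
  · rintro s₀ ⟨a1, a2, a3, a4, a5, a6⟩
    have he₀ : Eliminated m ν s₀ u m := by
      refine ⟨a4, by rw [a2]; exact he.piv_lt, he.rows.congr (fun i hi => ?_) fun i _ => by rw [a2]⟩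
      have hkm : (i + 1) * (2 * (m + ν)) ≤ m * (2 * (m + ν)) := Nat.mul_le_mul_right _ hi
      rw [add_mul, one_mul] at hkm
      exact rowLabel_congr fun c hc => a5 _ (by omega)
    refine (insertRow_eliminated (h.congr fun b hb => a1 b (by omega))
      (by rw [a1 10 (by decide), h10]) le_rfl he₀).mono le_rfl ?_
    rintro s' ⟨b1, b2, b3, b4, b5, b6⟩
    refine ⟨fun b hb => by rw [b1 b hb, a1 b hb], by rw [b2, a3], b3, b4, ?_⟩
    have hlt := b3.bit (m * (2 * (m + ν)) + s'.word 21 m)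
    rw [a6] at b5
    rw [b3.rows.mem_span_iff, ← b5, ← bit_eq_val hlt, ← coord_rowLabel _ _ b4]
    split_ifs with h0
    · rw [show rowLabel _ _ _ = 0 from h0]; simp
    · rw [show coord _ _ (rowLabel _ _ _) = 1 from b6.resolve_left h0]; rfl
  · have h1 : (ν + 1) * ((m + ν) * 400) ≤ (m + ν + 1) * ((m + ν) * 400) :=
      Nat.mul_le_mul_right _ (by omega)
    have h2 : (m + 1) * ((m + ν) * 300) ≤ (m + ν + 1) * ((m + ν) * 400) :=
      Nat.mul_le_mul (by omega) (by omega)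
    have h3 : (m + ν + 1) * ((m + ν) * 800) = 2 * ((m + ν + 1) * ((m + ν) * 400)) := by ring
    omega

end

/-! ### The Walsh–Hadamard transform -/

/-- The first `j` butterfly levels of the Walsh–Hadamard transform. -/
def walsh (f : ℕ → ℝ) : ℕ → ℕ → ℝ
  | 0, i => f i
  | j + 1, i => walsh f j (i ^^^ 2 ^ j) + (1 - ((bitAt i j + bitAt i j : ℕ) : ℝ)) * walsh f j i

/-- One butterfly level, from level `word 29 0` to the next one, in the real array `r`. -/
def Prog.walshStep (r : ℕ) : Prog :=
  .for 28 (.var 5)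
    (.setReal r (.op .add (.op .mul (.op .add (.var 29) (.lit 1)) (.var 5)) (.var 28))
      (.add
        (.get r (.op .add (.op .mul (.var 29) (.var 5))
          (.op .xor (.var 28) (.op .shl (.lit 1) (.var 29)))))
        (.mul (.sub (.ofWord (.lit 1))
            (.ofWord (.op .add (.op .land (.op .shr (.var 28) (.var 29)) (.lit 1))
              (.op .land (.op .shr (.var 28) (.var 29)) (.lit 1)))))
          (.get r (.op .add (.op .mul (.var 29) (.var 5)) (.var 28))))))

/-- The Walsh–Hadamard transform in the real array `r`. -/
def Prog.walsh (r : ℕ) : Prog := .for 29 (.get 0 (.lit 1)) (.walshStep r)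

/-- The real and imaginary parts of `conj (φ i) * φ (i + a)`, where `a = word 12 0`. -/
def Prog.loadProducts : Prog :=
  .seq
    (.for 28 (.var 5) (.setReal 3 (.var 28)
      (.add (.mul (.get 0 (.var 28)) (.get 0 (.op .xor (.var 28) (.var 12))))
        (.mul (.get 1 (.var 28)) (.get 1 (.op .xor (.var 28) (.var 12)))))))
    (.for 28 (.var 5) (.setReal 4 (.var 28)
      (.sub (.mul (.get 0 (.var 28)) (.get 1 (.op .xor (.var 28) (.var 12))))
        (.mul (.get 1 (.var 28)) (.get 0 (.op .xor (.var 28) (.var 12)))))))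

section

variable {W m ν : ℕ} {s : Memory} {u tx tz : ℕ → PauliLabel (m + ν)}

theorem Layout.size_lt (h : Layout W m ν s u tx tz) : 2 ^ ν + 20 < W := by
  have h1 := h.levels
  have h2 : 1 * 2 ^ ν ≤ (ν + 2) * 2 ^ ν := Nat.mul_le_mul_right _ (by omega)
  omega

theorem Layout.level_lt (h : Layout W m ν s u tx tz) {j : ℕ} (hj : j ≤ ν + 1) :
    j * 2 ^ ν + 2 ^ ν < W := by
  have h1 := h.levels
  have h2 : (j + 1) * 2 ^ ν ≤ (ν + 2) * 2 ^ ν := Nat.mul_le_mul_right _ (by omega)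
  rw [add_mul, one_mul] at h2
  omega

/-- Level `j` occupies the block of `2^ν` cells at `j * 2^ν`. Writing the next level to a fresh
block keeps both butterfly inputs readable, and explains the factor `ν + 2` in `Layout.levels`. The
sign `(-1)^bit` is written as `1 - (bit + bit)`. -/
theorem walshStep_spec (h : Layout W m ν s u tx tz) (r : ℕ) {j : ℕ} (hj : j < ν)
    (h29 : s.word 29 0 = j) {g : ℕ → ℝ} (hg : ∀ i < 2 ^ ν, s.real r (j * 2 ^ ν + i) = g i) :
    Spec W (.walshStep r) s ((2 ^ ν + 1) * 100) fun s' =>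
      (∀ b, b ≠ 28 → s'.word b = s.word b) ∧ (∀ b, b ≠ r → s'.real b = s.real b) ∧
      ∀ i < 2 ^ ν, s'.real r ((j + 1) * 2 ^ ν + i) =
        g (i ^^^ 2 ^ j) + (1 - ((bitAt i j + bitAt i j : ℕ) : ℝ)) * g i := by
  have hN := h.size_lt
  have hL := h.level_lt (j := j) (by omega)
  have hL' := h.level_lt (j := j + 1) (by omega)
  have h2j : 2 ^ j < 2 ^ ν := Nat.pow_lt_pow_right (by omega) hj
  have hjj : j < 2 ^ j := Nat.lt_two_pow_self
  have hsum : (j + 1) * 2 ^ ν = j * 2 ^ ν + 2 ^ ν := by ring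
  refine (Spec.fillReal 28 r (.var 5) _ _ ((j + 1) * 2 ^ ν) (2 ^ ν) 100
    (fun i => g (i ^^^ 2 ^ j) + (1 - ((bitAt i j + bitAt i j : ℕ) : ℝ)) * g i) _
    (by omega) (by omega) ?_ ?_ ?_ le_rfl).mono le_rfl ?_
  · intro s' hs'
    simp only [WordExp.Ok, WordExp.eval, hs' 5 (by decide), h.size_eq, and_true]; omega
  · intro c s' hc hs' hc' hr hseg
    have hx : c ^^^ 2 ^ j < 2 ^ ν := Nat.xor_lt_two_pow hc h2j
    have e1 : s'.real r (j * 2 ^ ν + (c ^^^ 2 ^ j)) = g (c ^^^ 2 ^ j) := by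
      rw [hseg, segUpdate_of_not _ _ (Or.inl (by omega)), hg _ hx]
    have e2 : s'.real r (j * 2 ^ ν + c) = g c := by
      rw [hseg, segUpdate_of_not _ _ (by omega), hg _ hc]
    have hb : bitAt c j < 2 := bitAt_lt c j
    have o1 : c >>> j < W := by
      refine lt_of_le_of_lt (?_ : _ ≤ c) (by omega)
      rw [Nat.shiftRight_eq_div_pow]; exact Nat.div_le_self _ _
    have o2 : c >>> j &&& 1 < W := lt_of_lt_of_le hb (by omega)
    have o3 : (c >>> j &&& 1) + (c >>> j &&& 1) < W :=
      lt_of_lt_of_le (Nat.add_lt_add hb hb) (by omega)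
    have o4 : c ^^^ 2 ^ j < W := by omega
    have o5 : j * 2 ^ ν + (c ^^^ 2 ^ j) < W := by omega
    simp only [WordExp.Ok, RealExp.Ok, WordExp.eval, RealExp.eval, WordOp.eval, hs' 5 (by decide),
      hs' 29 (by decide), h29, h.size_eq, hc', Nat.one_shiftLeft, e1, e2, o1, o2, o3, o4, o5,
      Nat.cast_one, and_true]
    omega
  · simp [WordExp.cost, RealExp.cost]
  · rintro s' ⟨h1, h2, h3⟩
    refine ⟨h1, h2, fun i hi => ?_⟩
    rw [h3, segUpdate_of_lt _ _ hi]

theorem walsh_spec (h : Layout W m ν s u tx tz) (r : ℕ) {f : ℕ → ℝ}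
    (hf : ∀ i < 2 ^ ν, s.real r i = f i) :
    Spec W (.walsh r) s ((ν + 1) * (2 ^ ν * 300)) fun s' =>
      (∀ b, b ≠ 28 → b ≠ 29 → s'.word b = s.word b) ∧ (∀ b, b ≠ r → s'.real b = s.real b) ∧
      ∀ i < 2 ^ ν, s'.real r (ν * 2 ^ ν + i) = walsh f ν i := by
  have hN := h.size_lt
  have h2 : 0 < 2 ^ ν := by positivity
  have hν : ν < 2 ^ ν := Nat.lt_two_pow_self
  refine (Spec.for 29 (.get 0 (.lit 1)) _ ν ((2 ^ ν + 1) * 100) _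
    (fun k s' => (∀ b, b ≠ 28 → b ≠ 29 → s'.word b = s.word b) ∧
      (∀ b, b ≠ r → s'.real b = s.real b) ∧
      ∀ i < 2 ^ ν, s'.real r (k * 2 ^ ν + i) = walsh f k i)
    (by omega) (by omega) ?_ ?_ ?_ ?_ ?_).mono le_rfl fun s' h => h.1
  · rintro k s' - ⟨h1, -⟩
    simp only [WordExp.Ok, WordExp.eval, h1 0 (by decide) (by decide), h.ν_eq, and_true]
    omega
  · rintro k s' x ⟨h1, h2, h3⟩
    exact ⟨fun b hb hb' => by rw [Memory.word_setWord, if_neg hb', h1 b hb hb'], h2, h3⟩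
  · exact ⟨fun _ _ _ => rfl, fun _ _ => rfl, fun i hi => by rw [zero_mul, zero_add, hf i hi]; rfl⟩
  · rintro k s' hk ⟨h1, h2, h3⟩ h29
    refine (walshStep_spec (h.congr fun b hb => h1 b (by omega) (by omega)) r hk h29 h3).mono
      le_rfl ?_
    rintro s'' ⟨g1, g2, g3⟩
    exact ⟨by rw [g1 29 (by decide), h29], fun b hb hb' => by rw [g1 b hb, h1 b hb hb'],
      fun b hb => by rw [g2 b hb, h2 b hb], g3⟩
  · simp only [WordExp.cost]
    have : ν * ((2 ^ ν + 1) * 100 + (1 + 1) + 9) ≤ ν * (2 ^ ν * 300) :=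
      Nat.mul_le_mul_left _ (by omega)
    have e : (ν + 1) * (2 ^ ν * 300) = ν * (2 ^ ν * 300) + 2 ^ ν * 300 := by ring
    omega

/-- The real part of `conj (φ i) * φ (i + a)`. -/
def productRe (re im : ℕ → ℝ) (a i : ℕ) : ℝ := re i * re (i ^^^ a) + im i * im (i ^^^ a)

/-- The imaginary part of `conj (φ i) * φ (i + a)`. -/
def productIm (re im : ℕ → ℝ) (a i : ℕ) : ℝ := re i * im (i ^^^ a) - im i * re (i ^^^ a)

theorem loadProducts_spec (h : Layout W m ν s u tx tz) {a : ℕ} (h12 : s.word 12 0 = a)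
    (ha : a < 2 ^ ν) :
    Spec W .loadProducts s (2 ^ ν * 400) fun s' =>
      (∀ b, b ≠ 28 → s'.word b = s.word b) ∧ (∀ b, b ≠ 3 → b ≠ 4 → s'.real b = s.real b) ∧
      (∀ i < 2 ^ ν, s'.real 3 i = productRe (s.real 0) (s.real 1) a i) ∧
      ∀ i < 2 ^ ν, s'.real 4 i = productIm (s.real 0) (s.real 1) a i := by
  have hN := h.size_lt
  have h2 : 0 < 2 ^ ν := by positivity
  -- Both loops differ only in the expression they store, so one argument covers them. The condition
  -- `1 < r` protects the amplitudes in the real arrays `0` and `1`.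
  have step : ∀ (r : ℕ) (e : RealExp) (g : (ℕ → ℝ) → (ℕ → ℝ) → ℕ → ℕ → ℝ) (s₀ : Memory)
      (_ : Layout W m ν s₀ u tx tz) (_ : 1 < r)
      (_ : ∀ c s', c < 2 ^ ν → s'.word 12 0 = a → s'.word 28 0 = c → c ^^^ a < W →
        e.Ok W s' ∧ e.eval s' = g (s'.real 0) (s'.real 1) a c)
      (_ : s₀.word 12 0 = a) (_ : e.cost ≤ 70),
      Spec W (.for 28 (.var 5) (.setReal r (.var 28) e)) s₀ ((2 ^ ν + 1) * 100) fun s' =>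
      (∀ b, b ≠ 28 → s'.word b = s₀.word b) ∧ (∀ b, b ≠ r → s'.real b = s₀.real b) ∧
      (∀ i < 2 ^ ν, s'.real r i = g (s₀.real 0) (s₀.real 1) a i) := by
    intro r e g s₀ h hr he h12 hcost
    refine (Spec.fillReal 28 r (.var 5) _ _ 0 (2 ^ ν) 100
      (fun i => g (s₀.real 0) (s₀.real 1) a i) _
      (by omega) (by omega) ?_ ?_ ?_ le_rfl).mono le_rfl ?_
    · intro s' hs'
      simp only [WordExp.Ok, WordExp.eval, hs' 5 (by decide), h.size_eq, and_true]; omega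
    · intro c s' hc hs' hc' hr' hseg
      have hx : c ^^^ a < 2 ^ ν := Nat.xor_lt_two_pow hc ha
      obtain ⟨e1, e2⟩ := he c s' hc (by rw [hs' 12 (by decide), h12]) hc' (by omega)
      refine ⟨by simp only [WordExp.Ok]; omega, e1, by simp only [WordExp.eval, hc', zero_add], ?_⟩
      rw [e2, hr' 0 (by omega), hr' 1 (by omega)]
    · simp only [WordExp.cost]; omega
    · rintro s' ⟨h1, h2, h3⟩
      refine ⟨h1, h2, fun i hi => ?_⟩
      have := segUpdate_of_lt (s₀.real r) (base := 0) (fun i => g (s₀.real 0) (s₀.real 1) a i) hi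
      rw [zero_add] at this
      rw [h3, this]
  refine (Spec.seq (step 3 _ productRe s h (by decide) ?_ h12 (by decide)) ?_
    (T' := (2 ^ ν + 1) * 100)).mono (by omega) fun _ h => h
  · intro c s' hc h12' h28 hW
    simp only [WordExp.Ok, RealExp.Ok, WordExp.eval, RealExp.eval, WordOp.eval, h12', h28, hW,
      and_true, productRe]
    omega
  rintro s' ⟨a1, a2, a3⟩
  refine (step 4 _ productIm s' (h.congr fun b hb => a1 b (by omega)) (by decide) ?_
    (by rw [a1 12 (by decide), h12]) (by decide)).mono le_rfl ?_
  · intro c s' hc h12' h28 hW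
    simp only [WordExp.Ok, RealExp.Ok, WordExp.eval, RealExp.eval, WordOp.eval, h12', h28, hW,
      and_true, productIm]
    omega
  rintro s'' ⟨b1, b2, b3⟩
  refine ⟨fun b hb => by rw [b1 b hb, a1 b hb], fun b hb hb' => by rw [b2 b hb', a2 b hb],
    fun i hi => by rw [b2 3 (by decide), a3 i hi], fun i hi => ?_⟩
  rw [b3 i hi, a2 0 (by decide), a2 1 (by decide)]

end

/-! ### The entropy algorithm -/

/-- Add the contribution of one Pauli operator to the sum in cell `1` of the real array `2`. -/
def Prog.accumulate : Prog :=
  .setReal 2 (.lit 1) (.add (.get 2 (.lit 1))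
    (.mul (.sub (.ofWord (.lit 1)) (.ofWord (.cell 20 (.var 10) (.get 21 (.var 10)))))
      (.add
        (.mul (.get 3 (.op .add (.op .mul (.get 0 (.lit 1)) (.var 5)) (.var 13)))
          (.get 3 (.op .add (.op .mul (.get 0 (.lit 1)) (.var 5)) (.var 13))))
        (.mul (.get 4 (.op .add (.op .mul (.get 0 (.lit 1)) (.var 5)) (.var 13)))
          (.get 4 (.op .add (.op .mul (.get 0 (.lit 1)) (.var 5)) (.var 13)))))))

/-- The contributions of all Pauli operators with X-part `word 12 0`. -/
def Prog.sumZ : Prog := .for 13 (.var 5) (.seq .testRow .accumulate)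

/-- The contributions of all Pauli operators. -/
def Prog.sumX : Prog :=
  .for 12 (.var 5) (.seq .loadProducts (.seq (.walsh 3) (.seq (.walsh 4) .sumZ)))

open Classical in
/-- The contribution of the Pauli operator with bits `a` and `z`. -/
noncomputable def contribution {n : ℕ} (S : Submodule (ZMod 2) (PauliLabel n)) (tx tz : ℕ → PauliLabel n)
    (re im : ℕ → ℝ) (ν a z : ℕ) : ℝ :=
  if bitCombination tx tz a z ν ∈ S then
    walsh (productRe re im a) ν z ^ 2 + walsh (productIm re im a) ν z ^ 2 else 0

section

variable {W m ν : ℕ} {s : Memory} {u tx tz : ℕ → PauliLabel (m + ν)}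

theorem Eliminated.of_eq {k : ℕ} {s' : Memory} (h : Eliminated m ν s u k)
    (h20 : s'.word 20 = s.word 20) (h21 : s'.word 21 = s.word 21) : Eliminated m ν s' u k :=
  ⟨by rw [h20]; exact h.bit, by rw [h21]; exact h.piv_lt,
    h.rows.congr (fun i _ => by rw [Memory.row, h20]) fun i _ => by rw [h21]⟩

/-- Each Z-part costs one membership test, `O(n²)`, and a constant number of real operations; the
transforms for the X-part `a` are already available in block `ν` of the real arrays `3` and `4`. -/
theorem sumZ_spec (h : Layout W m ν s u tx tz) (h10 : s.word 10 0 = m)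
    (he : Eliminated m ν s u m) {a : ℕ} (h12 : s.word 12 0 = a) (ha : a < 2 ^ ν)
    {re im : ℕ → ℝ}
    (hre : ∀ i < 2 ^ ν, s.real 3 (ν * 2 ^ ν + i) = walsh (productRe re im a) ν i)
    (him : ∀ i < 2 ^ ν, s.real 4 (ν * 2 ^ ν + i) = walsh (productIm re im a) ν i) :
    Spec W .sumZ s ((2 ^ ν + 1) * ((m + ν + 1) * ((m + ν) * 800) + 100)) fun s' =>
      (∀ b, b < 20 → b ≠ 13 → s'.word b = s.word b) ∧ (∀ b, b ≠ 2 → s'.real b = s.real b) ∧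
      Eliminated m ν s' u m ∧
      s'.real 2 1 = s.real 2 1 + ∑ z ∈ Finset.range (2 ^ ν),
        contribution (Submodule.span (ZMod 2) (u '' Set.Iio m)) tx tz re im ν a z := by
  have hN := h.size_lt
  have hpos := h.pos
  have hrow := h.row_lt (i := m) (by omega)
  have hlev := h.level_lt (j := ν) (by omega)
  refine (Spec.for 13 (.var 5) _ (2 ^ ν) ((m + ν + 1) * ((m + ν) * 800) + 60) _
    (fun k s' => (∀ b, b < 20 → b ≠ 13 → s'.word b = s.word b) ∧
      (∀ b, b ≠ 2 → s'.real b = s.real b) ∧ Eliminated m ν s' u m ∧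
      s'.real 2 1 = s.real 2 1 + ∑ z ∈ Finset.range k,
        contribution (Submodule.span (ZMod 2) (u '' Set.Iio m)) tx tz re im ν a z)
    (by omega) (by omega) ?_ ?_ ?_ ?_ ?_).mono le_rfl fun s' h => h.1
  · rintro k s' - ⟨h1, -⟩
    simp only [WordExp.Ok, WordExp.eval, h1 5 (by decide) (by decide), h.size_eq, and_true]
    omega
  · rintro k s' x ⟨h1, h2, h3, h4⟩
    refine ⟨fun b hb hb' => by rw [Memory.word_setWord, if_neg hb', h1 b hb hb'], h2,
      h3.of_eq ?_ ?_, h4⟩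
    · rw [Memory.word_setWord, if_neg (by decide)]
    · rw [Memory.word_setWord, if_neg (by decide)]
  · exact ⟨fun _ _ _ => rfl, fun _ _ => rfl, he, by simp⟩
  · rintro k s' hk ⟨h1, h2, h3, h4⟩ h13
    have hL : Layout W m ν s' u tx tz := h.congr fun b hb => h1 b (by omega) (by omega)
    have g10 : s'.word 10 0 = m := by rw [h1 10 (by decide) (by decide), h10]
    have g12 : s'.word 12 0 = a := by rw [h1 12 (by decide) (by decide), h12]
    refine Spec.seq (testRow_spec hL g10 h3 g12 h13 ha hk) ?_ (T' := 60)
    rintro s₁ ⟨a1, a2, a3, a4, a5⟩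
    have e10 : s₁.word 10 0 = m := by rw [a1 10 (by decide), g10]
    have e13 : s₁.word 13 0 = k := by rw [a1 13 (by decide), h13]
    have e5 : s₁.word 5 0 = 2 ^ ν := by rw [a1 5 (by decide), hL.size_eq]
    have e0 : s₁.word 0 1 = ν := by rw [a1 0 (by decide), hL.ν_eq]
    have e6 : s₁.word 6 0 = 2 * (m + ν) := by rw [a1 6 (by decide), hL.width_eq]
    have r3 : s₁.real 3 (ν * 2 ^ ν + k) = walsh (productRe re im a) ν k := by
      rw [a2, h2 3 (by decide), hre k hk]
    have r4 : s₁.real 4 (ν * 2 ^ ν + k) = walsh (productIm re im a) ν k := by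
      rw [a2, h2 4 (by decide), him k hk]
    refine Spec.setReal ?_ ?_ ?_ ?_
    · simp only [WordExp.Ok]; omega
    · simp only [RealExp.Ok, WordExp.Ok, WordExp.eval, WordOp.eval, e10, e13, e5, e0, e6]
      omega
    · simp only [RealExp.eval, WordExp.eval, WordOp.eval, e10, e13, e5, e0, e6, r3, r4, a5]
      refine ⟨e13, fun b hb hb' => ?_, fun b hb => ?_, a3.of_eq rfl rfl, ?_⟩
      · rw [Memory.word_setReal, a1 b hb, h1 b hb hb']
      · rw [Memory.real_setReal, if_neg hb, a2, h2 b hb]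
      -- The factor `1 - cell` is the indicator of membership, which matches the case split in
      -- `contribution`.
      · rw [Memory.real_setReal, if_pos rfl, Function.update_self, a2, h4, Finset.sum_range_succ,
          contribution]
        split_ifs <;> push_cast <;> ring
    · simp [WordExp.cost, RealExp.cost]
  · simp only [WordExp.cost]
    have : 2 ^ ν * ((m + ν + 1) * ((m + ν) * 800) + 60 + (1 + 1) + 9) ≤
        2 ^ ν * ((m + ν + 1) * ((m + ν) * 800) + 100) := Nat.mul_le_mul_left _ (by omega)
    rw [add_mul (2 ^ ν) 1, one_mul]
    omega

/-- The budget of `sumX_spec`, with `Z` for `2^ν` and `X` for the cost of `Prog.sumZ`. -/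
theorem sumX_cost_le (X Z k : ℕ) :
    Z * (Z * 400 + ((k + 1) * (Z * 300) + ((k + 1) * (Z * 300) + X)) + (1 + 1) + 9) +
      (1 + 1) + 7 ≤ (Z + 1) * (X + (k + 2) * (Z * 600) + 100) := by
  have h2 : Z * (Z * 400 + ((k + 1) * (Z * 300) + ((k + 1) * (Z * 300) + X)) + (1 + 1) + 9) ≤
      Z * (X + (k + 2) * (Z * 600) + 100) := by
    refine Nat.mul_le_mul_left Z ?_
    have : (k + 2) * (Z * 600) = 2 * ((k + 1) * (Z * 300)) + Z * 600 := by ring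
    omega
  rw [add_mul Z 1, one_mul]
  exact (Nat.add_le_add_right (Nat.add_le_add_right h2 _) _).trans (by omega)

/-- Two transforms per X-part serve all `2^ν` Z-parts, so the transforms cost `O(ν 4^ν)` altogether.
The invariant keeps the amplitudes unchanged, because every round forms its products from them anew.
-/
theorem sumX_spec (h : Layout W m ν s u tx tz) (h10 : s.word 10 0 = m)
    (he : Eliminated m ν s u m) (h21 : s.real 2 1 = 0) :
    Spec W .sumX s ((2 ^ ν + 1) * ((2 ^ ν + 1) * ((m + ν + 1) * ((m + ν) * 800) + 100) +
        (ν + 2) * (2 ^ ν * 600) + 100)) fun s' =>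
      (∀ b, b < 12 → s'.word b = s.word b) ∧ Eliminated m ν s' u m ∧
      s'.real 2 1 = ∑ a ∈ Finset.range (2 ^ ν), ∑ z ∈ Finset.range (2 ^ ν),
        contribution (Submodule.span (ZMod 2) (u '' Set.Iio m)) tx tz (s.real 0) (s.real 1)
          ν a z := by
  have hN := h.size_lt
  have hpos := h.pos
  have hNpos : 0 < 2 ^ ν := by positivity
  refine (Spec.for 12 (.var 5) _ (2 ^ ν)
    (2 ^ ν * 400 + ((ν + 1) * (2 ^ ν * 300) + ((ν + 1) * (2 ^ ν * 300) +
      (2 ^ ν + 1) * ((m + ν + 1) * ((m + ν) * 800) + 100)))) _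
    (fun k s' => (∀ b, b < 12 → s'.word b = s.word b) ∧ Eliminated m ν s' u m ∧
      s'.real 0 = s.real 0 ∧ s'.real 1 = s.real 1 ∧
      s'.real 2 1 = ∑ a ∈ Finset.range k, ∑ z ∈ Finset.range (2 ^ ν),
        contribution (Submodule.span (ZMod 2) (u '' Set.Iio m)) tx tz (s.real 0) (s.real 1)
          ν a z)
    (by omega) (by omega) ?_ ?_ ?_ ?_ ?_).mono le_rfl fun s' h => ⟨h.1.1, h.1.2.1, h.1.2.2.2.2⟩
  · rintro k s' - ⟨h1, -⟩
    simp only [WordExp.Ok, WordExp.eval, h1 5 (by decide), h.size_eq, and_true]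
    omega
  · rintro k s' x ⟨h1, h2, h3⟩
    refine ⟨fun b hb => by rw [Memory.word_setWord, if_neg (by omega), h1 b hb],
      h2.of_eq ?_ ?_, h3⟩
    · rw [Memory.word_setWord, if_neg (by decide)]
    · rw [Memory.word_setWord, if_neg (by decide)]
  · exact ⟨fun _ _ => rfl, he, rfl, rfl, by simpa using h21⟩
  · rintro k s' hk ⟨h1, h2, h3, h4, h5⟩ h12
    have hL : Layout W m ν s' u tx tz := h.congr fun b hb => h1 b (by omega)
    refine Spec.seq (loadProducts_spec hL h12 hk) ?_
    rintro s₁ ⟨a1, a2, a3, a4⟩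
    have hL₁ : Layout W m ν s₁ u tx tz := hL.congr fun b hb => a1 b (by omega)
    refine Spec.seq (walsh_spec hL₁ 3 a3) ?_
    rintro s₂ ⟨b1, b2, b3⟩
    have hL₂ : Layout W m ν s₂ u tx tz := hL₁.congr fun b hb => b1 b (by omega) (by omega)
    refine Spec.seq (walsh_spec hL₂ 4 (fun i hi => by rw [b2 4 (by decide), a4 i hi])) ?_
    rintro s₃ ⟨c1, c2, c3⟩
    have hw : ∀ b, b < 28 → s₃.word b = s'.word b := fun b hb => by
      rw [c1 b (by omega) (by omega), b1 b (by omega) (by omega), a1 b (by omega)]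
    have hr : ∀ b, b < 3 → s₃.real b = s'.real b := fun b hb => by
      rw [c2 b (by omega), b2 b (by omega), a2 b (by omega) (by omega)]
    refine (sumZ_spec (hL.congr fun b hb => hw b (by omega)) ?_ (h2.of_eq (hw _ (by decide))
      (hw _ (by decide))) ?_ hk ?_ c3).mono le_rfl ?_
    · rw [hw 10 (by decide), h1 10 (by decide), h10]
    · rw [hw 12 (by decide), h12]
    · intro i hi
      rw [c2 3 (by decide), b3 i hi]
    rintro s₄ ⟨d1, d2, d3, d4⟩
    refine ⟨?_, fun b hb => ?_, d3, ?_, ?_, ?_⟩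
    · rw [d1 12 (by decide) (by decide), hw 12 (by decide), h12]
    · rw [d1 b (by omega) (by omega), hw b (by omega), h1 b hb]
    · rw [d2 0 (by decide), hr 0 (by decide), h3]
    · rw [d2 1 (by decide), hr 1 (by decide), h4]
    · rw [d4, hr 2 (by decide), h5, h3, h4, Finset.sum_range_succ]
  · exact sumX_cost_le ..

end

/-! ### Preparation, rank and the complete program -/

/-- A loop that computes prefix sums in array `a`. -/
theorem Spec.prefixSum {W : ℕ} {s : Memory} (v a : ℕ) (bound e : WordExp) (B C : ℕ)
    (g : ℕ → ℕ) (T' : ℕ) (hav : v ≠ a) (hBW : B + 1 < W) (hg : ∀ c < B, g c ≤ 1)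
    (h0 : s.word a 0 = 0)
    (hbound : ∀ s' : Memory, (∀ b, b ≠ a → b ≠ v → s'.word b = s.word b) →
      bound.Ok W s' ∧ bound.eval s' = B)
    (h : ∀ c s', c < B → (∀ b, b ≠ a → b ≠ v → s'.word b = s.word b) → s'.word v 0 = c →
      e.Ok W s' ∧ e.eval s' = g c)
    (hC : e.cost + bound.cost + 40 ≤ C) (hT : (B + 1) * C ≤ T') :
    Spec W (.for v bound (.setWord a (.op .add (.lit 1) (.var v))
        (.op .add (.get a (.var v)) e))) s T' fun s' =>
      (∀ b, b ≠ a → b ≠ v → s'.word b = s.word b) ∧ s'.real = s.real ∧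
      s'.word a B = ∑ c ∈ Finset.range B, g c := by
  -- The segment starts at cell `1`; cell `0`, which is initially zero, is the empty sum. Terms
  -- bounded by `1` keep the partial sums below `B + 1`, within the word range.
  refine (Spec.fillWord v a bound _ _ 1 B C (fun c => ∑ i ∈ Finset.range (c + 1), g i) T' hav
    (by omega) (by omega) hbound ?_ (by simp only [WordExp.cost]; omega) hT).mono le_rfl ?_
  · intro c s' hc hs' hc' hseg
    obtain ⟨e1, e2⟩ := h c s' hc hs' hc'
    have hle : ∑ i ∈ Finset.range (c + 1), g i ≤ c + 1 := by
      simpa using Finset.sum_le_card_nsmul (Finset.range (c + 1)) g 1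
        fun i hi => hg i (by have := Finset.mem_range.mp hi; omega)
    have hprev : s'.word a c = ∑ i ∈ Finset.range c, g i := by
      rw [hseg]
      rcases c with _ | c
      · rw [segUpdate_of_not _ _ (by omega), h0]; rfl
      · rw [add_comm c 1, segUpdate_of_lt _ _ (by omega), add_comm 1 c]
    show _ ∧ _ ∧ _ ∧ _ = ∑ i ∈ Finset.range (c + 1), g i
    rw [Finset.sum_range_succ, ← hprev] at hle ⊢
    simp only [WordExp.Ok, WordExp.eval, WordOp.eval, hc', e1, e2, and_true, true_and]
    omega
  · rintro s' ⟨h1, h2, h3⟩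
    refine ⟨h1, h2, ?_⟩
    rw [h3]
    rcases B with _ | B
    · rw [segUpdate_of_not _ _ (by omega), h0]; rfl
    · rw [add_comm B 1, segUpdate_of_lt _ _ (by omega), add_comm 1 B]

/-- Derived quantities: `2^ν`, the row length `2n`, `m`, the mask of `B`, and `n_A`. -/
def Prog.setup : Prog :=
  .seq (.setWord 5 (.lit 0) (.op .shl (.lit 1) (.get 0 (.lit 1))))
  (.seq (.setWord 6 (.lit 0) (.op .add (.var 0) (.var 0)))
  (.seq (.setWord 7 (.lit 0) (.op .sub (.var 0) (.get 0 (.lit 1))))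
  (.seq (.for 28 (.var 0) (.setWord 8 (.var 28) (.op .sub (.lit 1) (.get 1 (.var 28)))))
  (.seq (.for 28 (.var 0) (.setWord 8 (.op .add (.var 0) (.var 28))
    (.op .sub (.lit 1) (.get 1 (.var 28)))))
  (.for 28 (.var 0) (.setWord 9 (.op .add (.lit 1) (.var 28))
    (.op .add (.get 9 (.var 28)) (.get 1 (.var 28)))))))))

theorem setup_spec {W m ν : ℕ} {s : Memory} (hpos : 0 < m + ν)
    (words : 4 * ((m + ν) * (m + ν)) + 20 < W) (hN : 2 ^ ν < W) (h0 : s.word 0 0 = m + ν)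
    (h01 : s.word 0 1 = ν) (hA : ∀ c, s.word 1 c ≤ 1) (h9 : s.word 9 0 = 0) :
    Spec W .setup s ((m + ν) * 1000) fun s' =>
      (∀ b, (b < 5 ∨ 9 < b) → b ≠ 28 → s'.word b = s.word b) ∧ s'.real = s.real ∧
      s'.word 5 0 = 2 ^ ν ∧ s'.word 6 0 = 2 * (m + ν) ∧ s'.word 7 0 = m ∧
      (∀ c < m + ν, s'.word 8 c = 1 - s.word 1 c) ∧
      (∀ c < m + ν, s'.word 8 (m + ν + c) = 1 - s.word 1 c) ∧
      s'.word 9 (m + ν) = ∑ c ∈ Finset.range (m + ν), s.word 1 c := by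
  have hn : m + ν ≤ (m + ν) * (m + ν) := Nat.le_mul_of_pos_right _ hpos
  have hν : ν < 2 ^ ν := Nat.lt_two_pow_self
  have step : ∀ (s₀ : Memory) (a : ℕ) (e : WordExp) (v : ℕ) (_ : e.Ok W s₀) (_ : e.eval s₀ = v)
      (_ : e.cost ≤ 8), Spec W (.setWord a (.lit 0) e) s₀ 10
        fun s' => s' = s₀.setWord a 0 v := by
    intro s₀ a e v h1 h2 h3
    refine Spec.setWord (by simp only [WordExp.Ok]; omega) h1 (by rw [h2]; rfl) ?_
    simp only [WordExp.cost]; omega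
  have T1 : (m + ν) * 1000 ≥ 10 + (10 + (10 + ((m + ν + 1) * 60 + ((m + ν + 1) * 60 +
    (m + ν + 1) * 60)))) := by omega
  refine Spec.mono ?_ T1 fun _ h => h
  refine Spec.seq (step s 5 _ (2 ^ ν) ?_ ?_ (by decide)) ?_
  · simp only [WordExp.Ok, WordExp.eval, WordOp.eval, h01, Nat.one_shiftLeft, hN, and_true]; omega
  · simp only [WordExp.eval, WordOp.eval, h01, Nat.one_shiftLeft]
  rintro _ rfl
  refine Spec.seq (step _ 6 _ (2 * (m + ν)) ?_ ?_ (by decide)) ?_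
  · simp [WordExp.Ok, WordExp.eval, WordOp.eval, Memory.word_setWord, h0]; omega
  · simp [WordExp.eval, WordOp.eval, Memory.word_setWord, h0]; omega
  rintro _ rfl
  refine Spec.seq (step _ 7 _ m ?_ ?_ (by decide)) ?_
  · simp [WordExp.Ok, WordExp.eval, WordOp.eval, Memory.word_setWord, h0, h01]; omega
  · simp [WordExp.eval, WordOp.eval, Memory.word_setWord, h0, h01]
  rintro s₁ rfl
  set s₁ := ((s.setWord 5 0 (2 ^ ν)).setWord 6 0 (2 * (m + ν))).setWord 7 0 m with hs₁
  have hw : ∀ b, (b < 5 ∨ 7 < b) → s₁.word b = s.word b := fun b hb => by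
    rw [hs₁, Memory.word_setWord, if_neg (by omega), Memory.word_setWord, if_neg (by omega),
      Memory.word_setWord, if_neg (by omega)]
  have h5 : s₁.word 5 0 = 2 ^ ν := by simp [hs₁, Memory.word_setWord]
  have h6 : s₁.word 6 0 = 2 * (m + ν) := by simp [hs₁, Memory.word_setWord]
  have h7 : s₁.word 7 0 = m := by simp [hs₁, Memory.word_setWord]
  have hreal : s₁.real = s.real := rfl
  -- The indicator of `B` is written twice, at base `0` for the X-columns and at base `n` for the
  -- Z-columns.
  have maskStep : ∀ (s₀ : Memory) (idx : WordExp) (base : ℕ) (_ : base ≤ m + ν)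
      (_ : ∀ b, b ≠ 8 → b ≠ 28 → s₀.word b = s₁.word b)
      (_ : ∀ s' : Memory, ∀ c < m + ν, s'.word 0 0 = m + ν → s'.word 28 0 = c →
        idx.Ok W s' ∧ idx.eval s' = base + c)
      (_ : idx.cost ≤ 10),
      Spec W (.for 28 (.var 0) (.setWord 8 idx (.op .sub (.lit 1) (.get 1 (.var 28))))) s₀
        ((m + ν + 1) * 60) fun s' =>
        (∀ b, b ≠ 8 → b ≠ 28 → s'.word b = s₀.word b) ∧ s'.real = s₀.real ∧
        s'.word 8 = segUpdate (s₀.word 8) base (m + ν) (fun c => 1 - s.word 1 c) := by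
    intro s₀ idx base hbase hs₀ hidx hcost
    have k0 : s₀.word 0 0 = m + ν := by
      rw [hs₀ 0 (by decide) (by decide), hw 0 (by decide), h0]
    have k1 : s₀.word 1 = s.word 1 := by
      rw [hs₀ 1 (by decide) (by decide), hw 1 (by decide)]
    refine Spec.fillWord 28 8 (.var 0) idx _ base (m + ν) 60 (fun c => 1 - s.word 1 c) _
      (by decide) (by omega) (by omega) ?_ ?_ ?_ le_rfl
    · intro s' hs'
      simp only [WordExp.Ok, WordExp.eval, hs' 0 (by decide) (by decide), k0, and_true]; omega
    · intro c s' hc hs' hc' hseg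
      obtain ⟨o1, o2⟩ := hidx s' c hc (by rw [hs' 0 (by decide) (by decide), k0]) hc'
      simp only [WordExp.Ok, WordExp.eval, WordOp.eval, hs' 1 (by decide) (by decide), k1, hc',
        o1, o2, and_true, true_and]
      omega
    · simp only [WordExp.cost]; omega
  refine Spec.seq (maskStep s₁ _ 0 (by omega) (fun _ _ _ => rfl) ?_ (by decide)) ?_
  · intro s' c hc _ h28
    simp only [WordExp.Ok, WordExp.eval, h28, zero_add, and_true]; omega
  rintro s₂ ⟨a1, a2, a3⟩
  refine Spec.seq (maskStep s₂ _ (m + ν) le_rfl a1 ?_ (by decide)) ?_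
  · intro s' c hc k0 h28
    simp only [WordExp.Ok, WordExp.eval, WordOp.eval, h28, k0, and_true]; omega
  rintro s₃ ⟨b1, b2, b3⟩
  have hw3 : ∀ b, (b < 5 ∨ 8 < b) → b ≠ 28 → s₃.word b = s.word b := fun b hb hb' => by
    rw [b1 b (by omega) hb', a1 b (by omega) hb', hw b (by omega)]
  refine (Spec.prefixSum 28 9 (.var 0) (.get 1 (.var 28)) (m + ν) 60 (s.word 1) _ (by decide)
    (by omega) (fun c _ => hA c) (by rw [hw3 9 (by decide) (by decide), h9]) ?_ ?_ (by decide)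
    le_rfl).mono le_rfl ?_
  · intro s' hs'
    simp only [WordExp.Ok, WordExp.eval, hs' 0 (by decide) (by decide),
      hw3 0 (by decide) (by decide), h0, and_true]
    omega
  · intro c s' hc hs' hc'
    simp only [WordExp.Ok, WordExp.eval, hs' 1 (by decide) (by decide),
      hw3 1 (by decide) (by decide), hc', and_true]
    omega
  rintro s₄ ⟨c1, c2, c3⟩
  refine ⟨fun b hb hb' => ?_, by rw [c2, b2, a2, hreal], ?_, ?_, ?_, fun c hc => ?_,
    fun c hc => ?_, c3⟩
  · rw [c1 b (by omega) hb', hw3 b (by omega) hb']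
  · rw [c1 5 (by decide) (by decide), b1 5 (by decide) (by decide), a1 5 (by decide) (by decide),
      h5]
  · rw [c1 6 (by decide) (by decide), b1 6 (by decide) (by decide), a1 6 (by decide) (by decide),
      h6]
  · rw [c1 7 (by decide) (by decide), b1 7 (by decide) (by decide), a1 7 (by decide) (by decide),
      h7]
  · rw [c1 8 (by decide) (by decide), b3, segUpdate_of_not _ _ (by omega), a3]
    have := segUpdate_of_lt (s₁.word 8) (base := 0) (fun c => 1 - s.word 1 c) hc
    rwa [zero_add] at this
  · rw [c1 8 (by decide) (by decide), b3, segUpdate_of_lt _ _ hc]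

/-- The rank of the eliminated system, as a prefix sum in array `11`. -/
def Prog.rank : Prog :=
  .for 28 (.var 7) (.setWord 11 (.op .add (.lit 1) (.var 28))
    (.op .add (.get 11 (.var 28)) (.cell 20 (.var 28) (.get 21 (.var 28)))))

/-- The summed cells are the pivot entries, so the result is the rank by
`IsEliminated.sum_eq_finrank`. -/
theorem rank_spec {W m ν : ℕ} {s : Memory} {u tx tz : ℕ → PauliLabel (m + ν)}
    (h : Layout W m ν s u tx tz) (he : Eliminated m ν s u m) (h11 : s.word 11 0 = 0) :
    Spec W .rank s ((m + 1) * 100) fun s' =>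
      (∀ b, b ≠ 11 → b ≠ 28 → s'.word b = s.word b) ∧ s'.real = s.real ∧
      s'.word 11 m = Module.finrank (ZMod 2) (Submodule.span (ZMod 2) (u '' Set.Iio m)) := by
  have hpos := h.pos
  have hW := h.row_lt (i := m) (by omega)
  have hm : m ≤ m * (2 * (m + ν)) := Nat.le_mul_of_pos_right _ (by omega)
  refine (Spec.prefixSum 28 11 (.var 7) _ m 100
    (fun i => s.word 20 (i * (2 * (m + ν)) + s.word 21 i)) _ (by decide)
    (by omega) (fun c _ => Nat.lt_succ_iff.mp (he.bit _)) h11 ?_ ?_ (by decide)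
    le_rfl).mono le_rfl ?_
  · intro s' hs'
    simp only [WordExp.Ok, WordExp.eval, hs' 7 (by decide) (by decide), h.m_eq, and_true]
    omega
  · intro c s' hc hs' hc'
    have hp := he.piv_lt c hc
    have hcm : (c + 1) * (2 * (m + ν)) ≤ m * (2 * (m + ν)) := Nat.mul_le_mul_right _ hc
    rw [add_mul, one_mul] at hcm
    simp only [WordExp.Ok, WordExp.eval, WordOp.eval, hs' 6 (by decide) (by decide),
      hs' 20 (by decide) (by decide), hs' 21 (by decide) (by decide), h.width_eq, hc', and_true]
    omega
  · rintro s' ⟨h1, h2, h3⟩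
    refine ⟨h1, h2, ?_⟩
    rw [h3, ← he.rows.sum_eq_finrank]
    refine Finset.sum_congr rfl fun i hi => ?_
    rw [coord_rowLabel _ _ (he.piv_lt i (Finset.mem_range.mp hi)), bit_eq_val (he.bit _)]

/-- The algorithm for the 2-Rényi entropy. -/
def Prog.entropy : Prog :=
  .seq .setup (.seq .eliminate (.seq .rank (.seq .sumX
    (.setReal 2 (.lit 0) (.sub
      (.sub (.ofWord (.get 9 (.var 0))) (.sub (.ofWord (.var 7)) (.ofWord (.get 11 (.var 7)))))
      (.log2 (.get 2 (.lit 1))))))))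

/-- With `N = 2^ν`, the summands are the linear setup, the cubic elimination, the rank, `N²` tests
of cost `O(n²)` and `N` pairs of transforms of cost `O(ν N)`. Each is `O(n³ N²)` because `n` and `N`
are positive. -/
theorem entropy_cost_le {m ν N : ℕ} (h : 0 < m + ν) (hN : 0 < N) :
    (m + ν) * 1000 + ((m + 1) * (m + 1) * ((m + ν) * 1000) + ((m + 1) * 100 +
      ((N + 1) * ((N + 1) * ((m + ν + 1) * ((m + ν) * 800) + 100) +
        (ν + 2) * (N * 600) + 100) + 30))) ≤ 20000 * ((m + ν) ^ 3 * N ^ 2) := by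
  -- In the shifted variables, once `m` and `ν` are replaced by `k + 1`, the right side minus the
  -- left side is a polynomial with nonnegative coefficients; listing its monomials then settles the
  -- inequality.
  obtain ⟨n, rfl⟩ : ∃ n, N = n + 1 := ⟨N - 1, by omega⟩
  obtain ⟨k, hk⟩ : ∃ k, m + ν = k + 1 := ⟨m + ν - 1, by omega⟩
  have hm : m ≤ k + 1 := by omega
  have hν : ν ≤ k + 1 := by omega
  rw [hk]
  calc _ ≤ (k + 1) * 1000 + ((k + 1 + 1) * (k + 1 + 1) * ((k + 1) * 1000) + ((k + 1 + 1) * 100 +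
      ((n + 1 + 1) * ((n + 1 + 1) * ((k + 1 + 1) * ((k + 1) * 800) + 100) +
        (k + 1 + 2) * ((n + 1) * 600) + 100) + 30))) := by gcongr
    _ ≤ _ := by
      have h1 := Nat.zero_le (k ^ 2)
      have h2 := Nat.zero_le (k ^ 3)
      have h3 := Nat.zero_le (k * n)
      have h4 := Nat.zero_le (k ^ 2 * n)
      have h5 := Nat.zero_le (k ^ 3 * n)
      have h6 := Nat.zero_le (k * n ^ 2)
      have h7 := Nat.zero_le (k ^ 2 * n ^ 2)
      have h8 := Nat.zero_le (k ^ 3 * n ^ 2)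
      have h9 := Nat.zero_le (n ^ 2)
      linarith [Nat.zero_le n, Nat.zero_le k]

/-- The function `mask` anticipates array `8`, so that the hypotheses can speak about the initial
memory, where that array is still zero. Positivity of the sum (`hr`) makes the final logarithm
legal. -/
theorem entropy_spec {W m ν : ℕ} {s : Memory} {u tx tz : ℕ → PauliLabel (m + ν)} (hpos : 0 < m + ν)
    (words : 4 * ((m + ν) * (m + ν)) + 20 < W) (levels : (ν + 2) * 2 ^ ν + 20 < W)
    (h0 : s.word 0 0 = m + ν)
    (h01 : s.word 0 1 = ν) (hA : ∀ c, s.word 1 c ≤ 1) (h5 : ∀ b, 5 ≤ b → ∀ i, s.word b i = 0)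
    (hreal : s.real 2 1 = 0) {mask : ℕ → ℕ} (hmask : ∀ c < m + ν, mask c = 1 - s.word 1 c)
    (hmask' : ∀ c < m + ν, mask (m + ν + c) = 1 - s.word 1 c)
    (u_eq : ∀ i < m, ∀ c < 2 * (m + ν),
      mask c &&& s.word 3 (i * (2 * (m + ν)) + c) = (coord (m + ν) c (u i)).val)
    (tx_eq : ∀ j < ν, ∀ c < 2 * (m + ν),
      mask c &&& s.word 4 ((m + j) * (2 * (m + ν)) + c) = (coord (m + ν) c (tx j)).val)
    (tz_eq : ∀ j < ν, ∀ c < 2 * (m + ν),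
      mask c &&& s.word 4 ((m + ν + (m + j)) * (2 * (m + ν)) + c) =
        (coord (m + ν) c (tz j)).val)
    (hr : 0 < ∑ a ∈ Finset.range (2 ^ ν), ∑ z ∈ Finset.range (2 ^ ν),
        contribution (Submodule.span (ZMod 2) (u '' Set.Iio m)) tx tz (s.real 0) (s.real 1)
          ν a z) :
    Spec W .entropy s (20000 * ((m + ν) ^ 3 * (2 ^ ν) ^ 2)) fun s' =>
      s'.output = ((∑ c ∈ Finset.range (m + ν), s.word 1 c : ℕ) : ℝ) -
        (m - Module.finrank (ZMod 2) (Submodule.span (ZMod 2) (u '' Set.Iio m))) -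
        Real.logb 2 (∑ a ∈ Finset.range (2 ^ ν), ∑ z ∈ Finset.range (2 ^ ν),
          contribution (Submodule.span (ZMod 2) (u '' Set.Iio m)) tx tz (s.real 0) (s.real 1)
            ν a z) := by
  have hNpos : 0 < 2 ^ ν := by positivity
  have hN : 2 ^ ν < W := by
    have h2 : 1 * 2 ^ ν ≤ (ν + 2) * 2 ^ ν := Nat.mul_le_mul_right _ (by omega)
    omega
  have hn : m + ν ≤ (m + ν) * (m + ν) := Nat.le_mul_of_pos_right _ hpos
  refine Spec.mono ?_ (entropy_cost_le hpos hNpos) fun _ h => h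
  refine Spec.seq (setup_spec hpos words hN h0 h01 hA (h5 9 (by decide) 0)) ?_
  rintro s₁ ⟨a1, a2, a3, a4, a5, a6, a7, a8⟩
  have hmask_eq : ∀ c < 2 * (m + ν), s₁.word 8 c = mask c := fun c hc => by
    by_cases hc' : c < m + ν
    · rw [a6 c hc', hmask c hc']
    · obtain ⟨d, rfl⟩ : ∃ d, c = m + ν + d := ⟨c - (m + ν), by omega⟩
      rw [a7 d (by omega), hmask' d (by omega)]
  have hL : Layout W m ν s₁ u tx tz := by
    refine ⟨hpos, words, levels, ?_, ?_, a3, a4, a5, ?_, ?_, ?_⟩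
    · rw [a1 0 (by decide) (by decide), h0]
    · rw [a1 0 (by decide) (by decide), h01]
    · intro i hi c hc
      rw [hmask_eq c hc, a1 3 (by decide) (by decide), u_eq i hi c hc]
    · intro i hi c hc
      rw [hmask_eq c hc, a1 4 (by decide) (by decide), tx_eq i hi c hc]
    · intro i hi c hc
      rw [hmask_eq c hc, a1 4 (by decide) (by decide), tz_eq i hi c hc]
  refine Spec.seq (eliminate_spec hL fun j => ?_) ?_
  · rw [a1 20 (by decide) (by decide), h5 20 (by decide)]; decide
  rintro s₂ ⟨b1, b2, b3, b4⟩
  have hL₂ : Layout W m ν s₂ u tx tz := hL.congr fun b hb => b1 b (by omega) (by omega)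
  refine Spec.seq (rank_spec hL₂ b4 ?_) ?_
  · rw [b1 11 (by decide) (by decide), a1 11 (by decide) (by decide), h5 11 (by decide)]
  rintro s₃ ⟨c1, c2, c3⟩
  have hr3 : s₃.real = s.real := by rw [c2, b2, a2]
  refine Spec.seq (sumX_spec (hL₂.congr fun b hb => c1 b (by omega) (by omega)) ?_
    (b4.of_eq (c1 20 (by decide) (by decide)) (c1 21 (by decide) (by decide))) ?_) ?_
  · rw [c1 10 (by decide) (by decide), b3]
  · rw [hr3, hreal]
  rintro s₄ ⟨d1, d2, d3⟩
  rw [hr3] at d3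
  have e0 : s₄.word 0 0 = m + ν := by
    rw [d1 0 (by decide), c1 0 (by decide) (by decide), hL₂.n_eq]
  have e7 : s₄.word 7 0 = m := by
    rw [d1 7 (by decide), c1 7 (by decide) (by decide), hL₂.m_eq]
  have e9 : s₄.word 9 (m + ν) = ∑ c ∈ Finset.range (m + ν), s.word 1 c := by
    rw [d1 9 (by decide), c1 9 (by decide) (by decide), b1 9 (by decide) (by decide), a8]
  have e11 : s₄.word 11 m =
      Module.finrank (ZMod 2) (Submodule.span (ZMod 2) (u '' Set.Iio m)) := by
    rw [d1 11 (by decide), c3]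
  refine Spec.setReal ?_ ?_ ?_ (by decide)
  · simp only [WordExp.Ok]; omega
  · simp only [RealExp.Ok, WordExp.Ok, RealExp.eval, WordExp.eval, d3, hr, and_true]; omega
  · simp only [RealExp.eval, WordExp.eval, Memory.output, e0, e7, e9, e11, d3,
      Memory.real_setReal, if_true, Function.update_self]

/-! ### Pauli algebra -/

/-- Tensor product of one-qubit matrices. -/
def tensor {n : ℕ} (M : Fin n → Matrix (Fin 2) (Fin 2) ℂ) : Op n :=
  Matrix.of fun s t => ∏ i, M i (s i) (t i)

theorem pauli_eq_tensor {n : ℕ} (v : PauliLabel n) :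
    pauli v = tensor fun i => pauliOne (v.1 i) (v.2 i) := rfl

theorem tensor_mul {n : ℕ} (M N : Fin n → Matrix (Fin 2) (Fin 2) ℂ) :
    tensor M * tensor N = tensor fun i => M i * N i := by
  ext s t
  simp only [tensor, Matrix.mul_apply, Matrix.of_apply, ← Finset.prod_mul_distrib]
  rw [Finset.prod_univ_sum, Fintype.piFinset_univ]

theorem trace_tensor {n : ℕ} (M : Fin n → Matrix (Fin 2) (Fin 2) ℂ) :
    (tensor M).trace = ∏ i, (M i).trace := by
  simp only [tensor, Matrix.trace, Matrix.diag_apply, Matrix.of_apply]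
  rw [Finset.prod_univ_sum, Fintype.piFinset_univ]

theorem tensor_smul {n : ℕ} (c : Fin n → ℂ) (M : Fin n → Matrix (Fin 2) (Fin 2) ℂ) :
    tensor (fun i => c i • M i) = (∏ i, c i) • tensor M := by
  ext s t
  simp [tensor, Finset.prod_mul_distrib]

theorem tensor_conjTranspose {n : ℕ} (M : Fin n → Matrix (Fin 2) (Fin 2) ℂ) :
    (tensor M)ᴴ = tensor fun i => (M i)ᴴ := by
  ext s t
  simp [tensor]

theorem zmod_two_cases (x : ZMod 2) : x = 0 ∨ x = 1 := by
  revert x; decide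

theorem pauliOne_mul (x z x' z' : ZMod 2) :
    ∃ c : ℂ, c ≠ 0 ∧ pauliOne x z * pauliOne x' z' = c • pauliOne (x + x') (z + z') := by
  have h2 : (1 + 1 : ZMod 2) = 0 := rfl
  rcases zmod_two_cases x with rfl | rfl <;> rcases zmod_two_cases z with rfl | rfl <;>
  rcases zmod_two_cases x' with rfl | rfl <;> rcases zmod_two_cases z' with rfl | rfl <;>
  simp only [pauliOne, h2, add_zero, zero_add, if_true, one_ne_zero, if_false]
  -- The phase of a product of one-qubit Pauli matrices is `1`, `I` or `-I`; the three are tried in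
  -- turn.
  all_goals first
    | (refine ⟨1, one_ne_zero, ?_⟩; ext i j; fin_cases i <;> fin_cases j <;>
        simp [Matrix.mul_apply, Fin.sum_univ_two]; done)
    | (refine ⟨I, Complex.I_ne_zero, ?_⟩; ext i j; fin_cases i <;> fin_cases j <;>
        simp [Matrix.mul_apply, Fin.sum_univ_two]; done)
    | (refine ⟨-I, neg_ne_zero.mpr Complex.I_ne_zero, ?_⟩; ext i j; fin_cases i <;> fin_cases j <;>
        simp [Matrix.mul_apply, Fin.sum_univ_two])

theorem trace_pauliOne_mul (x z x' z' : ZMod 2) :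
    (pauliOne x z * pauliOne x' z').trace = if x = x' ∧ z = z' then 2 else 0 := by
  rcases zmod_two_cases x with rfl | rfl <;> rcases zmod_two_cases z with rfl | rfl <;>
  rcases zmod_two_cases x' with rfl | rfl <;> rcases zmod_two_cases z' with rfl | rfl <;>
  simp [pauliOne, Matrix.trace, Fin.sum_univ_two] <;> norm_num

theorem pauliOne_conjTranspose (x z : ZMod 2) : (pauliOne x z)ᴴ = pauliOne x z := by
  rcases zmod_two_cases x with rfl | rfl <;> rcases zmod_two_cases z with rfl | rfl <;>
  ext i j <;> fin_cases i <;> fin_cases j <;> simp [pauliOne]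

theorem pauli_mul {n : ℕ} (v w : PauliLabel n) :
    ∃ c : ℂ, c ≠ 0 ∧ pauli v * pauli w = c • pauli (v + w) := by
  choose c hc h using fun i => pauliOne_mul (v.1 i) (v.2 i) (w.1 i) (w.2 i)
  refine ⟨∏ i, c i, Finset.prod_ne_zero_iff.mpr fun i _ => hc i, ?_⟩
  rw [pauli_eq_tensor, pauli_eq_tensor, tensor_mul, funext h, tensor_smul]
  rfl

theorem pauli_conjTranspose {n : ℕ} (v : PauliLabel n) : (pauli v)ᴴ = pauli v := by
  simp [pauli_eq_tensor, tensor_conjTranspose, pauliOne_conjTranspose]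

theorem pauli_zero {n : ℕ} : pauli (0 : PauliLabel n) = 1 := by
  ext s t
  rw [pauli_eq_tensor, Matrix.one_apply]
  simp only [tensor, Matrix.of_apply, Prod.fst_zero, Prod.snd_zero, Pi.zero_apply, pauliOne,
    if_true, Matrix.one_apply]
  rw [Finset.prod_ite_zero]
  simp [funext_iff]

theorem trace_pauli_mul {n : ℕ} (v w : PauliLabel n) :
    (pauli v * pauli w).trace = if v = w then (2 : ℂ) ^ n else 0 := by
  rw [pauli_eq_tensor, pauli_eq_tensor, tensor_mul, trace_tensor]
  simp only [trace_pauliOne_mul]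
  rw [Finset.prod_ite_zero]
  simp [Prod.ext_iff, funext_iff, forall_and]

/-- Distinct Pauli operators are orthogonal for the trace form and have nonzero norm, so they are
not proportional. This is what permits phases to be dropped in every computation with labels. -/
theorem pauli_label_unique {n : ℕ} {v w : PauliLabel n} {c : ℂ} (h : pauli v = c • pauli w) :
    v = w := by
  by_contra hne
  have h1 := trace_pauli_mul v v
  rw [if_pos rfl] at h1
  have h2 : (pauli v * pauli v).trace = 0 := by
    nth_rewrite 2 [h]
    rw [Matrix.mul_smul, Matrix.trace_smul, trace_pauli_mul, if_neg hne, smul_zero]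
  rw [h1] at h2
  exact pow_ne_zero n two_ne_zero h2

/-! ### Conjugation by a Clifford unitary -/

theorem conjTo_iff_exists {n : ℕ} {U : Op n} {v w : PauliLabel n} :
    ConjTo U v w ↔ ∃ c : ℂ, (c = 1 ∨ c = -1) ∧ U * pauli v * Uᴴ = c • pauli w := by
  constructor
  · rintro (h | h)
    · exact ⟨1, .inl rfl, by rw [h, one_smul]⟩
    · exact ⟨-1, .inr rfl, by rw [h, neg_one_smul]⟩
  · rintro ⟨c, rfl | rfl, h⟩
    · exact .inl (by rw [h, one_smul])
    · exact .inr (by rw [h, neg_one_smul])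

section

variable {n : ℕ} {C : Op n}

theorem IsClifford.conj_mul (h : IsClifford C) : Cᴴ * C = 1 := (Matrix.mem_unitaryGroup_iff').mp h.1

theorem IsClifford.mul_conj (h : IsClifford C) : C * Cᴴ = 1 := (Matrix.mem_unitaryGroup_iff).mp h.1

theorem IsClifford.conjTo_symm (h : IsClifford C) {v w : PauliLabel n} :
    ConjTo Cᴴ w v ↔ ConjTo C v w := by
  have key : ∀ (M N : Op n), C * M * Cᴴ = N ↔ Cᴴ * N * Cᴴᴴ = M := by
    intro M N
    rw [Matrix.conjTranspose_conjTranspose]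
    constructor
    · rintro rfl
      rw [show Cᴴ * (C * M * Cᴴ) * C = (Cᴴ * C) * M * (Cᴴ * C) by simp only [Matrix.mul_assoc],
        h.conj_mul, one_mul, mul_one]
    · rintro rfl
      rw [show C * (Cᴴ * N * C) * Cᴴ = (C * Cᴴ) * N * (C * Cᴴ) by simp only [Matrix.mul_assoc],
        h.mul_conj, one_mul, mul_one]
  rw [ConjTo, ConjTo, key, key]
  simp only [Matrix.mul_neg, Matrix.neg_mul, neg_eq_iff_eq_neg]

theorem ConjTo.unique {v w w' : PauliLabel n} (h : ConjTo C v w) (h' : ConjTo C v w') :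
    w = w' := by
  obtain ⟨c, hc, h⟩ := conjTo_iff_exists.mp h
  obtain ⟨c', hc', h'⟩ := conjTo_iff_exists.mp h'
  have hc0 : c ≠ 0 := by rcases hc with rfl | rfl <;> norm_num
  apply pauli_label_unique (c := c⁻¹ * c')
  rw [mul_smul, ← h', h, smul_smul, inv_mul_cancel₀ hc0, one_smul]

/-- Conjugation by a unitary is multiplicative, and products of Pauli operators are sums of labels
up to nonzero phases, which `pauli_label_unique` discards. -/
theorem IsClifford.conjTo_add (hC : IsClifford C) {v w v' w' u : PauliLabel n}
    (hv : ConjTo C v v') (hw : ConjTo C w w') (hu : ConjTo C (v + w) u) : u = v' + w' := by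
  obtain ⟨a, ha, hv⟩ := conjTo_iff_exists.mp hv
  obtain ⟨b, hb, hw⟩ := conjTo_iff_exists.mp hw
  obtain ⟨d, hd, hu⟩ := conjTo_iff_exists.mp hu
  obtain ⟨c, hc, h1⟩ := pauli_mul v w
  obtain ⟨c', hc', h2⟩ := pauli_mul v' w'
  have hd0 : d ≠ 0 := by rcases hd with rfl | rfl <;> norm_num
  have key : (c * d) • pauli u = (a * b * c') • pauli (v' + w') := by
    calc (c * d) • pauli u = c • (C * pauli (v + w) * Cᴴ) := by rw [hu, smul_smul]
      _ = C * (pauli v * pauli w) * Cᴴ := by rw [h1, Matrix.mul_smul, Matrix.smul_mul]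
      _ = C * pauli v * (Cᴴ * C) * (pauli w * Cᴴ) := by
        rw [hC.conj_mul, mul_one]; simp only [Matrix.mul_assoc]
      _ = (C * pauli v * Cᴴ) * (C * pauli w * Cᴴ) := by simp only [Matrix.mul_assoc]
      _ = _ := by
        rw [hv, hw, Matrix.smul_mul, Matrix.mul_smul, h2, smul_smul, smul_smul, mul_assoc]
  apply pauli_label_unique (c := (c * d)⁻¹ * (a * b * c'))
  rw [mul_smul, ← key, smul_smul, inv_mul_cancel₀ (mul_ne_zero hc hd0), one_smul]

/-- The relation `ConjTo C` is the graph of an additive map, which is automatically linear over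
`ZMod 2`. It is injective because `Cᴴ` undoes it, hence bijective by finite dimension. -/
theorem IsClifford.exists_equiv (hC : IsClifford C) :
    ∃ τ : PauliLabel n ≃ₗ[ZMod 2] PauliLabel n, ∀ v w, ConjTo C v w ↔ τ v = w := by
  choose f hf using hC.2
  let φ : PauliLabel n →+ PauliLabel n :=
    { toFun := f
      map_zero' := by
        have h := hC.conjTo_add (hf 0) (hf 0) (by rw [add_zero]; exact hf 0)
        simpa using h
      map_add' := fun v w => hC.conjTo_add (hf v) (hf w) (hf (v + w)) }
  let L : PauliLabel n →ₗ[ZMod 2] PauliLabel n := φ.toZModLinearMap 2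
  have hL : ∀ v, L v = f v := fun v => rfl
  have hinj : Function.Injective L := by
    intro v w hvw
    rw [hL, hL] at hvw
    have h1 := hC.conjTo_symm.mpr (hf v)
    have h2 := hC.conjTo_symm.mpr (hf w)
    rw [hvw] at h1
    exact h1.unique h2
  refine ⟨LinearEquiv.ofInjectiveEndo L hinj, fun v w => ?_⟩
  rw [LinearEquiv.coe_ofInjectiveEndo, hL]
  exact ⟨fun h => (hf v).unique h, fun h => h ▸ hf v⟩

end

/-! ### Expectation values -/

theorem star_expectation {n : ℕ} (ψ : Bits n → ℂ) (v : PauliLabel n) :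
    star (star ψ ⬝ᵥ (pauli v *ᵥ ψ)) = star ψ ⬝ᵥ (pauli v *ᵥ ψ) := by
  rw [← Matrix.star_dotProduct_star, star_star, Matrix.star_mulVec, pauli_conjTranspose,
    Matrix.dotProduct_mulVec]

theorem ofReal_expectation {n : ℕ} (ψ : Bits n → ℂ) (v : PauliLabel n) :
    (expectation ψ v : ℂ) = star ψ ⬝ᵥ (pauli v *ᵥ ψ) :=
  Complex.conj_eq_iff_re.mp (star_expectation ψ v)

/-- The expectation is real because Pauli operators are Hermitian. In the form `normSq`, signs and
phases of modulus one drop out by multiplicativity. -/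
theorem sq_expectation_eq_normSq {n : ℕ} (ψ : Bits n → ℂ) (v : PauliLabel n) :
    expectation ψ v ^ 2 = Complex.normSq (star ψ ⬝ᵥ (pauli v *ᵥ ψ)) := by
  rw [← ofReal_expectation, Complex.normSq_ofReal, sq]

theorem sq_expectation_conj {n : ℕ} {C : Op n} (hC : IsClifford C) (ψ : Bits n → ℂ)
    {v w : PauliLabel n} (h : ConjTo C v w) :
    expectation (C *ᵥ ψ) w ^ 2 = expectation ψ v ^ 2 := by
  obtain ⟨c, hc, h⟩ := conjTo_iff_exists.mp h
  have hc1 : Complex.normSq c = 1 := by rcases hc with rfl | rfl <;> simp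
  have key : c • (star (C *ᵥ ψ) ⬝ᵥ (pauli w *ᵥ (C *ᵥ ψ))) = star ψ ⬝ᵥ (pauli v *ᵥ ψ) := by
    rw [← dotProduct_smul, ← Matrix.smul_mulVec, ← h, Matrix.star_mulVec, ← Matrix.dotProduct_mulVec,
      Matrix.mulVec_mulVec, Matrix.mulVec_mulVec]
    congr 2
    calc Cᴴ * (C * pauli v * Cᴴ) * C = (Cᴴ * C) * pauli v * (Cᴴ * C) := by
          simp only [Matrix.mul_assoc]
      _ = pauli v := by rw [hC.conj_mul, one_mul, mul_one]
  rw [sq_expectation_eq_normSq, sq_expectation_eq_normSq, ← key, smul_eq_mul, Complex.normSq_mul,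
    hc1, one_mul]

/-! ### Purity of the reduced state -/

theorem sum_label_prod {n : ℕ} (f : Fin n → ZMod 2 → ZMod 2 → ℂ) :
    ∑ y : PauliLabel n, ∏ i, f i (y.1 i) (y.2 i) = ∏ i, ∑ x, ∑ z, f i x z := by
  rw [← Equiv.sum_comp (Equiv.arrowProdEquivProdArrow (Fin n) (fun _ => ZMod 2) (fun _ => ZMod 2))]
  simp only [← Fintype.sum_prod_type', Finset.prod_univ_sum, Fintype.piFinset_univ]
  rfl

/-- The one-qubit identity `∑ P ⊗ P = 2 · SWAP`, in matrix entries. -/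
theorem sum_pauliOne_mul (s t s' t' : Fin 2) :
    ∑ x, ∑ z, pauliOne x z s t * pauliOne x z s' t' = if s = t' ∧ t = s' then 2 else 0 := by
  have h : ∀ f : ZMod 2 → ℂ, ∑ x, f x = f 0 + f 1 := fun f => Fin.sum_univ_two f
  rw [h, h, h]
  fin_cases s <;> fin_cases t <;> fin_cases s' <;> fin_cases t' <;>
    simp [pauliOne] <;> norm_num

theorem projB_eq_zero_iff {n : ℕ} (A : Finset (Fin n)) (y : PauliLabel n) :
    projB A y = 0 ↔ ∀ i, i ∈ A ∨ (y.1 i = 0 ∧ y.2 i = 0) := by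
  simp only [projB, LinearMap.coe_mk, AddHom.coe_mk, Prod.ext_iff, funext_iff, Prod.fst_zero,
    Prod.snd_zero, Pi.zero_apply, ite_eq_left_iff, ← forall_and]
  refine forall_congr' fun i => ?_
  tauto

/-- The sum factorizes over qubits. Inside `A` each factor is twice a swap; outside, only the
identity label survives. The result is `2^|A|` times the swap of the two copies of `A`. -/
theorem sum_pauli_mul_pauli {n : ℕ} (A : Finset (Fin n)) (s t s' t' : Bits n) :
    (∑ y : PauliLabel n, if projB A y = 0 then pauli y s t * pauli y s' t' else 0) =
      if ∀ i, (i ∈ A → s i = t' i ∧ t i = s' i) ∧ (i ∉ A → s i = t i ∧ s' i = t' i)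
        then 2 ^ A.card else 0 := by
  have h1 : ∀ y : PauliLabel n, (if projB A y = 0 then pauli y s t * pauli y s' t' else 0) =
      ∏ i, if i ∈ A ∨ (y.1 i = 0 ∧ y.2 i = 0) then
        pauliOne (y.1 i) (y.2 i) (s i) (t i) * pauliOne (y.1 i) (y.2 i) (s' i) (t' i) else 0 := by
    intro y
    rw [Finset.prod_ite_zero]
    simp only [projB_eq_zero_iff, pauli, Matrix.of_apply, Finset.prod_mul_distrib, Finset.mem_univ,
      true_implies]
  rw [Finset.sum_congr rfl fun y _ => h1 y,
    sum_label_prod fun i x z => if i ∈ A ∨ (x = 0 ∧ z = 0) then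
        pauliOne x z (s i) (t i) * pauliOne x z (s' i) (t' i) else 0]
  have h2 : ∀ i, (∑ x : ZMod 2, ∑ z : ZMod 2, if i ∈ A ∨ (x = 0 ∧ z = 0) then
        pauliOne x z (s i) (t i) * pauliOne x z (s' i) (t' i) else 0) =
      if (i ∈ A → s i = t' i ∧ t i = s' i) ∧ (i ∉ A → s i = t i ∧ s' i = t' i) then
        (if i ∈ A then (2 : ℂ) else 1) else 0 := by
    intro i
    by_cases hi : i ∈ A
    · simp only [hi, true_or, if_true, sum_pauliOne_mul, true_implies, not_true, false_implies,
        and_true]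
    · simp only [hi, false_or, if_false, ite_and, false_implies, not_false_iff, true_implies,
        true_and]
      rw [Finset.sum_eq_single 0 (fun x _ hx => by simp [hx]) (by simp),
        Finset.sum_eq_single 0 (fun x _ hx => by simp [hx]) (by simp)]
      by_cases h1 : s i = t i <;> by_cases h2 : s' i = t' i <;>
        simp [pauliOne, Matrix.one_apply, h1, h2]
  rw [Finset.prod_congr rfl fun i _ => h2 i, Finset.prod_ite_zero]
  simp [Finset.prod_ite_mem]

/-- Contracting the four deltas of the swap leaves the index pattern `(a,b), (a',b), (a',b'),
(a,b')` of `Tr ψ_A²`. -/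
theorem sum_swap_kernel {α β : Type*} [Fintype α] [Fintype β] [DecidableEq α] [DecidableEq β]
    (F : α → β → α → β → α → β → α → β → ℂ) (c : ℂ) :
    (∑ s : α × β, ∑ t : α × β, ∑ s' : α × β, ∑ t' : α × β,
      if s.1 = t'.1 ∧ t.1 = s'.1 ∧ s.2 = t.2 ∧ s'.2 = t'.2 then
        c * F s.1 s.2 t.1 t.2 s'.1 s'.2 t'.1 t'.2 else 0) =
    c * ∑ a, ∑ a', ∑ b, ∑ b', F a b a' b a' b' a b' := by
  simp only [Fintype.sum_prod_type, ite_and, Finset.mul_sum]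
  refine Finset.sum_congr rfl fun a _ => ?_
  rw [Finset.sum_comm]
  refine Finset.sum_congr rfl fun a' _ => ?_
  refine Finset.sum_congr rfl fun b _ => ?_
  simp

/-- The swap trick: both sides are `2^|A|` times the expectation of `SWAP_A` in two copies of `ψ`,
and the right side expands the swap in the Pauli operators supported on `A`. -/
theorem trace_reducedDensity_sq {n : ℕ} (ψ : Bits n → ℂ) (A : Finset (Fin n)) :
    (2 : ℂ) ^ A.card * (reducedDensity ψ A * reducedDensity ψ A).trace =
      ∑ y : PauliLabel n, if projB A y = 0 then (expectation ψ y : ℂ) ^ 2 else 0 := by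
  set e := (Equiv.piEquivPiSubtypeProd (fun i => i ∈ A) (fun _ : Fin n => Fin 2)).symm with he
  have hcond : ∀ s t s' t', (∀ i, (i ∈ A → e s i = e t' i ∧ e t i = e s' i) ∧
      (i ∉ A → e s i = e t i ∧ e s' i = e t' i)) ↔
      s.1 = t'.1 ∧ t.1 = s'.1 ∧ s.2 = t.2 ∧ s'.2 = t'.2 := by
    intro s t s' t'
    constructor
    · intro h
      refine ⟨funext fun i => ?_, funext fun i => ?_, funext fun i => ?_, funext fun i => ?_⟩
      · simpa [he, i.2] using ((h i).1 i.2).1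
      · simpa [he, i.2] using ((h i).1 i.2).2
      · simpa [he, i.2] using ((h i).2 i.2).1
      · simpa [he, i.2] using ((h i).2 i.2).2
    · rintro ⟨h1, h2, h3, h4⟩ i
      refine ⟨fun hi => ?_, fun hi => ?_⟩
      · simp [he, hi, h1, h2]
      · simp [he, hi, h3, h4]
  have hexp : ∀ y : PauliLabel n, (expectation ψ y : ℂ) ^ 2 =
      ∑ s, ∑ t, ∑ s', ∑ t', star (ψ (e s)) * ψ (e t) * star (ψ (e s')) * ψ (e t') *
        (pauli y (e s) (e t) * pauli y (e s') (e t')) := by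
    intro y
    have : (expectation ψ y : ℂ) = ∑ s, ∑ t, star (ψ (e s)) * (pauli y (e s) (e t) * ψ (e t)) := by
      rw [ofReal_expectation]
      simp only [dotProduct, Matrix.mulVec, Pi.star_apply]
      rw [← Equiv.sum_comp e]
      refine Finset.sum_congr rfl fun s _ => ?_
      rw [← Equiv.sum_comp e, Finset.mul_sum]
    rw [sq, this, Finset.sum_mul]
    refine Finset.sum_congr rfl fun s _ => ?_
    rw [Finset.sum_mul]
    refine Finset.sum_congr rfl fun t _ => ?_
    rw [Finset.mul_sum]
    refine Finset.sum_congr rfl fun s' _ => ?_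
    rw [Finset.mul_sum]
    refine Finset.sum_congr rfl fun t' _ => ?_
    ring
  have hite : ∀ y : PauliLabel n, (if projB A y = 0 then (expectation ψ y : ℂ) ^ 2 else 0) =
      ∑ s, ∑ t, ∑ s', ∑ t', star (ψ (e s)) * ψ (e t) * star (ψ (e s')) * ψ (e t') *
        (if projB A y = 0 then pauli y (e s) (e t) * pauli y (e s') (e t') else 0) := by
    intro y
    by_cases hy : projB A y = 0
    · simp only [hy, if_true, hexp]
    · simp [hy]
  have hsum : (∑ y : PauliLabel n, if projB A y = 0 then (expectation ψ y : ℂ) ^ 2 else 0) =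
      ∑ s : ({i // i ∈ A} → Fin 2) × ({i // ¬ i ∈ A} → Fin 2),
      ∑ t : ({i // i ∈ A} → Fin 2) × ({i // ¬ i ∈ A} → Fin 2),
      ∑ s' : ({i // i ∈ A} → Fin 2) × ({i // ¬ i ∈ A} → Fin 2),
      ∑ t' : ({i // i ∈ A} → Fin 2) × ({i // ¬ i ∈ A} → Fin 2),
      if s.1 = t'.1 ∧ t.1 = s'.1 ∧ s.2 = t.2 ∧ s'.2 = t'.2 then
        2 ^ A.card * (star (ψ (e (s.1, s.2))) * ψ (e (t.1, t.2)) * star (ψ (e (s'.1, s'.2))) *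
          ψ (e (t'.1, t'.2))) else 0 := by
    -- The sum over labels is moved inside the four basis sums, where `sum_pauli_mul_pauli`
    -- evaluates it.
    rw [Finset.sum_congr rfl fun y _ => hite y, Finset.sum_comm]
    refine Finset.sum_congr rfl fun s _ => ?_
    rw [Finset.sum_comm]
    refine Finset.sum_congr rfl fun t _ => ?_
    rw [Finset.sum_comm]
    refine Finset.sum_congr rfl fun s' _ => ?_
    rw [Finset.sum_comm]
    refine Finset.sum_congr rfl fun t' _ => ?_
    rw [← Finset.mul_sum, sum_pauli_mul_pauli]
    simp only [hcond]
    rw [mul_ite, mul_zero, mul_comm]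
  rw [hsum, sum_swap_kernel fun a b a' b' a'' b'' a''' b''' => star (ψ (e (a, b))) * ψ (e (a', b')) *
    star (ψ (e (a'', b''))) * ψ (e (a''', b'''))]
  congr 1
  simp only [Matrix.trace, Matrix.diag_apply, Matrix.mul_apply, reducedDensity, Matrix.of_apply]
  refine Finset.sum_congr rfl fun a _ => ?_
  refine Finset.sum_congr rfl fun a' _ => ?_
  rw [Finset.sum_mul_sum, Finset.sum_comm]
  refine Finset.sum_congr rfl fun b _ => ?_
  refine Finset.sum_congr rfl fun b' _ => ?_
  ring

/-! ### Pauli operators as signed permutations -/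

/-- The action of a Pauli operator with X-part `x` on basis labels. -/
def shift {n : ℕ} (s : Bits n) (x : Fin n → ZMod 2) : Bits n :=
  fun i => if x i = 0 then s i else 1 - s i

/-- The sign `(-1)^(z·s)`. -/
def zSign {n : ℕ} (z : Fin n → ZMod 2) (s : Bits n) : ℂ :=
  ∏ i, if z i = 1 ∧ s i = 1 then -1 else 1

/-- The phase of a Pauli operator relative to the product of its X- and Z-part. -/
noncomputable def pauliPhase {n : ℕ} (v : PauliLabel n) : ℂ :=
  ∏ i, if v.1 i = 1 ∧ v.2 i = 1 then -I else 1

theorem pauliOne_apply (x z : ZMod 2) (s t : Fin 2) :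
    pauliOne x z s t = if t = (if x = 0 then s else 1 - s) then
      (if x = 1 ∧ z = 1 then -I else 1) * (if z = 1 ∧ s = 1 then -1 else 1) else 0 := by
  rcases zmod_two_cases x with rfl | rfl <;> rcases zmod_two_cases z with rfl | rfl <;>
    fin_cases s <;> fin_cases t <;> simp [pauliOne]

theorem pauli_apply {n : ℕ} (v : PauliLabel n) (s t : Bits n) :
    pauli v s t = if t = shift s v.1 then pauliPhase v * zSign v.2 s else 0 := by
  simp only [pauli, Matrix.of_apply, pauliOne_apply]
  rw [Finset.prod_ite_zero, Finset.prod_mul_distrib]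
  simp only [pauliPhase, zSign, funext_iff, shift, Finset.mem_univ, true_implies]

theorem pauli_mulVec {n : ℕ} (v : PauliLabel n) (χ : Bits n → ℂ) (s : Bits n) :
    (pauli v *ᵥ χ) s = pauliPhase v * (zSign v.2 s * χ (shift s v.1)) := by
  simp only [Matrix.mulVec, dotProduct, pauli_apply]
  rw [Finset.sum_eq_single (shift s v.1) (fun t _ ht => by rw [if_neg ht, zero_mul]) (by simp),
    if_pos rfl, mul_assoc]

theorem normSq_pauliPhase {n : ℕ} (v : PauliLabel n) : Complex.normSq (pauliPhase v) = 1 := by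
  rw [pauliPhase, map_prod]
  refine Finset.prod_eq_one fun i _ => ?_
  split_ifs <;> simp

theorem normSq_zSign {n : ℕ} (z : Fin n → ZMod 2) (s : Bits n) :
    Complex.normSq (zSign z s) = 1 := by
  rw [zSign, map_prod]
  refine Finset.prod_eq_one fun i _ => ?_
  split_ifs <;> simp

/-- A Pauli operator is a signed permutation of the basis times a global phase of modulus one. The
remaining sum is visibly a Walsh–Hadamard transform in the Z-part. -/
theorem sq_expectation {n : ℕ} (φ : Bits n → ℂ) (v : PauliLabel n) :
    expectation φ v ^ 2 =
      Complex.normSq (∑ s, zSign v.2 s * (star (φ s) * φ (shift s v.1))) := by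
  have : star φ ⬝ᵥ (pauli v *ᵥ φ) =
      pauliPhase v * ∑ s, zSign v.2 s * (star (φ s) * φ (shift s v.1)) := by
    simp only [dotProduct, pauli_mulVec, Pi.star_apply, Finset.mul_sum]
    refine Finset.sum_congr rfl fun s _ => ?_
    ring
  rw [sq_expectation_eq_normSq, this, Complex.normSq_mul, normSq_pauliPhase, one_mul]

/-! ### Product states -/

/-- The part of a label on the last `ν` qubits. -/
def lastLabel {m ν : ℕ} (q : PauliLabel (m + ν)) : PauliLabel ν :=
  (fun j => q.1 (Fin.natAdd m j), fun j => q.2 (Fin.natAdd m j))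

theorem shift_append {m ν : ℕ} (x : Bits m) (b : Bits ν) (u : Fin (m + ν) → ZMod 2) :
    shift (Fin.append x b) u = Fin.append (shift x fun i => u (Fin.castAdd ν i))
      (shift b fun j => u (Fin.natAdd m j)) := by
  funext i
  refine Fin.addCases (fun i => ?_) (fun j => ?_) i <;> simp [shift]

theorem zSign_append {m ν : ℕ} (x : Bits m) (b : Bits ν) (z : Fin (m + ν) → ZMod 2) :
    zSign z (Fin.append x b) = zSign (fun i => z (Fin.castAdd ν i)) x *
      zSign (fun j => z (Fin.natAdd m j)) b := by
  simp [zSign, Fin.prod_univ_add]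

theorem prodState_append {m ν : ℕ} (x x' : Bits m) (φ : Bits ν → ℂ) (b : Bits ν) :
    prodState x φ (Fin.append x' b) = if x' = x then φ b else 0 := by
  simp [prodState]

theorem shift_eq_self_iff {n : ℕ} (x : Bits n) (u : Fin n → ZMod 2) : shift x u = x ↔ u = 0 := by
  simp only [shift, funext_iff, Pi.zero_apply]
  refine forall_congr' fun i => ?_
  generalize x i = a
  generalize u i = c
  revert a c
  decide

/-- An X-part on the first `m` qubits moves `|x⟩` to an orthogonal basis state; a Z-part there only
contributes a global sign, which squaring removes. -/
theorem sq_expectation_prodState {m ν : ℕ} (x : Bits m) (φ : Bits ν → ℂ)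
    (q : PauliLabel (m + ν)) :
    expectation (prodState x φ) q ^ 2 =
      if ∀ i : Fin m, q.1 (Fin.castAdd ν i) = 0 then expectation φ (lastLabel q) ^ 2 else 0 := by
  rw [sq_expectation, sq_expectation, ← Equiv.sum_comp (Fin.appendEquiv m ν),
    Fintype.sum_prod_type, Finset.sum_eq_single x]
  · have hshift : (shift x fun i => q.1 (Fin.castAdd ν i)) = x ↔
        ∀ i : Fin m, q.1 (Fin.castAdd ν i) = 0 := by
      rw [shift_eq_self_iff, funext_iff]; rfl
    have : ∀ b : Bits ν, zSign q.2 (Fin.appendEquiv m ν (x, b)) *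
        (star (prodState x φ (Fin.appendEquiv m ν (x, b))) *
          prodState x φ (shift (Fin.appendEquiv m ν (x, b)) q.1)) =
        zSign (fun i => q.2 (Fin.castAdd ν i)) x *
          if ∀ i : Fin m, q.1 (Fin.castAdd ν i) = 0 then
            zSign (lastLabel q).2 b * (star (φ b) * φ (shift b (lastLabel q).1)) else 0 := by
      intro b
      simp only [Fin.appendEquiv, Equiv.coe_fn_mk, shift_append, zSign_append, prodState_append,
        if_true, hshift, lastLabel]
      split_ifs
      · ring
      · simp
    rw [Finset.sum_congr rfl fun b _ => this b, ← Finset.mul_sum, Complex.normSq_mul, normSq_zSign,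
      one_mul]
    split_ifs <;> simp
  · intro x' _ hx'
    refine Finset.sum_eq_zero fun b _ => ?_
    simp [Fin.appendEquiv, prodState_append, hx']
  · simp

theorem expectation_zero_ne_zero {n : ℕ} {φ : Bits n → ℂ} (h : φ ≠ 0) :
    expectation φ 0 ≠ 0 := by
  intro h0
  have h1 := ofReal_expectation φ 0
  rw [h0, pauli_zero, Matrix.one_mulVec] at h1
  open scoped ComplexOrder in
  exact h (dotProduct_star_self_eq_zero.mp (by rw [← h1]; simp))

/-- Every `Z_i` with `i ≤ m` is, up to sign, the conjugate of an element of `J`, so `Cψ` is an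
eigenvector of it. Two basis labels in the support of `Cψ` must therefore agree in bit `i`. -/
theorem exists_prodState {m ν : ℕ} {C : Op (m + ν)} (hC : IsClifford C)
    {J : Submodule (ZMod 2) (PauliLabel (m + ν))} (hJ : MapsToZ C J) {ψ : Bits (m + ν) → ℂ}
    (hψ : ψ ≠ 0) (heig : ∀ v ∈ J, pauli v *ᵥ ψ = ψ ∨ pauli v *ᵥ ψ = -ψ) :
    ∃ (x : Bits m) (φ : Bits ν → ℂ), C *ᵥ ψ = prodState x φ ∧ φ ≠ 0 := by
  have hχ : C *ᵥ ψ ≠ 0 := by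
    intro h
    apply hψ
    rw [← Matrix.one_mulVec ψ, ← hC.conj_mul, ← Matrix.mulVec_mulVec, h, Matrix.mulVec_zero]
  set χ := C *ᵥ ψ with hχdef
  have hz : ∀ w : PauliLabel (m + ν), w.1 = 0 → (∀ j : Fin ν, w.2 (Fin.natAdd m j) = 0) →
      ∃ c : ℂ, pauli w *ᵥ χ = c • χ := by
    intro w h1 h2
    obtain ⟨v, hv, hvw⟩ := (hJ w).mpr ⟨h1, h2⟩
    obtain ⟨c, hc, h⟩ := conjTo_iff_exists.mp hvw
    have hcc : c * c = 1 := by rcases hc with rfl | rfl <;> norm_num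
    have key : c • (pauli w *ᵥ χ) = C *ᵥ (pauli v *ᵥ ψ) := by
      rw [← Matrix.smul_mulVec, ← h, hχdef, Matrix.mulVec_mulVec, Matrix.mulVec_mulVec,
        Matrix.mul_assoc, hC.conj_mul, mul_one]
    have key' : pauli w *ᵥ χ = c • (C *ᵥ (pauli v *ᵥ ψ)) := by
      rw [← key, smul_smul, hcc, one_smul]
    rcases heig v hv with h | h
    · exact ⟨c, by rw [key', h]⟩
    · exact ⟨-c, by rw [key', h, Matrix.mulVec_neg, smul_neg, neg_smul]⟩
  obtain ⟨s₀, hs₀⟩ := Function.ne_iff.mp hχ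
  rw [Pi.zero_apply] at hs₀
  have hsupp : ∀ s, χ s ≠ 0 → ∀ i : Fin m, s (Fin.castAdd ν i) = s₀ (Fin.castAdd ν i) := by
    intro s hs i
    obtain ⟨c, hc⟩ := hz (0, Pi.single (Fin.castAdd ν i) 1) rfl fun j => by
      have hne : Fin.natAdd m j ≠ Fin.castAdd ν i := by
        simp only [ne_eq, Fin.ext_iff, Fin.val_natAdd, Fin.val_castAdd]; omega
      simp [hne]
    -- On a basis label `t` in the support, the eigenvalue of `Z_i` can be read off as the sign
    -- given by bit `i`.
    have sgn : ∀ t, χ t ≠ 0 → (if t (Fin.castAdd ν i) = 1 then (-1 : ℂ) else 1) = c := by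
      intro t ht
      have h1 := congrFun hc t
      rw [pauli_mulVec] at h1
      have hph : pauliPhase (n := m + ν) (0, Pi.single (Fin.castAdd ν i) 1) = 1 := by
        simp [pauliPhase]
      have hsg : zSign (Pi.single (Fin.castAdd ν i) 1) t =
          if t (Fin.castAdd ν i) = 1 then (-1 : ℂ) else 1 := by
        rw [zSign, Finset.prod_eq_single (Fin.castAdd ν i)]
        · simp
        · intro k _ hk
          simp [hk]
        · simp
      have hsh : shift t (0 : Fin (m + ν) → ZMod 2) = t := (shift_eq_self_iff _ _).mpr rfl
      simp only [hph, hsg, hsh, one_mul, Pi.smul_apply, smul_eq_mul] at h1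
      exact mul_right_cancel₀ ht h1
    have h2 := (sgn s hs).trans (sgn s₀ hs₀).symm
    generalize s (Fin.castAdd ν i) = a at h2 ⊢
    generalize s₀ (Fin.castAdd ν i) = b at h2 ⊢
    fin_cases a <;> fin_cases b <;> first | rfl | (exfalso; norm_num at h2)
  have happ : ∀ s : Bits (m + ν), s = Fin.append (fun i => s (Fin.castAdd ν i))
      (fun j => s (Fin.natAdd m j)) := fun s => by
    funext i
    refine Fin.addCases (fun i => ?_) (fun j => ?_) i <;> simp
  refine ⟨fun i => s₀ (Fin.castAdd ν i),
    fun b => χ (Fin.append (fun i => s₀ (Fin.castAdd ν i)) b), funext fun s => ?_, fun h => hs₀ ?_⟩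
  · simp only [prodState]
    split_ifs with h
    · rw [← h, ← happ s]
    · by_contra hne
      exact h (funext fun i => hsupp s hne i)
  · have := congrFun h (fun j => s₀ (Fin.natAdd m j))
    rwa [← happ s₀] at this

/-! ### The entropy formula -/

open Classical in
/-- The fibre of a linear map over a coset of a subspace. -/
theorem card_coset_ker {V : Type*} [AddCommGroup V] [Module (ZMod 2) V] [Fintype V]
    (f : V →ₗ[ZMod 2] V) (J : Submodule (ZMod 2) V) (y₀ : V)
    [DecidablePred fun y => f y = 0 ∧ y - y₀ ∈ J] :
    (Finset.univ.filter fun y => f y = 0 ∧ y - y₀ ∈ J).card =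
      if f y₀ ∈ J.map f then 2 ^ Module.finrank (ZMod 2) ↥(J ⊓ LinearMap.ker f) else 0 := by
  split_ifs with h
  · obtain ⟨j, hj, hjy⟩ := h
    have hcard : Fintype.card ↥(J ⊓ LinearMap.ker f) =
        2 ^ Module.finrank (ZMod 2) ↥(J ⊓ LinearMap.ker f) := by
      rw [Module.card_eq_pow_finrank (K := ZMod 2), ZMod.card]
    rw [← hcard, ← Fintype.card_subtype]
    -- The element `y₀ - j` lies in the coset and, since `f j = f y₀`, in the kernel. Translation by
    -- it identifies `J ⊓ ker f` with the filtered set.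
    refine Fintype.card_congr
      { toFun := fun y => ⟨y.1 - (y₀ - j), ?_, ?_⟩
        invFun := fun k => ⟨k.1 + (y₀ - j), ?_, ?_⟩
        left_inv := fun y => by simp
        right_inv := fun k => by simp }
    · have := J.add_mem y.2.2 hj
      rwa [sub_add] at this
    · simp [y.2.1, hjy]
    · have hk : f k.1 = 0 := k.2.2
      simp [hk, hjy]
    · have := J.sub_mem k.2.1 hj
      rwa [show k.1 + (y₀ - j) - y₀ = k.1 - j by abel]
  · rw [Finset.card_eq_zero, Finset.filter_eq_empty_iff]
    rintro y - ⟨h1, h2⟩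
    refine h ⟨y₀ - y, ?_, by rw [map_sub, h1, sub_zero]⟩
    rw [← neg_sub]
    exact J.neg_mem h2

section

variable {m ν : ℕ} {C : Op (m + ν)} {J : Submodule (ZMod 2) (PauliLabel (m + ν))}

/-- Under `τ`, `J` becomes the Z-type labels on the first `m` qubits, so membership in the coset
leaves exactly that Z-part of `τ y` free. -/
theorem mem_iff_of_mapsToZ (hJ : MapsToZ C J)
    {τ : PauliLabel (m + ν) ≃ₗ[ZMod 2] PauliLabel (m + ν)} (hτ : ∀ v w, ConjTo C v w ↔ τ v = w)
    (p : PauliLabel ν) (y : PauliLabel (m + ν)) :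
    y - τ.symm (onLast m p) ∈ J ↔
      (∀ i : Fin m, (τ y).1 (Fin.castAdd ν i) = 0) ∧ lastLabel (τ y) = p := by
  have h1 : ∀ v, v ∈ J ↔ ((τ v).1 = 0 ∧ ∀ j : Fin ν, (τ v).2 (Fin.natAdd m j) = 0) := by
    intro v
    rw [← hJ (τ v)]
    constructor
    · exact fun hv => ⟨v, hv, (hτ _ _).mpr rfl⟩
    · rintro ⟨v', hv', h⟩
      rwa [← τ.injective ((hτ _ _).mp h)]
  rw [h1, map_sub, LinearEquiv.apply_symm_apply]
  generalize τ y = q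
  simp only [Prod.fst_sub, Prod.snd_sub, Pi.sub_apply, funext_iff, Pi.zero_apply, onLast,
    Fin.forall_fin_add, Fin.append_left, Fin.append_right, lastLabel, Prod.ext_iff,
    sub_eq_zero]
  tauto

theorem entropySum_eq {τ : PauliLabel (m + ν) ≃ₗ[ZMod 2] PauliLabel (m + ν)} (hC : IsClifford C)
    (hτ : ∀ v w, ConjTo C v w ↔ τ v = w) (φ : Bits ν → ℂ) (A : Finset (Fin (m + ν))) :
    entropySum J C φ A = open Classical in ∑ p : PauliLabel ν,
      if projB A (τ.symm (onLast m p)) ∈ J.map (projB A) then expectation φ p ^ 2 else 0 := by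
  classical
  unfold entropySum
  refine Finset.sum_congr rfl fun p _ => ?_
  congr 1
  refine propext ⟨?_, fun h => ⟨_, ?_, h⟩⟩
  · rintro ⟨y, hy, h⟩
    rw [hC.conjTo_symm, hτ] at hy
    rwa [← hy, LinearEquiv.symm_apply_apply]
  · rw [hC.conjTo_symm, hτ, LinearEquiv.apply_symm_apply]

/-- Each `y` with a possibly nonzero term lies in exactly one coset `τ⁻¹(1 ⊗ p) + J`, on which the
squared expectation is constant. Exchanging the sums reduces the claim to `card_coset_ker`. -/
theorem sum_sq_expectation (hC : IsClifford C) (hJ : MapsToZ C J) {ψ : Bits (m + ν) → ℂ}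
    {x : Bits m} {φ : Bits ν → ℂ} (hψ : C *ᵥ ψ = prodState x φ) (A : Finset (Fin (m + ν))) :
    (∑ y : PauliLabel (m + ν), if projB A y = 0 then expectation ψ y ^ 2 else 0) =
      2 ^ Module.finrank (ZMod 2) ↥(J ⊓ LinearMap.ker (projB A)) * entropySum J C φ A := by
  classical
  obtain ⟨τ, hτ⟩ := hC.exists_equiv
  have hy : ∀ y, (if projB A y = 0 then expectation ψ y ^ 2 else 0) =
      ∑ p : PauliLabel ν, if projB A y = 0 ∧ y - τ.symm (onLast m p) ∈ J then
        expectation φ p ^ 2 else 0 := by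
    intro y
    rw [← sq_expectation_conj hC ψ ((hτ y _).mpr rfl), hψ, sq_expectation_prodState]
    simp only [mem_iff_of_mapsToZ hJ hτ, ite_and]
    split_ifs <;> simp
  rw [Finset.sum_congr rfl fun y _ => hy y, Finset.sum_comm, entropySum_eq hC hτ, Finset.mul_sum]
  refine Finset.sum_congr rfl fun p _ => ?_
  rw [← Finset.sum_filter, Finset.sum_const, card_coset_ker, nsmul_eq_mul]
  split_ifs <;> simp

/-- The identity, `p = 0`, always qualifies and contributes `‖φ‖⁴ > 0`. -/
theorem entropySum_pos (hC : IsClifford C) {φ : Bits ν → ℂ} (hφ : φ ≠ 0)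
    (A : Finset (Fin (m + ν))) : 0 < entropySum J C φ A := by
  classical
  obtain ⟨τ, hτ⟩ := hC.exists_equiv
  rw [entropySum_eq hC hτ]
  refine Finset.sum_pos' (fun p _ => by split_ifs <;> positivity) ⟨0, Finset.mem_univ _, ?_⟩
  have h0 : onLast m (0 : PauliLabel ν) = 0 := by
    ext i <;> refine Fin.addCases (fun i => ?_) (fun j => ?_) i <;> simp [onLast]
  rw [h0, map_zero, map_zero, if_pos (Submodule.zero_mem _)]
  have := expectation_zero_ne_zero hφ
  positivity

theorem entropyValue_eq_renyiTwo (hC : IsClifford C) (hJ : MapsToZ C J) {ψ : Bits (m + ν) → ℂ}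
    {x : Bits m} {φ : Bits ν → ℂ} (hψ : C *ᵥ ψ = prodState x φ) (hφ : φ ≠ 0)
    (A : Finset (Fin (m + ν))) : entropyValue J C φ A = renyiTwo ψ A := by
  have hr := entropySum_pos (J := J) hC hφ A
  have h1 := trace_reducedDensity_sq ψ A
  have h2 : (∑ y : PauliLabel (m + ν), if projB A y = 0 then (expectation ψ y : ℂ) ^ 2 else 0) =
      ((2 ^ Module.finrank (ZMod 2) ↥(J ⊓ LinearMap.ker (projB A)) * entropySum J C φ A : ℝ) : ℂ) := by
    rw [← sum_sq_expectation hC hJ hψ A, Complex.ofReal_sum]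
    refine Finset.sum_congr rfl fun y _ => ?_
    split_ifs <;> simp
  rw [h2] at h1
  have h3 : (2 : ℝ) ^ A.card * (reducedDensity ψ A * reducedDensity ψ A).trace.re =
      2 ^ Module.finrank (ZMod 2) ↥(J ⊓ LinearMap.ker (projB A)) * entropySum J C φ A := by
    have := congrArg Complex.re h1
    rw [Complex.ofReal_re] at this
    rw [← this, show (2 : ℂ) ^ A.card = ((2 ^ A.card : ℝ) : ℂ) by push_cast; rfl,
      Complex.re_ofReal_mul]
  have h4 : (reducedDensity ψ A * reducedDensity ψ A).trace.re =
      2 ^ Module.finrank (ZMod 2) ↥(J ⊓ LinearMap.ker (projB A)) * entropySum J C φ A /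
        2 ^ A.card := by
    rw [← h3, mul_div_cancel_left₀ _ (by positivity)]
  rw [renyiTwo, h4, Real.logb_div (by positivity) (by positivity),
    Real.logb_mul (by positivity) hr.ne', Real.logb_pow, Real.logb_pow,
    Real.logb_self_eq_one (by norm_num), entropyValue]
  ring

end

/-! ### The Walsh–Hadamard transform and expectation values -/

/-- The lowest `n` bits of `a`. -/
def natBits (R : Type*) [Zero R] [One R] (n a : ℕ) : Fin n → R :=
  fun j => if a.testBit j then 1 else 0

theorem natBits_injOn (R : Type*) [Zero R] [One R] [NeZero (1 : R)] (n : ℕ) :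
    Set.InjOn (natBits R n) (Finset.range (2 ^ n)) := by
  intro a ha b hb hab
  simp only [Finset.coe_range, Set.mem_Iio] at ha hb
  refine Nat.eq_of_testBit_eq fun i => ?_
  by_cases hi : i < n
  · have := congrFun hab ⟨i, hi⟩
    simp only [natBits] at this
    cases h1 : a.testBit i <;> cases h2 : b.testBit i <;> simp_all
  · have hle : 2 ^ n ≤ 2 ^ i := Nat.pow_le_pow_right (by omega) (by omega)
    rw [Nat.testBit_lt_two_pow (by omega), Nat.testBit_lt_two_pow (by omega)]

theorem sum_natBits {R M : Type*} [Zero R] [One R] [NeZero (1 : R)] [Fintype R] [AddCommMonoid M]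
    (hR : Fintype.card R = 2) (n : ℕ) (F : (Fin n → R) → M) :
    ∑ a ∈ Finset.range (2 ^ n), F (natBits R n a) = ∑ b, F b := by
  classical
  rw [← Finset.sum_image (natBits_injOn R n)]
  congr 1
  apply Finset.eq_univ_of_card
  rw [Finset.card_image_of_injOn (natBits_injOn R n), Finset.card_range, Fintype.card_fun, hR,
    Fintype.card_fin]

theorem bitAt_eq_ite (a j : ℕ) : bitAt a j = if a.testBit j then 1 else 0 := by
  rw [bitAt, Nat.and_one_is_mod, Nat.shiftRight_eq_div_pow, ← Nat.toNat_testBit]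
  cases a.testBit j <;> rfl

theorem bitAt_cast {n : ℕ} (a : ℕ) (j : Fin n) : (bitAt a j : ZMod 2) = natBits (ZMod 2) n a j := by
  rw [bitAt_eq_ite, natBits]
  split_ifs <;> simp

/-- The kernel of the first `j` levels of the transform, at a position with bits `a` and `b`. -/
def walshKernel (j l : ℕ) (a b : Bool) : ℝ :=
  if l < j then (if a && b then -1 else 1) else (if a = b then 1 else 0)

/-- The transform is a tensor product over bit positions: after `j` levels the positions below `j`
carry the sign kernel `(-1)^(ab)`, and the others still carry a delta. -/
theorem walsh_eq_sum (f : ℕ → ℝ) (ν j : ℕ) (hj : j ≤ ν) (i : ℕ) (hi : i < 2 ^ ν) :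
    walsh f j i = ∑ t ∈ Finset.range (2 ^ ν),
      (∏ l ∈ Finset.range ν, walshKernel j l (i.testBit l) (t.testBit l)) * f t := by
  induction j generalizing i with
  | zero =>
    rw [Finset.sum_eq_single i]
    · simp [walsh, walshKernel]
    · intro t ht hti
      rw [Finset.mem_range] at ht
      obtain ⟨l, hl⟩ : ∃ l, i.testBit l ≠ t.testBit l := by
        by_contra! h
        exact hti (Nat.eq_of_testBit_eq h).symm
      have hlν : l < ν := by
        by_contra hlν
        have hle : 2 ^ ν ≤ 2 ^ l := Nat.pow_le_pow_right (by omega) (by omega)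
        rw [Nat.testBit_lt_two_pow (by omega), Nat.testBit_lt_two_pow (by omega)] at hl
        exact hl rfl
      rw [Finset.prod_eq_zero (Finset.mem_range.mpr hlν) (by simp [walshKernel, hl]), zero_mul]
    · exact fun h => absurd (Finset.mem_range.mpr hi) h
  | succ j ih =>
    have hx : i ^^^ 2 ^ j < 2 ^ ν :=
      Nat.xor_lt_two_pow hi (Nat.pow_lt_pow_right (by omega) (by omega))
    rw [walsh, ih (by omega) _ hx, ih (by omega) _ hi, Finset.mul_sum, ← Finset.sum_add_distrib]
    refine Finset.sum_congr rfl fun t _ => ?_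
    have hmem : j ∈ Finset.range ν := Finset.mem_range.mpr (by omega)
    -- Level `j` changes only the factor at position `j`; for `l ≠ j` the conditions `l < j` and `l
    -- < j + 1` agree.
    rw [← Finset.mul_prod_erase _ _ hmem, ← Finset.mul_prod_erase _ _ hmem,
      ← Finset.mul_prod_erase _ _ hmem]
    have h1 : ∏ l ∈ (Finset.range ν).erase j,
        walshKernel j l ((i ^^^ 2 ^ j).testBit l) (t.testBit l) =
        ∏ l ∈ (Finset.range ν).erase j, walshKernel (j + 1) l (i.testBit l) (t.testBit l) := by
      refine Finset.prod_congr rfl fun l hl => ?_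
      have hlj : l ≠ j := Finset.ne_of_mem_erase hl
      rw [Nat.testBit_xor, Nat.testBit_two_pow_of_ne hlj.symm, Bool.xor_false, walshKernel,
        walshKernel, if_congr (show l < j ↔ l < j + 1 by omega) rfl rfl]
    have h2 : ∏ l ∈ (Finset.range ν).erase j,
        walshKernel j l (i.testBit l) (t.testBit l) =
        ∏ l ∈ (Finset.range ν).erase j, walshKernel (j + 1) l (i.testBit l) (t.testBit l) := by
      refine Finset.prod_congr rfl fun l hl => ?_
      have hlj : l ≠ j := Finset.ne_of_mem_erase hl
      rw [walshKernel, walshKernel, if_congr (show l < j ↔ l < j + 1 by omega) rfl rfl]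
    rw [h1, h2, Nat.testBit_xor, Nat.testBit_two_pow_self, bitAt_eq_ite]
    generalize (∏ l ∈ (Finset.range ν).erase j,
      walshKernel (j + 1) l (i.testBit l) (t.testBit l)) = X
    cases i.testBit j <;> cases t.testBit j <;> simp [walshKernel]
    ring

theorem shift_natBits (n a b : ℕ) : 
    shift (natBits (Fin 2) n a) (natBits (ZMod 2) n b) = natBits (Fin 2) n (a ^^^ b) := by
  funext j
  simp only [shift, natBits, Nat.testBit_xor]
  by_cases h1 : a.testBit j <;> by_cases h2 : b.testBit j <;> simp [h1, h2]

/-- The full kernel is `(-1)^(z·s)`, the sign in `sq_expectation`. It is real, so real and imaginary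
parts are transformed separately. -/
theorem sq_expectation_eq_walsh {ν : ℕ} (φ : Bits ν → ℂ) {re im : ℕ → ℝ}
    (hre : ∀ i < 2 ^ ν, re i = (φ (natBits (Fin 2) ν i)).re)
    (him : ∀ i < 2 ^ ν, im i = (φ (natBits (Fin 2) ν i)).im)
    {a z : ℕ} (ha : a < 2 ^ ν) (hz : z < 2 ^ ν) :
    expectation φ (natBits (ZMod 2) ν a, natBits (ZMod 2) ν z) ^ 2 =
      walsh (productRe re im a) ν z ^ 2 + walsh (productIm re im a) ν z ^ 2 := by
  have hsign : ∀ t, zSign (natBits (ZMod 2) ν z) (natBits (Fin 2) ν t) =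
      ((∏ l ∈ Finset.range ν, walshKernel ν l (z.testBit l) (t.testBit l) : ℝ) : ℂ) := by
    intro t
    rw [zSign, Finset.prod_range fun l => walshKernel ν l (z.testBit l) (t.testBit l),
      Complex.ofReal_prod]
    refine Finset.prod_congr rfl fun l _ => ?_
    simp only [natBits, walshKernel, l.isLt, if_true]
    by_cases h1 : z.testBit l <;> by_cases h2 : t.testBit l <;> simp [h1, h2]
  rw [sq_expectation, ← sum_natBits (R := Fin 2) (Fintype.card_fin 2) ν fun s => zSign (natBits (ZMod 2) ν z) s *
    (star (φ s) * φ (shift s (natBits (ZMod 2) ν a))), Complex.normSq_apply, walsh_eq_sum _ ν ν le_rfl z hz,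
    walsh_eq_sum _ ν ν le_rfl z hz, Complex.re_sum, Complex.im_sum, sq, sq]
  have hval : ∀ t ∈ Finset.range (2 ^ ν), zSign (natBits (ZMod 2) ν z) (natBits (Fin 2) ν t) *
      (star (φ (natBits (Fin 2) ν t)) * φ (shift (natBits (Fin 2) ν t) (natBits (ZMod 2) ν a))) =
      ((∏ l ∈ Finset.range ν, walshKernel ν l (z.testBit l) (t.testBit l) : ℝ) : ℂ) *
        ⟨productRe re im a t, productIm re im a t⟩ := by
    intro t ht
    rw [Finset.mem_range] at ht
    have hx : t ^^^ a < 2 ^ ν := Nat.xor_lt_two_pow ht ha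
    rw [hsign, shift_natBits]
    congr 1
    apply Complex.ext
    · simp [productRe, hre _ ht, hre _ hx, him _ ht, him _ hx]
    · simp [productIm, hre _ ht, hre _ hx, him _ ht, him _ hx]; ring
  congr 2 <;>
  · refine Finset.sum_congr rfl fun t ht => ?_
    rw [hval t ht]
    simp only [Complex.re_ofReal_mul, Complex.im_ofReal_mul]

/-! ### The algorithm on its input -/

/-- Rank–nullity for the restriction of `f` to `J`; it converts the computed rank into `|S_A|`. -/
theorem finrank_map_add_finrank_inf_ker {K V V' : Type*} [Field K] [AddCommGroup V] [Module K V]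
    [AddCommGroup V'] [Module K V'] [Module.Finite K V] (f : V →ₗ[K] V') (J : Submodule K V) :
    Module.finrank K (J.map f) + Module.finrank K ↥(J ⊓ LinearMap.ker f) =
      Module.finrank K J := by
  have h := LinearMap.finrank_range_add_finrank_ker (f.comp J.subtype)
  rw [LinearMap.range_comp, Submodule.range_subtype, LinearMap.ker_comp] at h
  have hcomap : Submodule.comap J.subtype (LinearMap.ker f) =
      Submodule.comap J.subtype (J ⊓ LinearMap.ker f) := by
    ext v; simp
  rwa [hcomap, (Submodule.comapSubtypeEquivOfLe inf_le_left).finrank_eq] at h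

theorem span_image_extension {R V : Type*} [Semiring R] [AddCommMonoid V] [Module R V] {m : ℕ}
    (g : Fin m → V) :
    Submodule.span R ((fun i => if h : i < m then g ⟨i, h⟩ else 0) '' Set.Iio m) =
      Submodule.span R (Set.range g) := by
  congr 1
  ext v
  constructor
  · rintro ⟨i, hi, rfl⟩
    have hi : i < m := hi
    exact ⟨⟨i, hi⟩, by simp [hi]⟩
  · rintro ⟨i, rfl⟩
    exact ⟨i, i.isLt, by simp⟩

/-- The labels `𝒫_B (C† X_{m+j} C)` and `𝒫_B (C† Z_{m+j} C)`, depending on the choice of the kind of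
generator. -/
def maskedTableau {m ν : ℕ} (T : Fin (m + ν) ⊕ Fin (m + ν) → PauliLabel (m + ν))
    (A : Finset (Fin (m + ν))) (kind : Fin (m + ν) → Fin (m + ν) ⊕ Fin (m + ν)) (j : ℕ) :
    PauliLabel (m + ν) :=
  if h : j < ν then projB A (T (kind (Fin.natAdd m ⟨j, h⟩))) else 0

theorem onLast_eq_sum {m ν : ℕ} (p : PauliLabel ν) :
    onLast m p = ∑ j : Fin ν, (p.1 j • pauliGen (.inl (Fin.natAdd m j)) +
      p.2 j • pauliGen (.inr (Fin.natAdd m j))) := by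
  have key : ∀ (q : Fin ν → ZMod 2) (i : Fin (m + ν)),
      Fin.append (0 : Fin m → ZMod 2) q i =
        ∑ j, q j * (Pi.single (Fin.natAdd m j) 1 : Fin (m + ν) → ZMod 2) i := by
    intro q i
    refine Fin.addCases (fun i => ?_) (fun i => ?_) i
    · rw [Fin.append_left, Finset.sum_eq_zero]
      · rfl
      · intro j _
        have hne : Fin.castAdd ν i ≠ Fin.natAdd m j := by
          simp only [ne_eq, Fin.ext_iff, Fin.val_natAdd, Fin.val_castAdd]; omega
        rw [Pi.single_eq_of_ne hne, mul_zero]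
    · rw [Fin.append_right, Finset.sum_eq_single i]
      · simp
      · intro j _ hj
        have hne : Fin.natAdd m i ≠ Fin.natAdd m j := by
          simpa using hj.symm
        rw [Pi.single_eq_of_ne hne, mul_zero]
      · simp
  refine Prod.ext (funext fun i => ?_) (funext fun i => ?_)
  · refine (key p.1 i).trans ?_
    simp [pauliGen, Prod.fst_sum]
  · refine (key p.2 i).trans ?_
    simp [pauliGen, Prod.snd_sum]

/-- The tableau lists the values of the linear map `τ.symm` on the generators, so `τ.symm (1 ⊗ P)`
is the combination with the bits of `P` as coefficients. -/
theorem bitCombination_eq {m ν : ℕ} {C : Op (m + ν)} (hC : IsClifford C)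
    {T : Fin (m + ν) ⊕ Fin (m + ν) → PauliLabel (m + ν)} (hT : IsTableau C T)
    {τ : PauliLabel (m + ν) ≃ₗ[ZMod 2] PauliLabel (m + ν)} (hτ : ∀ v w, ConjTo C v w ↔ τ v = w)
    (A : Finset (Fin (m + ν))) (a z : ℕ) :
    bitCombination (maskedTableau T A .inl) (maskedTableau T A .inr) a z ν =
      projB A (τ.symm (onLast m (natBits (ZMod 2) ν a, natBits (ZMod 2) ν z))) := by
  have hgen : ∀ j, τ.symm (pauliGen j) = T j := fun j => by
    rw [LinearEquiv.symm_apply_eq, eq_comm, ← hτ, ← hC.conjTo_symm]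
    exact hT j
  rw [onLast_eq_sum, bitCombination, Finset.sum_range, map_sum, map_sum]
  refine Finset.sum_congr rfl fun j _ => ?_
  simp only [map_add, map_smul, hgen, maskedTableau, j.isLt, dif_pos, bitAt_cast]

theorem labelBit_projB {n : ℕ} (A : Finset (Fin n)) (v : PauliLabel n) {mask : ℕ → ℕ}
    (h1 : ∀ c : Fin n, mask c = if c ∈ A then 0 else 1)
    (h2 : ∀ c : Fin n, mask (n + c) = if c ∈ A then 0 else 1) {c : ℕ} (hc : c < 2 * n) :
    mask c &&& labelBit v c = (coord n c (projB A v)).val := by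
  have key : ∀ x : ZMod 2, ∀ p : Prop, [Decidable p] →
      (if p then 0 else 1) &&& x.val = (if p then 0 else x).val := by
    intro x p _
    by_cases hp : p
    · simp [hp]
    · simp only [hp, if_false]
      revert x; decide
  rw [coord_val]
  by_cases h : c < n
  · simp only [labelBit, h, dif_pos, projB, LinearMap.coe_mk, AddHom.coe_mk]
    rw [← key, ← h1 ⟨c, h⟩]
  · obtain ⟨d, rfl⟩ : ∃ d, c = n + d := ⟨c - n, by omega⟩
    have hd : d < n := by omega
    have hd' : n + d - n = d := by omega
    simp only [labelBit, h, dif_neg, hd', hd, dif_pos, projB, LinearMap.coe_mk, AddHom.coe_mk,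
      not_false_iff]
    rw [← key, ← h2 ⟨d, hd⟩]

section

variable {m ν : ℕ} {C : Op (m + ν)} {T : Fin (m + ν) ⊕ Fin (m + ν) → PauliLabel (m + ν)}

theorem sum_contribution (hC : IsClifford C) (hT : IsTableau C T)
    (J : Submodule (ZMod 2) (PauliLabel (m + ν))) (A : Finset (Fin (m + ν))) (φ : Bits ν → ℂ)
    {re im : ℕ → ℝ} (hre : ∀ i < 2 ^ ν, re i = (φ (natBits (Fin 2) ν i)).re)
    (him : ∀ i < 2 ^ ν, im i = (φ (natBits (Fin 2) ν i)).im) :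
    ∑ a ∈ Finset.range (2 ^ ν), ∑ z ∈ Finset.range (2 ^ ν),
      contribution (J.map (projB A)) (maskedTableau T A .inl) (maskedTableau T A .inr) re im
        ν a z = entropySum J C φ A := by
  classical
  obtain ⟨τ, hτ⟩ := hC.exists_equiv
  rw [entropySum_eq hC hτ, Fintype.sum_prod_type, ← sum_natBits (ZMod.card 2)]
  refine Finset.sum_congr rfl fun a ha => ?_
  rw [← sum_natBits (ZMod.card 2)]
  refine Finset.sum_congr rfl fun z hz => ?_
  rw [contribution, bitCombination_eq hC hT hτ,
    ← sq_expectation_eq_walsh φ hre him (Finset.mem_range.mp ha) (Finset.mem_range.mp hz)]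

theorem entropy_run {W : ℕ} (hpos : 0 < m + ν)
    (words : 4 * ((m + ν) * (m + ν)) + 20 < W) (levels : (ν + 2) * 2 ^ ν + 20 < W)
    (hC : IsClifford C) (hT : IsTableau C T) {J : Submodule (ZMod 2) (PauliLabel (m + ν))}
    {g : Fin m → PauliLabel (m + ν)} (hg : LinearIndependent (ZMod 2) g)
    (hgJ : Submodule.span (ZMod 2) (Set.range g) = J) (A : Finset (Fin (m + ν))) (x : Bits m)
    {φ : Bits ν → ℂ} (hφ : φ ≠ 0) :
    Spec W .entropy (inputMemory g T A x φ) (20000 * ((m + ν) ^ 3 * (2 ^ ν) ^ 2))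
      fun s' => s'.output = entropyValue J C φ A := by
  set s := inputMemory g T A x φ with hs
  -- The indicator of `B`, repeated for the X- and the Z-columns, so that a bitwise AND realizes
  -- `projB` (`labelBit_projB`).
  set mask : ℕ → ℕ := fun c => 1 - s.word 1 (if c < m + ν then c else c - (m + ν)) with hmask
  set u : ℕ → PauliLabel (m + ν) := fun i => if h : i < m then projB A (g ⟨i, h⟩) else 0 with hu
  have hw1 : ∀ c : Fin (m + ν), s.word 1 c = if c ∈ A then 1 else 0 := fun c => by
    simp [hs, inputMemory]
  have hm1 : ∀ c < m + ν, mask c = 1 - s.word 1 c := fun c hc => by simp only [hmask, hc, if_true]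
  have hm2 : ∀ c < m + ν, mask (m + ν + c) = 1 - s.word 1 c := fun c hc => by
    simp [hmask]
  have hM1 : ∀ c : Fin (m + ν), mask c = if c ∈ A then 0 else 1 := fun c => by
    rw [hm1 c c.isLt, hw1]; split_ifs <;> rfl
  have hM2 : ∀ c : Fin (m + ν), mask (m + ν + c) = if c ∈ A then 0 else 1 := fun c => by
    rw [hm2 c c.isLt, hw1]; split_ifs <;> rfl
  have hdiv : ∀ r c, c < 2 * (m + ν) → (r * (2 * (m + ν)) + c) / (2 * (m + ν)) = r :=
    fun r c hc => by
      rw [mul_comm, Nat.mul_add_div (by omega), Nat.div_eq_of_lt hc, add_zero]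
  have hmod : ∀ r c, c < 2 * (m + ν) → (r * (2 * (m + ν)) + c) % (2 * (m + ν)) = c :=
    fun r c hc => by
      rw [mul_comm, Nat.mul_add_mod, Nat.mod_eq_of_lt hc]
  have hre : ∀ i < 2 ^ ν, s.real 0 i = (φ (natBits (Fin 2) ν i)).re := fun i hi => by
    simp only [hs, inputMemory, hi, if_true]; rfl
  have him : ∀ i < 2 ^ ν, s.real 1 i = (φ (natBits (Fin 2) ν i)).im := fun i hi => by
    simp only [hs, inputMemory, hi, if_true]; rfl
  have hspan : Submodule.span (ZMod 2) (u '' Set.Iio m) = J.map (projB A) := by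
    rw [hu, span_image_extension fun i => projB A (g i), ← hgJ, Submodule.map_span,
      ← Set.range_comp]
    rfl
  have hsum : ∑ a ∈ Finset.range (2 ^ ν), ∑ z ∈ Finset.range (2 ^ ν),
      contribution (Submodule.span (ZMod 2) (u '' Set.Iio m)) (maskedTableau T A .inl)
        (maskedTableau T A .inr) (s.real 0) (s.real 1) ν a z = entropySum J C φ A := by
    rw [hspan, sum_contribution hC hT J A φ hre him]
  refine (entropy_spec (u := u) (tx := maskedTableau T A .inl) (tz := maskedTableau T A .inr)
    (mask := mask) hpos words levels rfl rfl ?_ ?_ rfl hm1 hm2 ?_ ?_ ?_ ?_).mono le_rfl ?_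
  · intro c
    simp only [hs, inputMemory]
    split_ifs <;> omega
  · intro b hb i
    obtain ⟨d, rfl⟩ : ∃ d, b = d + 5 := ⟨b - 5, by omega⟩
    rfl
  · intro i hi c hc
    rw [show u i = projB A (g ⟨i, hi⟩) by simp [hu, hi], ← labelBit_projB A _ hM1 hM2 hc]
    simp only [hs, inputMemory, hdiv i c hc, hmod i c hc, hi, dif_pos]
  · intro j hj c hc
    rw [maskedTableau, dif_pos hj, ← labelBit_projB A _ hM1 hM2 hc]
    have h1 : m + j < m + ν := by omega
    simp only [hs, inputMemory, hdiv (m + j) c hc, hmod (m + j) c hc, h1, dif_pos]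
    rfl
  · intro j hj c hc
    rw [maskedTableau, dif_pos hj, ← labelBit_projB A _ hM1 hM2 hc]
    have h1 : ¬ m + ν + (m + j) < m + ν := by omega
    have h2 : m + ν + (m + j) - (m + ν) = m + j := by omega
    have h3 : m + j < m + ν := by omega
    simp only [hs, inputMemory, hdiv (m + ν + (m + j)) c hc, hmod (m + ν + (m + j)) c hc, h1, h2,
      h3, dif_pos, dif_neg, not_false_iff]
    rfl
  · rw [hsum]; exact entropySum_pos hC hφ A
  · intro s' hs'
    have hJ : Module.finrank (ZMod 2) J = m := by
      rw [← hgJ, finrank_span_eq_card hg, Fintype.card_fin]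
    have hrank := finrank_map_add_finrank_inf_ker (projB A) J
    have hcard : ∑ c ∈ Finset.range (m + ν), s.word 1 c = A.card := by
      rw [Finset.sum_range, Finset.sum_congr rfl fun c _ => hw1 c]
      simp
    rw [hs', hsum, hspan, hcard, entropyValue]
    -- Since `g` is independent, `dim J = m`, and the computed `m - rank` is `|S_A|`.
    have : (m : ℝ) = Module.finrank (ZMod 2) (J.map (projB A)) +
        Module.finrank (ZMod 2) ↥(J ⊓ LinearMap.ker (projB A)) := by
      rw [← Nat.cast_add, hrank, hJ]
    rw [this]
    ring

end

/-- All addresses are quadratic in `n + 2^ν`, so a word range polynomial in it, that is `O(log (n +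
2^ν))` bits, suffices. -/
theorem word_bounds {m ν c : ℕ} (hc : 1000 ≤ c) :
    4 * ((m + ν) * (m + ν)) + 20 < c * ((m + ν) + 2 ^ ν) ^ c ∧
      (ν + 2) * 2 ^ ν + 20 < c * ((m + ν) + 2 ^ ν) ^ c := by
  have hN : 0 < 2 ^ ν := by positivity
  have hν : ν < 2 ^ ν := Nat.lt_two_pow_self
  generalize 2 ^ ν = N at *
  have hX : (m + ν + N) ^ 2 ≤ (m + ν + N) ^ c := Nat.pow_le_pow_right (by omega) (by omega)
  have h1 : 1000 * (m + ν + N) ^ 2 ≤ c * (m + ν + N) ^ c := Nat.mul_le_mul hc hX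
  have h2 : 1 ≤ N * N := Nat.mul_pos hN hN
  have h3 : (ν + 2) * N ≤ (N + 2) * N := Nat.mul_le_mul_right _ (by omega)
  have h4 : N ≤ N * N := Nat.le_mul_of_pos_right _ hN
  have h5 : (m + ν + N) ^ 2 = (m + ν) * (m + ν) + 2 * ((m + ν) * N) + N * N := by ring
  rw [add_mul N 2] at h3
  constructor <;> omega

theorem theorem5 :
    -- one program and one constant for all systems, states and bipartitions
    ∃ (prog : Prog) (c : ℕ),
      ∀ (m ν k : ℕ), 0 < m + ν →
      -- the maximally commuting Pauli group `G` and the Hamiltonian `H = H₀ + δH`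
      ∀ (G : Submodule (ZMod 2) (PauliLabel (m + ν))),
      (∀ v ∈ G, ∀ w ∈ G, Commute (pauli v) (pauli w)) →
      Module.finrank (ZMod 2) G = m + ν →
      ∀ (α : PauliLabel (m + ν) → ℝ) (P : Fin k → PauliLabel (m + ν)) (γ : Fin k → ℝ),
      -- the group `J ⊆ G ∩ K^⊥` of dimension `m = n - ν ≥ n - |K|`, given by generators `g`
      ∀ (J : Submodule (ZMod 2) (PauliLabel (m + ν))) (g : Fin m → PauliLabel (m + ν)),
      J ≤ G →
      (∀ v ∈ J, ∀ i, Commute (pauli v) (pauli (P i))) →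
      LinearIndependent (ZMod 2) g →
      Submodule.span (ZMod 2) (Set.range g) = J →
      ν ≤ groupDim P →
      -- the Clifford unitary `C` with `C J C† = ⟨Z₁, …, Z_m⟩` up to signs, and its tableau
      ∀ (C : Op (m + ν)) (T : Fin (m + ν) ⊕ Fin (m + ν) → PauliLabel (m + ν)),
      IsClifford C → MapsToZ C J → IsTableau C T →
      -- the eigenstate `ψ` of `H`, which is also an eigenstate of all elements of `J`
      ∀ (ψ : Bits (m + ν) → ℂ) (E : ℝ),
      ∑ s, ‖ψ s‖ ^ 2 = 1 →
      hamiltonian G α P γ *ᵥ ψ = (E : ℂ) • ψ →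
      (∀ v ∈ J, pauli v *ᵥ ψ = ψ ∨ pauli v *ᵥ ψ = -ψ) →
      ∃ (x : Bits m) (φ : Bits ν → ℂ), C *ᵥ ψ = prodState x φ ∧
        ∀ (A : Finset (Fin (m + ν))),
          entropyValue J C φ A = renyiTwo ψ A ∧
          ∃ (t : ℕ) (s : Memory),
            Runs (c * ((m + ν) + 2 ^ ν) ^ c) prog (inputMemory g T A x φ) t s ∧
            s.output = renyiTwo ψ A ∧
            t ≤ c * ((m + ν) ^ 3 * 2 ^ (2 * groupDim P)) := by
  -- The constant of `entropy_cost_le`, kept opaque so that powers with exponent `c` stay symbolic.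
  obtain ⟨c, hc⟩ : ∃ c : ℕ, 20000 ≤ c := ⟨20000, le_rfl⟩
  refine ⟨.entropy, c, ?_⟩
  intro m ν k hpos G _ _ α P γ J g _ _ hg hgJ hν C T hC hJ hT ψ E hnorm _ heig
  have hψ : ψ ≠ 0 := by
    rintro rfl
    simp at hnorm
  obtain ⟨x, φ, hprod, hφ⟩ := exists_prodState hC hJ hψ heig
  refine ⟨x, φ, hprod, fun A => ?_⟩
  have hval := entropyValue_eq_renyiTwo hC hJ hprod hφ A
  obtain ⟨hw, hl⟩ := word_bounds (m := m) (ν := ν) (c := c) (by omega)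
  obtain ⟨t, s, hrun, ht, hout⟩ := entropy_run hpos hw hl hC hT hg hgJ A x hφ
  refine ⟨hval, t, s, hrun, hout.trans hval, ht.trans (Nat.mul_le_mul hc ?_)⟩
  refine Nat.mul_le_mul_left _ ?_
  -- The running time is governed by `4^ν`, and `ν ≤ |K|`.
  rw [← pow_mul, mul_comm ν 2]
  exact Nat.pow_le_pow_right (by omega) (by omega)
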